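/- Put $w=(1,1,\tfrac15,\tfrac15)$ and $d=\tfrac45$. The algebraic Frobenius manifold $H_4(4)$ has flat coordinates $t=(t_1,\dots,t_4)$, Euler vector field $E=\sum_\lambda w_\lambda t_\lambda\partial_{t_\lambda}$, charge $d$, and prepotential \begin{align*} F(t)=& \, -\frac{25}{33}Z^{11}+\frac{1}{2}Z^{10} (-4 t_3 - 5 t_4)-\frac{125}{9}Z^9 (t_3 + t_4) (t_3 + 3 t_4)-5 Z^8 (8 t_3^3 + 57 t_3^2 t_4 \\ &+ 124 t_3 t_4^2 + 95 t_4^3)-\frac{35}{3} Z^6 (t_3 + t_4) (t_3 + 3 t_4) (12 t_3^3 + 123 t_3^2 t_4 + 336 t_3 t_4^2 + 305 t_4^3) \\ &- 10 Z^7 (5 t_3^4 + 64 t_3^3 t_4 + 236 t_3^2 t_4^2 + 344 t_3 t_4^3 + 175 t_4^4)+ Z^5 (135 t_3^6 - 840 t_3^5 t_4 \\ &- 17130 t_3^4 t_4^2 - 80920 t_3^3 t_4^3 - 174765 t_3^2 t_4^4 - 181952 t_3 t_4^5 - 74420 t_4^6) \\ &+ 5 Z t_4 (t_3 + t_4)^2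 (t_3 + 3 t_4)^2 (180 t_3^5 + 2115 t_3^4 t_4 + 11760 t_3^3 t_4^2 + 30270 t_3^2 t_4^3 \\ &+ 32316 t_3 t_4^4 + 9035 t_4^5)+\frac{5}{3}Z^3 (t_3 + t_4) (t_3 + 3 t_4) (-45 t_3^6 + 1260 t_3^5 t_4 + 13185 t_3^4 t_4^2 \\ &+ 42360 t_3^3 t_4^3 + 58125 t_3^2 t_4^4 + 37788 t_3 t_4^5 + 15815 t_4^6) - 100 Z^4 (-6 t_3^7 - 87 t_3^6 t_4 \\ &- 450 t_3^5 t_4^2 - 1015 t_3^4 t_4^3 - 650 t_3^3 t_4^4 + 1283 t_3^2 t_4^5 + 2450 t_3 t_4^6 + 1195 t_4^7) \\ &-\frac{5}{6}Z^2 (540 t_3^9 + 9315 t_3^8 t_4 + 73440 t_3^7 t_4^2 + 356940 t_3^6 t_4^3 + 1252440 t_3^5 t_4^4 \\ &+3321450 t_3^4 t_4^5 + 6239424 t_3^3 t_4^6 + 7356636 t_3^2 t_4^7 + 4563564 t_3 t_4^8 + 994315 t_4^9) \\ &+\frac{1}{198}(198 t_1 t_2 t_3 + 99 t_1^2 t_4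 - 4455 t_3^{10} t_4 - 178200 t_3^9 t_4^2 - 2569050 t_3^8 t_4^3 \\ &- 21740400 t_3^7 t_4^4 - 120561210 t_3^6 t_4^5 - 458678880 t_3^5 t_4^6 - 1191552120 t_3^4 t_4^7 \\ &- 2004227280 t_3^3 t_4^8 - 1955070535 t_3^2 t_4^9 - 858257224 t_3 t_4^{10} - 45669270 t_4^{11}), \end{align*} where $Z$ satisfies \begin{align*} P(t_2, t_3, t_4, Z):=& \, Z^5 - t_2 + 15 t_3^4 t_4 + 120 t_3^3 t_4^2 + 530 t_3^2 t_4^3 + 1160 t_3 t_4^4 + 843 t_4^5 \\ &+ 10 Z^3 (t_3 + t_4) (t_3 + 3 t_4) - 15 Z (t_3 + t_4)^2 (t_3 + 3 t_4)^2 \\ &+ 20 Z^2 t_4 (3 t_3^2 + 12 t_3 t_4 + 13 t_4^2)=0. \end{align*} A branch of $Z$ on an open set $U\subseteq\mathbb C^4$ is a holomorphic function $Z=Z(t)$ on $U$ with $P(t_2,t_3,t_4,Z(t))=0$. Given a branch, regard $F$ as a function of $t\in U$ and put $c_{ijk}=\partial^3F/\partial t_i\partial t_j\partial t_k$, $\eta_{ij}=c_{ij1}$,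 $(\eta^{ij})=(\eta_{ij})^{-1}$, $c^{ij}_k=\sum_{\lambda,\mu}\eta^{i\lambda}\eta^{j\mu}c_{\lambda\mu k}$. The intersection form is $g^{ij}(t)=\sum_\lambda w_\lambda t_\lambda c^{ij}_\lambda(t)$. Flat coordinates of the intersection form on an open set $V\subseteq U$ are holomorphic functions $x=(x_1,\dots,x_4)$ on $V$ with $$\sum_{\lambda,\mu}g^{\lambda\mu}(t)\frac{\partial x_i}{\partial t_\lambda}\frac{\partial x_j}{\partial t_\mu}=\delta_{ij},\qquad E(x_i)=\frac{1-d}2\,x_i\qquad(1\le i,j\le4).$$ Let $y_1(x),\dots,y_4(x)$ be the following basic invariants of the Coxeter group $H_4$, of degrees $30,20,12,2$: \begin{align*} y_1=& \, \frac{32}{3}x_1^{24}h_2^3-40x_1^{22}\left(2h_2^4+3h_2h_6\right)+x_1^{20}\left(360h_{10}+\frac{1344}{5}h_2^5+672h_2^2h_6\right) \\ &+x_1^{18}\left(1080h_6^2-1608h_2^3h_6-\frac{1328}{3}h_2^6-2880h_{10}h_2\right) \\ &+x_1^{16}\left(10024h_{10}h_2^2+272h_2^7+1248h_2^4h_6-5628h_2h_6^2\right)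 \\ &+x_1^{14}\left(18588h_2^2h_6^2+272h_2^8-7620h_{10}h_6-16856h_{10}h_2^3\right) \\ &+x_1^{12}\left(14216h_{10}h_2^4+23508h_{10}h_6h_2-\frac{1328}{3}h_2^9-1248h_6h_2^6-27396h_6^2h_2^3 \right. \\ &\biggl. -5796h_6^3\biggr)+x_1^{10}\left(3240h_{10}^2-7160h_{10}h_2^5-25332h_{10}h_6h_2^2+\frac{1344}{5}h_2^{10} \right. \\ &\biggl. +1608h_2^7h_6+19968h_2^4h_6^2+7350h_2h_6^3\biggr)+x_1^8\left(2144h_{10}h_2^6-3232h_{10}^2h_2 \right. \\ &\left. +10908h_{10}h_2^3h_6-906h_{10}h_6^2-80h_2^{11}-672h_2^8h_6-6924h_2^5h_6^2-1956h_2^2h_6^3\right) \\ &+x_1^6\left(1168h_{10}^2h_2^2-344h_{10}h_2^7-2172h_{10}h_2^4h_6-1908h_{10}h_2h_6^2+\frac{32}{3}h_2^{12} \right. \\ &\biggl. +120h_2^9h_6+1332h_2^6h_6^2+288h_2^3h_6^3+2394h_6^4\biggr)+x_1^4\left(348h_{10}^2h_6-152h_{10}^2h_2^3 \right. \\ &\left.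 +16h_{10}h_2^8+60h_{10}h_6h_2^5+408h_{10}h_6^2h_2^2-84h_2^7h_6^2+84h_2^4h_6^3-909h_2h_6^4\right) \\ &+x_1^2\left(8h_{10}^2h_2^4-42h_{10}h_6^2h_2^3-87h_{10}h_6^3-6h_2^5h_6^3+135h_2^2h_6^4\right) \\ &+\frac{4}{3}h_{10}^3-3h_{10}h_2h_6^3+\frac{9}{5}h_6^5, \\ y_2=& \, 4x_1^{16}h_2^2-10x_1^{14}\left(2h_2^3+3h_6\right)+x_1^{12}\left(44h_2^4+138h_2h_6\right) \\ &+x_1^{10}\left(180h_{10}-44h_2^5-402h_2^2h_6\right)+x_1^8\left(44h_2^6-464h_{10}h_2+402h_2^3h_6+294h_6^2\right) \\ &+x_1^6\left(296h_{10}h_2^2-20h_2^7-138h_2^4h_6-306h_2h_6^2\right)+x_1^4\left(4h_2^8-76h_{10}h_2^3-114h_{10}h_6 \right. \\ &\left. +30h_2^5h_6+168h_2^2h_6^2\right)+x_1^2\left(4h_{10}h_2^4-21h_2^3h_6^2+\frac{57}{2}h_6^3\right)+h_{10}^2-\frac{3}{2}h_2h_6^3, \\ y_3=& \, -2x_1^{10}h_2+6x_1^8h_2^2+x_1^6\left(33h_6-14h_2^3\right)-x_1^4\left(33h_2h_6-6h_2^4\right)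 \\ &+x_1^2\left(11h_{10}-2h_2^5\right)-h_{10}h_2+\frac{3}{2}h_6^2, \\ y_4=& \, x_1^2+h_2, \end{align*} where \begin{align*} h_2=& \, \epsilon_1, \\ h_6=& \, \sqrt{5}\delta+\epsilon_1\epsilon_2-11\epsilon_3, \\ h_{10}=& \, 95\epsilon_2\epsilon_3-32\epsilon_1^2\epsilon_3-5\epsilon_1\epsilon_2^2+2\epsilon_1^3\epsilon_2+3\sqrt{5}\delta\epsilon_2, \end{align*} and \begin{align*} \epsilon_1=& \, x_2^2+x_3^2+x_4^2, \\ \epsilon_2=& \, x_2^2x_3^2+x_2^2x_4^2+x_3^2x_4^2, \\ \epsilon_3=& \, x_2^2x_3^2x_4^2, \\ \delta=& \, (x_2^2-x_3^2)(x_2^2-x_4^2)(x_3^2-x_4^2). \end{align*} Consider the relations \begin{align*} y_1=& \, -\frac{2^{19}5^9}{3^{13}7}\left(42 t_1^2 t_2 - 168 t_1 t_2^2 + 168 t_2^3 - 210 Z^4 t_1 t_2 t_3 + 420 Z^4 t_2^2 t_3+ 1050 Z^3 t_2^2 t_3^2 \right. \\ &+ 2100 Z^2 t_1 t_2 t_3^3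 - 4200 Z^2 t_2^2 t_3^3 + 27300 Z t_2^2 t_3^4 + 89250 t_1 t_2 t_3^5 - 178500 t_2^2 t_3^5 \\ &+ 228620 Z^4 t_2 t_3^6 + 114240 Z^3 t_1 t_3^7 - 228480 Z^3 t_2 t_3^7 + 2465680 Z^2 t_2 t_3^8 \\ &- 141120 Z t_1 t_3^9 + 282240 Z t_2 t_3^9 - 5667634 t_2 t_3^{10} - 13482560 Z^3 t_3^{12} \\ &+ 42611520 Z t_3^{14} - 420 Z^4 t_1 t_2 t_4 + 1050 Z^4 t_2^2 t_4 - 1890 Z^3 t_1 t_2 t_3 t_4 + 7980 Z^3 t_2^2 t_3 t_4 \\ &+ 12600 Z^2 t_1 t_2 t_3^2 t_4 - 20790 Z^2 t_2^2 t_3^2 t_4 - 104580 Z t_1 t_2 t_3^3 t_4 + 427560 Z t_2^2 t_3^3 t_4 \\ &- 164430 t_1^2 t_3^4 t_4 + 1550220 t_1 t_2 t_3^4 t_4 - 2334570 t_2^2 t_3^4 t_4 - 46620 Z^4 t_1 t_3^5 t_4 \\ &+ 2836680 Z^4 t_2 t_3^5 t_4 + 1599360 Z^3 t_1 t_3^6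 t_4 - 2240700 Z^3 t_2 t_3^6 t_4 - 15120 Z^2 t_1 t_3^7 t_4 \\ &+ 39481120 Z^2 t_2 t_3^7 t_4 - 2540160 Z t_1 t_3^8 t_4 + 38725680 Z t_2 t_3^8 t_4 + 28513800 t_1 t_3^9 t_4 \\ &- 170380280 t_2 t_3^9 t_4 + 16561860 Z^4 t_3^{10} t_4 - 323581440 Z^3 t_3^{11} t_4 - 64723680 Z^2 t_3^{12} t_4 \\ &+ 1193122560 Z t_3^{13} t_4 - 29292690 t_3^{14} t_4 - 3780 Z^3 t_1 t_2 t_4^2 + 8820 Z^3 t_2^2 t_4^2 \\ &+ 23100 Z^2 t_1 t_2 t_3 t_4^2 - 28560 Z^2 t_2^2 t_3 t_4^2 - 627480 Z t_1 t_2 t_3^2 t_4^2 + 1892100 Z t_2^2 t_3^2 t_4^2 \\ &- 1315440 t_1^2 t_3^3 t_4^2 + 8585220 t_1 t_2 t_3^3 t_4^2 - 11043480 t_2^2 t_3^3 t_4^2 - 466200 Z^4 t_1 t_3^4 t_4^2 \\ &+ 15817200 Z^4 t_2 t_3^4 t_4^2 + 9705150 Z^3 t_1 t_3^5 t_4^2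 - 7914060 Z^3 t_2 t_3^5 t_4^2 - 211680 Z^2 t_1 t_3^6 t_4^2 \\ &+ 289891980 Z^2 t_2 t_3^6 t_4^2 - 17575740 Z t_1 t_3^7 t_4^2 + 573477240 Z t_2 t_3^7 t_4^2 + 513248400 t_1 t_3^8 t_4^2 \\ &- 1955803360 t_2 t_3^8 t_4^2 + 331237200 Z^4 t_3^9 t_4^2 - 3429078870 Z^3 t_3^{10} t_4^2 - 1553368320 Z^2 t_3^{11} t_4^2 \\ &+ 14721448140 Z t_3^{12} t_4^2 - 820195320 t_3^{13} t_4^2 + 12600 Z^2 t_1 t_2 t_4^3 - 3290 Z^2 t_2^2 t_4^3 \\ &- 1244460 Z t_1 t_2 t_3 t_4^3 + 3290280 Z t_2^2 t_3 t_4^3 - 3844260 t_1^2 t_3^2 t_4^3 - 450 Z^5 t_2 t_3^2 t_4^3 \\ &+ 21037800 t_1 t_2 t_3^2 t_4^3 - 24410930 t_2^2 t_3^2 t_4^3 - 1773240 Z^4 t_1 t_3^3 t_4^3 + 49466480 Z^4 t_2 t_3^3 t_4^3 \\ &+ 225 Z^8 t_3^4 t_4^3 + 33077100 Z^3 t_1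 t_3^4 t_4^3 - 11938395 Z^3 t_2 t_3^4 t_4^3 - 3845520 Z^2 t_1 t_3^5 t_4^3 \\ &+ 1272065200 Z^2 t_2 t_3^5 t_4^3 - 2700 Z^6 t_3^6 t_4^3 - 56395080 Z t_1 t_3^6 t_4^3 + 3895595560 Z t_2 t_3^6 t_4^3 \\ &+ 4000050600 t_1 t_3^7 t_4^3 - 11987148880 t_2 t_3^7 t_4^3 + 2939165645 Z^4 t_3^8 t_4^3 \\ &- 21122966200 Z^3 t_3^9 t_4^3 - 17379662880 Z^2 t_3^{10} t_4^3 + 105145262880 Z t_3^{11} t_4^3 \\ &- 6999178480 t_3^{12} t_4^3 - 815640 Z t_1 t_2 t_4^4 + 2080680 Z t_2^2 t_4^4 - 4853520 t_1^2 t_3 t_4^4 \\ &- 1800 Z^5 t_2 t_3 t_4^4 + 23828490 t_1 t_2 t_3 t_4^4 - 26013980 t_2^2 t_3 t_4^4 - 3180240 Z^4 t_1 t_3^2 t_4^4 \\ &+ 91783860 Z^4 t_2 t_3^2 t_4^4 + 1800 Z^8 t_3^3 t_4^4 + 69522180 Z^3 t_1 t_3^3 t_4^4 - 11884320 Z^3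 t_2 t_3^3 t_4^4 \\ &+ 5400 Z^7 t_3^4 t_4^4 - 29988000 Z^2 t_1 t_3^4 t_4^4 + 3617141020 Z^2 t_2 t_3^4 t_4^4 - 32400 Z^6 t_3^5 t_4^4 \end{align*} \begin{align*} &- 38118780 Z t_1 t_3^5 t_4^4 + 15323659800 Z t_2 t_3^5 t_4^4 - 25650 Z^5 t_3^6 t_4^4 + 17678161200 t_1 t_3^6 t_4^4 \\ &- 44692143980 t_2 t_3^6 t_4^4 + 15227879120 Z^4 t_3^7 t_4^4 - 83502915015 Z^3 t_3^8 t_4^4 \\ &- 119765904000 Z^2 t_3^9 t_4^4 + 469572887280 Z t_3^{10} t_4^4 + 2620343040 t_3^{11} t_4^4 - 2164806 t_1^2 t_4^5 \\ &- 1350 Z^5 t_2 t_4^5 + 10008684 t_1 t_2 t_4^5 - 11210172 t_2^2 t_4^5 - 2653140 Z^4 t_1 t_3 t_4^5 \\ &+ 96693240 Z^4 t_2 t_3 t_4^5 + 4950 Z^8 t_3^2 t_4^5 + 92617560 Z^3 t_1 t_3^2 t_4^5 - 43361430 Z^3 t_2 t_3^2 t_4^5 \\ &+ 43200 Z^7 t_3^3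 t_4^5 - 113047200 Z^2 t_1 t_3^3 t_4^5 + 6749433120 Z^2 t_2 t_3^3 t_4^5 - 121500 Z^6 t_3^4 t_4^5 \\ &+ 357293160 Z t_1 t_3^4 t_4^5 + 38092662600 Z t_2 t_3^4 t_4^5 - 307800 Z^5 t_3^5 t_4^5 + 49036806000 t_1 t_3^5 t_4^5 \\ &- 108705602416 t_2 t_3^5 t_4^5 + 50844400500 Z^4 t_3^6 t_4^5 - 219447220080 Z^3 t_3^7 t_4^5 \\ &- 570111869640 Z^2 t_3^8 t_4^5 + 1249790969280 Z t_3^9 t_4^5 + 479633884512 t_3^{10} t_4^5 - 803880 Z^4 t_1 t_4^6 \\ &+ 45585960 Z^4 t_2 t_4^6 + 5400 Z^8 t_3 t_4^6 + 74024790 Z^3 t_1 t_3 t_4^6 - 107328900 Z^3 t_2 t_3 t_4^6 \\ &+ 126000 Z^7 t_3^2 t_4^6 - 225570240 Z^2 t_1 t_3^2 t_4^6 + 7964410020 Z^2 t_2 t_3^2 t_4^6 - 108000 Z^6 t_3^3 t_4^6 \\ &+ 1399923420 Z t_1 t_3^3 t_4^6 + 61840178440 Z t_2 t_3^3 t_4^6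 - 1415250 Z^5 t_3^4 t_4^6 + 89821989600 t_1 t_3^4 t_4^6 \\ &- 183359111760 t_2 t_3^4 t_4^6 + 113517812720 Z^4 t_3^5 t_4^6 - 379424004920 Z^3 t_3^6 t_4^6 \\ &- 1998548319360 Z^2 t_3^7 t_4^6 + 1114813850860 Z t_3^8 t_4^6 + 4204075665280 t_3^9 t_4^6 + 2025 Z^8 t_4^7 \\ &+ 27351660 Z^3 t_1 t_4^7 - 87125115 Z^3 t_2 t_4^7 + 158400 Z^7 t_3 t_4^7 - 231759360 Z^2 t_1 t_3 t_4^7 \\ &+ 5344717200 Z^2 t_2 t_3 t_4^7 + 337500 Z^6 t_3^2 t_4^7 + 2400609960 Z t_1 t_3^2 t_4^7 + 65461451880 Z t_2 t_3^2 t_4^7 \\ &- 3114000 Z^5 t_3^3 t_4^7 + 113150026920 t_1 t_3^3 t_4^7 - 234714455760 t_2 t_3^3 t_4^7 + 169129871150 Z^4 t_3^4 t_4^7 \\ &- 396171632160 Z^3 t_3^5 t_4^7 - 5361270379440 Z^2 t_3^6 t_4^7 - 5723934259520 Z t_3^7 t_4^7 \\ &+ 20067909135750 t_3^8 t_4^7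 + 70200 Z^7 t_4^8 - 97251840 Z^2 t_1 t_4^8 + 1534267620 Z^2 t_2 t_4^8 \\ &+ 831600 Z^6 t_3 t_4^8 + 2057206620 Z t_1 t_3 t_4^8 + 42875701800 Z t_2 t_3 t_4^8 - 3307950 Z^5 t_3^2 t_4^8 \\ &+ 103042663920 t_1 t_3^2 t_4^8 - 249632019090 t_2 t_3^2 t_4^8 + 160462051440 Z^4 t_3^3 t_4^8 \\ &- 159576392790 Z^3 t_3^4 t_4^8 - 11200275624000 Z^2 t_3^5 t_4^8 - 29740325063280 Z t_3^6 t_4^8 \\ &+ 62134558132320 t_3^7 t_4^8 + 535500 Z^6 t_4^9 + 712487160 Z t_1 t_4^9 + 13938177080 Z t_2 t_4^9 \\ &- 1452600 Z^5 t_3 t_4^9 + 68111856120 t_1 t_3 t_4^9 - 203506674360 t_2 t_3 t_4^9 + 84058972000 Z^4 t_3^2 t_4^9 \\ &+ 151452210000 Z^3 t_3^3 t_4^9 - 18131069931360 Z^2 t_3^4 t_4^9 - 75535900424000 Z t_3^5 t_4^9 \\ &+ 130861824336350 t_3^6 t_4^9 - 125550 Z^5 t_4^{10} + 25090865520 t_1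 t_4^{10} - 86556812352 t_2 t_4^{10} \\ &+ 12789015040 Z^4 t_3 t_4^{10} + 241285828350 Z^3 t_3^2 t_4^{10} - 22060526165760 Z^2 t_3^3 t_4^{10} \\ &- 125256834868940 Z t_3^4 t_4^{10} + 186992066838888 t_3^5 t_4^{10} - 5145601875 Z^4 t_4^{11} \\ &+ 114867728760 Z^3 t_3 t_4^{11} - 18961639423440 Z^2 t_3^2 t_4^{11} - 142926704208480 Z t_3^3 t_4^{11} \\ &+ 171096028587180 t_3^4 t_4^{11} + 11533193965 Z^3 t_4^{12} - 10237991411520 Z^2 t_3 t_4^{12} \\ &- 110581088197120 Z t_3^2 t_4^{12} + 78681803681760 t_3^3 t_4^{12} - 2609003447640 Z^2 t_4^{13} \\ &- 53312566785280 Z t_3 t_4^{13} - 16250437730220 t_3^2 t_4^{13} - 12255008872620 Z t_4^{14} \\ &\left. - 46426601177520 t_3 t_4^{14} - 22667569904962 t_4^{15}\right), \end{align*} \begin{align*} y_2=& \, -\frac{2^{12}5^6}{3^8}\left(t_1^2 - 4 t_1 t_2 + 3 t_2^2 - 45 Z^3 t_2 t_3^2 - 810 Z t_2 t_3^4 - 1026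 t_1 t_3^5 + 2052 t_2 t_3^5 \right. \\ &- 405 Z^4 t_3^6 - 4050 Z^2 t_3^8 + 10044 t_3^{10} + 10 Z^4 t_2 t_4 - 180 Z^3 t_2 t_3 t_4 - 100 Z^2 t_2 t_3^2 t_4 \\ &- 6480 Z t_2 t_3^3 t_4 - 10260 t_1 t_3^4 t_4 + 12220 t_2 t_3^4 t_4 - 4860 Z^4 t_3^5 t_4 - 9085 Z^3 t_3^6 t_4 \\ &- 64800 Z^2 t_3^7 t_4 + 33450 Z t_3^8 t_4 + 200880 t_3^9 t_4 - 225 Z^3 t_2 t_4^2 - 400 Z^2 t_2 t_3 t_4^2 \\ &- 16080 Z t_2 t_3^2 t_4^2 - 30780 t_1 t_3^3 t_4^2 - 4840 t_2 t_3^3 t_4^2 - 22485 Z^4 t_3^4 t_4^2 - 109020 Z^3 t_3^5 t_4^2 \\ &- 511200 Z^2 t_3^6 t_4^2 + 535200 Z t_3^7 t_4^2 + 1253640 t_3^8 t_4^2 - 300 Z^2 t_2 t_4^3 - 12480 Z t_2 t_3 t_4^3 \\ &- 20520 t_1 t_3^2 t_4^3 - 163520 t_2 t_3^2 t_4^3 -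 50280 Z^4 t_3^3 t_4^3 - 550695 Z^3 t_3^4 t_4^3 - 2505600 Z^2 t_3^5 t_4^3 \\ &+ 3797100 Z t_3^6 t_4^3 + 773760 t_3^7 t_4^3 + 2410 Z t_2 t_4^4 + 46710 t_1 t_3 t_4^4 - 380460 t_2 t_3 t_4^4 \\ &- 55975 Z^4 t_3^2 t_4^4 - 1498360 Z^3 t_3^3 t_4^4 - 8058900 Z^2 t_3^4 t_4^4 + 15594000 Z t_3^5 t_4^4 \\ &- 27933080 t_3^6 t_4^4 + 60588 t_1 t_4^5 - 287748 t_2 t_4^5 - 29020 Z^4 t_3 t_4^5 - 2341695 Z^3 t_3^2 t_4^5 \\ &- 17008800 Z^2 t_3^3 t_4^5 + 39864360 Z t_3^4 t_4^5 - 162541344 t_3^5 t_4^5 - 6375 Z^4 t_4^6 \\ &- 2031420 Z^3 t_3 t_4^6 - 22768320 Z^2 t_3^2 t_4^6 + 62921280 Z t_3^3 t_4^6 - 465541320 t_3^4 t_4^6 \\ &- 778805 Z^3 t_4^7 - 17671680 Z^2 t_3 t_4^7 + 56624500 Z t_3^2 t_4^7 - 804407360 t_3^3 t_4^7 \\ &-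 6115770 Z^2 t_4^8 + 23108560 Z t_3 t_4^8 - 886614660 t_3^2 t_4^8 + 1355790 Z t_4^9 \\ &\left. - 625055760 t_3 t_4^9 - 240893344 t_4^{10}\right), \\ y_3=& \,-\frac{2^75^4}{3^5}\left(-Z t_2 - 6 t_1 t_3 + 12 t_2 t_3 + Z^4 t_3^2 - 6 Z^2 t_3^4 - 297 t_3^6 - 12 t_1 t_4 + 30 t_2 t_4 \right. \\ &+ 4 Z^4 t_3 t_4 + 12 Z^3 t_3^2 t_4 - 48 Z^2 t_3^3 t_4 + 15 Z t_3^4 t_4 - 3564 t_3^5 t_4 + 3 Z^4 t_4^2 + 48 Z^3 t_3 t_4^2 \\ &- 132 Z^2 t_3^2 t_4^2 + 120 Z t_3^3 t_4^2 - 22365 t_3^4 t_4^2 + 52 Z^3 t_4^3 - 144 Z^2 t_3 t_4^3 + 530 Z t_3^2 t_4^3 \\ &- 83880 t_3^3 t_4^3 - 54 Z^2 t_4^4 + 1160 Z t_3 t_4^4 - 166515 t_3^2 t_4^4 + 843 Z t_4^5 - 147084 t_3 t_4^5 \\ &\left. - 20311 t_4^6\right) , \\ y_4=& \, 20t_4.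 \end{align*} between $x$ and $(t,Z)$, in which $y_i=y_i(x)$. **Theorem.** (1) Let $U\subseteq\mathbb C^4$ be open and connected, let $Z$ be a branch on $U$, and let $x$ be flat coordinates of the intersection form on $U$. Then there is a complex orthogonal $4\times4$ matrix $R$ such that the four relations hold on all of $U$ with $y_i=y_i(Rx(t))$ and $Z=Z(t)$. (2) Let $Z$ be a branch on an open set $U\subseteq\mathbb C^4$. The points of $U$ that have an open neighbourhood $V\subseteq U$ on which there are injective flat coordinates $x$ of the intersection form satisfying the four relations with $y_i=y_i(x(t))$, $Z=Z(t)$ form a dense subset of $U$. (3) The relations are compatible with the intersection forms. Let $Z$ be a branch on an open set $U\subseteq\mathbb C^4$, let $Y_i(t)$ denote the right-hand side of the relation for $y_i$ at $(t,Z(t))$, let $t\in U$, and let $x_0\in\mathbb C^4$ satisfy $y_i(x_0)=Y_i(t)$ for $i=1,\dots,4$. Then for all $i,j$ $$\sum_{\lambda,\mu}g^{\lambda\mu}(t)\frac{\partial Y_i}{\partial t_\lambda}(t)\frac{\partial Y_j}{\partial t_\mu}(t)=\sum_{\alpha=1}^4\frac{\partial y_i}{\partial x_\alpha}(x_0)\frac{\partial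 y_j}{\partial x_\alpha}(x_0).$$ -/

import Mathlib

open scoped Matrix

namespace H44

/-! ### Frobenius-manifold data attached to a prepotential

Coordinates are indexed by `Fin 4`, so `t 0, t 1, t 2, t 3` are `t₁, t₂, t₃, t₄`. -/

/-- The partial derivative `∂f/∂zᵢ` of a function on `ℂ⁴`. -/
noncomputable def pd (i : Fin 4) (f : (Fin 4 → ℂ) → ℂ) (z : Fin 4 → ℂ) : ℂ :=
  fderiv ℂ f z (Pi.single i 1)

/-- `c_{ijk} = ∂³Φ/∂tᵢ∂tⱼ∂tₖ`. -/
noncomputable def cLow (Φ : (Fin 4 → ℂ) → ℂ) (i j k : Fin 4) (t : Fin 4 → ℂ) : ℂ :=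
  pd i (pd j (pd k Φ)) t

/-- The metric `η_{ij} = ∂³Φ/∂tᵢ∂tⱼ∂t₁`. -/
noncomputable def eta (Φ : (Fin 4 → ℂ) → ℂ) (t : Fin 4 → ℂ) : Matrix (Fin 4) (Fin 4) ℂ :=
  Matrix.of fun i j => cLow Φ i j 0 t

/-- `c^{ij}_k = η^{iλ} η^{jμ} c_{λμk}`, where `η^{ij}` is the inverse matrix of `η_{ij}`. -/
noncomputable def cUp (Φ : (Fin 4 → ℂ) → ℂ) (i j k : Fin 4) (t : Fin 4 → ℂ) : ℂ :=
  ∑ l, ∑ m, (eta Φ t)⁻¹ i l * (eta Φ t)⁻¹ j m * cLow Φ l m k t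

/-- The intersection form `g^{ij} = E^λ c^{ij}_λ`, for an Euler vector field with components
`E^λ(t) = w λ * t λ`. -/
noncomputable def intersectionForm (w : Fin 4 → ℂ) (Φ : (Fin 4 → ℂ) → ℂ) (t : Fin 4 → ℂ) :
    Matrix (Fin 4) (Fin 4) ℂ :=
  Matrix.of fun i j => ∑ l, w l * t l * cUp Φ i j l t

/-- `x = (x₁, …, x₄)` are flat coordinates on `U` of the contravariant metric `g`, normalised by
`g^{ij}(x) = δ^{ij}` and by `E = ((1 - d)/2) ∑ x_α ∂_{x_α}`, where `E^λ(t) = w λ * t λ`. The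
orthonormality makes the Jacobian matrix of `x` invertible on `U`. -/
structure IsFlatCoordinates (w : Fin 4 → ℂ) (d : ℂ)
    (g : (Fin 4 → ℂ) → Matrix (Fin 4) (Fin 4) ℂ)
    (U : Set (Fin 4 → ℂ)) (x : (Fin 4 → ℂ) → (Fin 4 → ℂ)) : Prop where
  holo : DifferentiableOn ℂ x U
  orthonormal : ∀ t ∈ U, ∀ i j : Fin 4,
    ∑ l, ∑ m, g t l m * pd l (fun s => x s i) t * pd m (fun s => x s j) t =
      if i = j then 1 else 0
  euler : ∀ t ∈ U, ∀ i : Fin 4,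
    ∑ l, w l * t l * pd l (fun s => x s i) t = (1 - d) / 2 * x t i

/-! ### The algebraic Frobenius manifold `H₄(4)` -/

/-- The polynomial `P`; `Z` is a root of `P(t₂, t₃, t₄, Z) = 0`. -/
noncomputable def relP (t₂ t₃ t₄ Z : ℂ) : ℂ :=
    Z^5 - t₂ + 15 * t₃^4 * t₄ + 120 * t₃^3 * t₄^2 + 530 * t₃^2 * t₄^3 + 1160 * t₃ * t₄^4 +
    843 * t₄^5 + 10 * Z^3 * (t₃ + t₄) * (t₃ + 3 * t₄) - 15 * Z * (t₃ + t₄)^2 * (t₃ +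
    3 * t₄)^2 + 20 * Z^2 * t₄ * (3 * t₃^2 + 12 * t₃ * t₄ + 13 * t₄^2)

/-- The prepotential as a polynomial in `t₁, t₂, t₃, t₄, Z`. -/
noncomputable def prepotential (t₁ t₂ t₃ t₄ Z : ℂ) : ℂ :=
    -(25 / 33) * Z^11 + (1 / 2) * Z^10 * (-4 * t₃ - 5 * t₄) - (125 / 9) * Z^9 * (t₃ +
    t₄) * (t₃ + 3 * t₄) - 5 * Z^8 * (8 * t₃^3 + 57 * t₃^2 * t₄ + 124 * t₃ * t₄^2 +
    95 * t₄^3) - (35 / 3) * Z^6 * (t₃ + t₄) * (t₃ + 3 * t₄) * (12 * t₃^3 +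
    123 * t₃^2 * t₄ + 336 * t₃ * t₄^2 + 305 * t₄^3) - 10 * Z^7 * (5 * t₃^4 +
    64 * t₃^3 * t₄ + 236 * t₃^2 * t₄^2 + 344 * t₃ * t₄^3 + 175 * t₄^4) +
    Z^5 * (135 * t₃^6 - 840 * t₃^5 * t₄ - 17130 * t₃^4 * t₄^2 - 80920 * t₃^3 * t₄^3 -
    174765 * t₃^2 * t₄^4 - 181952 * t₃ * t₄^5 - 74420 * t₄^6) + 5 * Z * t₄ * (t₃ +
    t₄)^2 * (t₃ + 3 * t₄)^2 * (180 * t₃^5 + 2115 * t₃^4 * t₄ + 11760 * t₃^3 * t₄^2 +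
    30270 * t₃^2 * t₄^3 + 32316 * t₃ * t₄^4 + 9035 * t₄^5) + (5 / 3) * Z^3 * (t₃ +
    t₄) * (t₃ + 3 * t₄) * (-45 * t₃^6 + 1260 * t₃^5 * t₄ + 13185 * t₃^4 * t₄^2 +
    42360 * t₃^3 * t₄^3 + 58125 * t₃^2 * t₄^4 + 37788 * t₃ * t₄^5 + 15815 * t₄^6) -
    100 * Z^4 * (-6 * t₃^7 - 87 * t₃^6 * t₄ - 450 * t₃^5 * t₄^2 - 1015 * t₃^4 * t₄^3 -
    650 * t₃^3 * t₄^4 + 1283 * t₃^2 * t₄^5 + 2450 * t₃ * t₄^6 + 1195 * t₄^7) -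
    (5 / 6) * Z^2 * (540 * t₃^9 + 9315 * t₃^8 * t₄ + 73440 * t₃^7 * t₄^2 +
    356940 * t₃^6 * t₄^3 + 1252440 * t₃^5 * t₄^4 + 3321450 * t₃^4 * t₄^5 +
    6239424 * t₃^3 * t₄^6 + 7356636 * t₃^2 * t₄^7 + 4563564 * t₃ * t₄^8 + 994315 * t₄^9) +
    (1 / 198) * (198 * t₁ * t₂ * t₃ + 99 * t₁^2 * t₄ - 4455 * t₃^10 * t₄ -
    178200 * t₃^9 * t₄^2 - 2569050 * t₃^8 * t₄^3 - 21740400 * t₃^7 * t₄^4 -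
    120561210 * t₃^6 * t₄^5 - 458678880 * t₃^5 * t₄^6 - 1191552120 * t₃^4 * t₄^7 -
    2004227280 * t₃^3 * t₄^8 - 1955070535 * t₃^2 * t₄^9 - 858257224 * t₃ * t₄^10 -
    45669270 * t₄^11)

/-- The components of the Euler vector field are `euler λ * t λ`. -/
noncomputable def euler : Fin 4 → ℂ := ![1, 1, 1 / 5, 1 / 5]

/-- The charge. -/
noncomputable def charge : ℂ := 4 / 5

/-- `ζ` is a holomorphic branch on the open set `U` of the algebraic function `Z`. -/
structure IsBranch (U : Set (Fin 4 → ℂ)) (ζ : (Fin 4 → ℂ) → ℂ) : Prop where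
  isOpen : IsOpen U
  holo : DifferentiableOn ℂ ζ U
  root : ∀ t ∈ U, relP (t 1) (t 2) (t 3) (ζ t) = 0

/-- The intersection form of `H₄(4)` on the domain of the branch `ζ`. -/
noncomputable def g (ζ : (Fin 4 → ℂ) → ℂ) : (Fin 4 → ℂ) → Matrix (Fin 4) (Fin 4) ℂ :=
  intersectionForm euler fun t => prepotential (t 0) (t 1) (t 2) (t 3) (ζ t)

/-! ### Basic invariants of the Coxeter group `H₄` as polynomials in `x₁, x₂, x₃, x₄` -/

/-- Elementary symmetric function of `x₂², x₃², x₄²`. -/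
noncomputable def eps1 (x₂ x₃ x₄ : ℂ) : ℂ :=
    x₂^2 + x₃^2 + x₄^2

/-- Elementary symmetric function of `x₂², x₃², x₄²`. -/
noncomputable def eps2 (x₂ x₃ x₄ : ℂ) : ℂ :=
    x₂^2 * x₃^2 + x₂^2 * x₄^2 + x₃^2 * x₄^2

/-- Elementary symmetric function of `x₂², x₃², x₄²`. -/
noncomputable def eps3 (x₂ x₃ x₄ : ℂ) : ℂ :=
    x₂^2 * x₃^2 * x₄^2

/-- The discriminant-type factor `δ`. -/
noncomputable def del (x₂ x₃ x₄ : ℂ) : ℂ :=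
    (x₂^2 - x₃^2) * (x₂^2 - x₄^2) * (x₃^2 - x₄^2)

/-- The `H₃`-invariant of degree 2. -/
noncomputable def h2 (x₂ x₃ x₄ : ℂ) : ℂ :=
  eps1 x₂ x₃ x₄

/-- The `H₃`-invariant of degree 6. -/
noncomputable def h6 (x₂ x₃ x₄ : ℂ) : ℂ :=
  let ε₁ := eps1 x₂ x₃ x₄
  let ε₂ := eps2 x₂ x₃ x₄
  let ε₃ := eps3 x₂ x₃ x₄
  let δ := del x₂ x₃ x₄
  ((Real.sqrt 5 : ℝ) : ℂ) * δ + ε₁ * ε₂ - 11 * ε₃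

/-- The `H₃`-invariant of degree 10. -/
noncomputable def h10 (x₂ x₃ x₄ : ℂ) : ℂ :=
  let ε₁ := eps1 x₂ x₃ x₄
  let ε₂ := eps2 x₂ x₃ x₄
  let ε₃ := eps3 x₂ x₃ x₄
  let δ := del x₂ x₃ x₄
  95 * ε₂ * ε₃ - 32 * ε₁^2 * ε₃ - 5 * ε₁ * ε₂^2 +
    2 * ε₁^3 * ε₂ + 3 * ((Real.sqrt 5 : ℝ) : ℂ) * δ * ε₂

/-- The basic invariant of degree 30, in terms of `x₁` and `h2, h6, h10`. -/
noncomputable def y1Aux (x₁ h2 h6 h10 : ℂ) : ℂ :=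
    (32 / 3) * x₁^24 * h2^3 - 40 * x₁^22 * (2 * h2^4 + 3 * h2 * h6) + x₁^20 * (360 * h10 +
    (1344 / 5) * h2^5 + 672 * h2^2 * h6) + x₁^18 * (1080 * h6^2 - 1608 * h2^3 * h6 -
    (1328 / 3) * h2^6 - 2880 * h10 * h2) + x₁^16 * (10024 * h10 * h2^2 + 272 * h2^7 +
    1248 * h2^4 * h6 - 5628 * h2 * h6^2) + x₁^14 * (18588 * h2^2 * h6^2 + 272 * h2^8 -
    7620 * h10 * h6 - 16856 * h10 * h2^3) + x₁^12 * (14216 * h10 * h2^4 +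
    23508 * h10 * h6 * h2 - (1328 / 3) * h2^9 - 1248 * h6 * h2^6 - 27396 * h6^2 * h2^3 -
    5796 * h6^3) + x₁^10 * (3240 * h10^2 - 7160 * h10 * h2^5 - 25332 * h10 * h6 * h2^2 +
    (1344 / 5) * h2^10 + 1608 * h2^7 * h6 + 19968 * h2^4 * h6^2 + 7350 * h2 * h6^3) +
    x₁^8 * (2144 * h10 * h2^6 - 3232 * h10^2 * h2 + 10908 * h10 * h2^3 * h6 -
    906 * h10 * h6^2 - 80 * h2^11 - 672 * h2^8 * h6 - 6924 * h2^5 * h6^2 -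
    1956 * h2^2 * h6^3) + x₁^6 * (1168 * h10^2 * h2^2 - 344 * h10 * h2^7 -
    2172 * h10 * h2^4 * h6 - 1908 * h10 * h2 * h6^2 + (32 / 3) * h2^12 + 120 * h2^9 * h6 +
    1332 * h2^6 * h6^2 + 288 * h2^3 * h6^3 + 2394 * h6^4) + x₁^4 * (348 * h10^2 * h6 -
    152 * h10^2 * h2^3 + 16 * h10 * h2^8 + 60 * h10 * h6 * h2^5 + 408 * h10 * h6^2 * h2^2 -
    84 * h2^7 * h6^2 + 84 * h2^4 * h6^3 - 909 * h2 * h6^4) + x₁^2 * (8 * h10^2 * h2^4 -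
    42 * h10 * h6^2 * h2^3 - 87 * h10 * h6^3 - 6 * h2^5 * h6^3 + 135 * h2^2 * h6^4) +
    (4 / 3) * h10^3 - 3 * h10 * h2 * h6^3 + (9 / 5) * h6^5

/-- The basic invariant of degree 20, in terms of `x₁` and `h2, h6, h10`. -/
noncomputable def y2Aux (x₁ h2 h6 h10 : ℂ) : ℂ :=
    4 * x₁^16 * h2^2 - 10 * x₁^14 * (2 * h2^3 + 3 * h6) + x₁^12 * (44 * h2^4 +
    138 * h2 * h6) + x₁^10 * (180 * h10 - 44 * h2^5 - 402 * h2^2 * h6) +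
    x₁^8 * (44 * h2^6 - 464 * h10 * h2 + 402 * h2^3 * h6 + 294 * h6^2) +
    x₁^6 * (296 * h10 * h2^2 - 20 * h2^7 - 138 * h2^4 * h6 - 306 * h2 * h6^2) +
    x₁^4 * (4 * h2^8 - 76 * h10 * h2^3 - 114 * h10 * h6 + 30 * h2^5 * h6 +
    168 * h2^2 * h6^2) + x₁^2 * (4 * h10 * h2^4 - 21 * h2^3 * h6^2 + (57 / 2) * h6^3) +
    h10^2 - (3 / 2) * h2 * h6^3

/-- The basic invariant of degree 12, in terms of `x₁` and `h2, h6, h10`. -/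
noncomputable def y3Aux (x₁ h2 h6 h10 : ℂ) : ℂ :=
    -2 * x₁^10 * h2 + 6 * x₁^8 * h2^2 + x₁^6 * (33 * h6 - 14 * h2^3) -
    x₁^4 * (33 * h2 * h6 - 6 * h2^4) + x₁^2 * (11 * h10 - 2 * h2^5) - h10 * h2 +
    (3 / 2) * h6^2

/-- The basic invariant of degree 2, in terms of `x₁` and `h2, h6, h10`. -/
noncomputable def y4Aux (x₁ h2 : ℂ) : ℂ :=
    x₁^2 + h2

/-- The basic invariants `y₁, y₂, y₃, y₄` (of degrees 30, 20, 12, 2) of `H₄` at `x ∈ ℂ⁴`. -/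
noncomputable def y (i : Fin 4) (x : Fin 4 → ℂ) : ℂ :=
  let a := h2 (x 1) (x 2) (x 3)
  let b := h6 (x 1) (x 2) (x 3)
  let c := h10 (x 1) (x 2) (x 3)
  ![y1Aux (x 0) a b c, y2Aux (x 0) a b c, y3Aux (x 0) a b c, y4Aux (x 0) a] i

/-! ### The invariants as polynomials in `t₁, t₂, t₃, t₄, Z` -/

/-- The terms of degree 0 to 1 in `t₄` of the expression of `y₁`, up to its scalar factor. -/
noncomputable def Y1Part0 (t₁ t₂ t₃ t₄ Z : ℂ) : ℂ :=
    42 * t₁^2 * t₂ - 168 * t₁ * t₂^2 + 168 * t₂^3 - 210 * Z^4 * t₁ * t₂ * t₃ +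
    420 * Z^4 * t₂^2 * t₃ + 1050 * Z^3 * t₂^2 * t₃^2 + 2100 * Z^2 * t₁ * t₂ * t₃^3 -
    4200 * Z^2 * t₂^2 * t₃^3 + 27300 * Z * t₂^2 * t₃^4 + 89250 * t₁ * t₂ * t₃^5 -
    178500 * t₂^2 * t₃^5 + 228620 * Z^4 * t₂ * t₃^6 + 114240 * Z^3 * t₁ * t₃^7 -
    228480 * Z^3 * t₂ * t₃^7 + 2465680 * Z^2 * t₂ * t₃^8 - 141120 * Z * t₁ * t₃^9 +
    282240 * Z * t₂ * t₃^9 - 5667634 * t₂ * t₃^10 - 13482560 * Z^3 * t₃^12 +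
    42611520 * Z * t₃^14 - 420 * Z^4 * t₁ * t₂ * t₄ + 1050 * Z^4 * t₂^2 * t₄ -
    1890 * Z^3 * t₁ * t₂ * t₃ * t₄ + 7980 * Z^3 * t₂^2 * t₃ * t₄ +
    12600 * Z^2 * t₁ * t₂ * t₃^2 * t₄ - 20790 * Z^2 * t₂^2 * t₃^2 * t₄ -
    104580 * Z * t₁ * t₂ * t₃^3 * t₄ + 427560 * Z * t₂^2 * t₃^3 * t₄ -
    164430 * t₁^2 * t₃^4 * t₄ + 1550220 * t₁ * t₂ * t₃^4 * t₄ -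
    2334570 * t₂^2 * t₃^4 * t₄ - 46620 * Z^4 * t₁ * t₃^5 * t₄ +
    2836680 * Z^4 * t₂ * t₃^5 * t₄ + 1599360 * Z^3 * t₁ * t₃^6 * t₄ -
    2240700 * Z^3 * t₂ * t₃^6 * t₄ - 15120 * Z^2 * t₁ * t₃^7 * t₄ +
    39481120 * Z^2 * t₂ * t₃^7 * t₄ - 2540160 * Z * t₁ * t₃^8 * t₄ +
    38725680 * Z * t₂ * t₃^8 * t₄ + 28513800 * t₁ * t₃^9 * t₄ -
    170380280 * t₂ * t₃^9 * t₄ + 16561860 * Z^4 * t₃^10 * t₄ -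
    323581440 * Z^3 * t₃^11 * t₄ - 64723680 * Z^2 * t₃^12 * t₄ +
    1193122560 * Z * t₃^13 * t₄ - 29292690 * t₃^14 * t₄

/-- The terms of degree 2 to 3 in `t₄` of the expression of `y₁`, up to its scalar factor. -/
noncomputable def Y1Part1 (t₁ t₂ t₃ t₄ Z : ℂ) : ℂ :=
    -3780 * Z^3 * t₁ * t₂ * t₄^2 + 8820 * Z^3 * t₂^2 * t₄^2 +
    23100 * Z^2 * t₁ * t₂ * t₃ * t₄^2 - 28560 * Z^2 * t₂^2 * t₃ * t₄^2 -
    627480 * Z * t₁ * t₂ * t₃^2 * t₄^2 + 1892100 * Z * t₂^2 * t₃^2 * t₄^2 -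
    1315440 * t₁^2 * t₃^3 * t₄^2 + 8585220 * t₁ * t₂ * t₃^3 * t₄^2 -
    11043480 * t₂^2 * t₃^3 * t₄^2 - 466200 * Z^4 * t₁ * t₃^4 * t₄^2 +
    15817200 * Z^4 * t₂ * t₃^4 * t₄^2 + 9705150 * Z^3 * t₁ * t₃^5 * t₄^2 -
    7914060 * Z^3 * t₂ * t₃^5 * t₄^2 - 211680 * Z^2 * t₁ * t₃^6 * t₄^2 +
    289891980 * Z^2 * t₂ * t₃^6 * t₄^2 - 17575740 * Z * t₁ * t₃^7 * t₄^2 +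
    573477240 * Z * t₂ * t₃^7 * t₄^2 + 513248400 * t₁ * t₃^8 * t₄^2 -
    1955803360 * t₂ * t₃^8 * t₄^2 + 331237200 * Z^4 * t₃^9 * t₄^2 -
    3429078870 * Z^3 * t₃^10 * t₄^2 - 1553368320 * Z^2 * t₃^11 * t₄^2 +
    14721448140 * Z * t₃^12 * t₄^2 - 820195320 * t₃^13 * t₄^2 +
    12600 * Z^2 * t₁ * t₂ * t₄^3 - 3290 * Z^2 * t₂^2 * t₄^3 -
    1244460 * Z * t₁ * t₂ * t₃ * t₄^3 + 3290280 * Z * t₂^2 * t₃ * t₄^3 -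
    3844260 * t₁^2 * t₃^2 * t₄^3 - 450 * Z^5 * t₂ * t₃^2 * t₄^3 +
    21037800 * t₁ * t₂ * t₃^2 * t₄^3 - 24410930 * t₂^2 * t₃^2 * t₄^3 -
    1773240 * Z^4 * t₁ * t₃^3 * t₄^3 + 49466480 * Z^4 * t₂ * t₃^3 * t₄^3 +
    225 * Z^8 * t₃^4 * t₄^3 + 33077100 * Z^3 * t₁ * t₃^4 * t₄^3 -
    11938395 * Z^3 * t₂ * t₃^4 * t₄^3 - 3845520 * Z^2 * t₁ * t₃^5 * t₄^3 +
    1272065200 * Z^2 * t₂ * t₃^5 * t₄^3 - 2700 * Z^6 * t₃^6 * t₄^3 -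
    56395080 * Z * t₁ * t₃^6 * t₄^3 + 3895595560 * Z * t₂ * t₃^6 * t₄^3 +
    4000050600 * t₁ * t₃^7 * t₄^3 - 11987148880 * t₂ * t₃^7 * t₄^3 +
    2939165645 * Z^4 * t₃^8 * t₄^3 - 21122966200 * Z^3 * t₃^9 * t₄^3 -
    17379662880 * Z^2 * t₃^10 * t₄^3 + 105145262880 * Z * t₃^11 * t₄^3 -
    6999178480 * t₃^12 * t₄^3

/-- The terms of degree 4 in `t₄` of the expression of `y₁`, up to its scalar factor. -/
noncomputable def Y1Part2 (t₁ t₂ t₃ t₄ Z : ℂ) : ℂ :=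
    -815640 * Z * t₁ * t₂ * t₄^4 + 2080680 * Z * t₂^2 * t₄^4 - 4853520 * t₁^2 * t₃ * t₄^4 -
    1800 * Z^5 * t₂ * t₃ * t₄^4 + 23828490 * t₁ * t₂ * t₃ * t₄^4 -
    26013980 * t₂^2 * t₃ * t₄^4 - 3180240 * Z^4 * t₁ * t₃^2 * t₄^4 +
    91783860 * Z^4 * t₂ * t₃^2 * t₄^4 + 1800 * Z^8 * t₃^3 * t₄^4 +
    69522180 * Z^3 * t₁ * t₃^3 * t₄^4 - 11884320 * Z^3 * t₂ * t₃^3 * t₄^4 +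
    5400 * Z^7 * t₃^4 * t₄^4 - 29988000 * Z^2 * t₁ * t₃^4 * t₄^4 +
    3617141020 * Z^2 * t₂ * t₃^4 * t₄^4 - 32400 * Z^6 * t₃^5 * t₄^4 -
    38118780 * Z * t₁ * t₃^5 * t₄^4 + 15323659800 * Z * t₂ * t₃^5 * t₄^4 -
    25650 * Z^5 * t₃^6 * t₄^4 + 17678161200 * t₁ * t₃^6 * t₄^4 -
    44692143980 * t₂ * t₃^6 * t₄^4 + 15227879120 * Z^4 * t₃^7 * t₄^4 -
    83502915015 * Z^3 * t₃^8 * t₄^4 - 119765904000 * Z^2 * t₃^9 * t₄^4 +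
    469572887280 * Z * t₃^10 * t₄^4 + 2620343040 * t₃^11 * t₄^4

/-- The terms of degree 5 in `t₄` of the expression of `y₁`, up to its scalar factor. -/
noncomputable def Y1Part3 (t₁ t₂ t₃ t₄ Z : ℂ) : ℂ :=
    -2164806 * t₁^2 * t₄^5 - 1350 * Z^5 * t₂ * t₄^5 + 10008684 * t₁ * t₂ * t₄^5 -
    11210172 * t₂^2 * t₄^5 - 2653140 * Z^4 * t₁ * t₃ * t₄^5 +
    96693240 * Z^4 * t₂ * t₃ * t₄^5 + 4950 * Z^8 * t₃^2 * t₄^5 +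
    92617560 * Z^3 * t₁ * t₃^2 * t₄^5 - 43361430 * Z^3 * t₂ * t₃^2 * t₄^5 +
    43200 * Z^7 * t₃^3 * t₄^5 - 113047200 * Z^2 * t₁ * t₃^3 * t₄^5 +
    6749433120 * Z^2 * t₂ * t₃^3 * t₄^5 - 121500 * Z^6 * t₃^4 * t₄^5 +
    357293160 * Z * t₁ * t₃^4 * t₄^5 + 38092662600 * Z * t₂ * t₃^4 * t₄^5 -
    307800 * Z^5 * t₃^5 * t₄^5 + 49036806000 * t₁ * t₃^5 * t₄^5 -
    108705602416 * t₂ * t₃^5 * t₄^5 + 50844400500 * Z^4 * t₃^6 * t₄^5 -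
    219447220080 * Z^3 * t₃^7 * t₄^5 - 570111869640 * Z^2 * t₃^8 * t₄^5 +
    1249790969280 * Z * t₃^9 * t₄^5 + 479633884512 * t₃^10 * t₄^5

/-- The terms of degree 6 in `t₄` of the expression of `y₁`, up to its scalar factor. -/
noncomputable def Y1Part4 (t₁ t₂ t₃ t₄ Z : ℂ) : ℂ :=
    -803880 * Z^4 * t₁ * t₄^6 + 45585960 * Z^4 * t₂ * t₄^6 + 5400 * Z^8 * t₃ * t₄^6 +
    74024790 * Z^3 * t₁ * t₃ * t₄^6 - 107328900 * Z^3 * t₂ * t₃ * t₄^6 +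
    126000 * Z^7 * t₃^2 * t₄^6 - 225570240 * Z^2 * t₁ * t₃^2 * t₄^6 +
    7964410020 * Z^2 * t₂ * t₃^2 * t₄^6 - 108000 * Z^6 * t₃^3 * t₄^6 +
    1399923420 * Z * t₁ * t₃^3 * t₄^6 + 61840178440 * Z * t₂ * t₃^3 * t₄^6 -
    1415250 * Z^5 * t₃^4 * t₄^6 + 89821989600 * t₁ * t₃^4 * t₄^6 -
    183359111760 * t₂ * t₃^4 * t₄^6 + 113517812720 * Z^4 * t₃^5 * t₄^6 -
    379424004920 * Z^3 * t₃^6 * t₄^6 - 1998548319360 * Z^2 * t₃^7 * t₄^6 +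
    1114813850860 * Z * t₃^8 * t₄^6 + 4204075665280 * t₃^9 * t₄^6

/-- The terms of degree 7 in `t₄` of the expression of `y₁`, up to its scalar factor. -/
noncomputable def Y1Part5 (t₁ t₂ t₃ t₄ Z : ℂ) : ℂ :=
    2025 * Z^8 * t₄^7 + 27351660 * Z^3 * t₁ * t₄^7 - 87125115 * Z^3 * t₂ * t₄^7 +
    158400 * Z^7 * t₃ * t₄^7 - 231759360 * Z^2 * t₁ * t₃ * t₄^7 +
    5344717200 * Z^2 * t₂ * t₃ * t₄^7 + 337500 * Z^6 * t₃^2 * t₄^7 +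
    2400609960 * Z * t₁ * t₃^2 * t₄^7 + 65461451880 * Z * t₂ * t₃^2 * t₄^7 -
    3114000 * Z^5 * t₃^3 * t₄^7 + 113150026920 * t₁ * t₃^3 * t₄^7 -
    234714455760 * t₂ * t₃^3 * t₄^7 + 169129871150 * Z^4 * t₃^4 * t₄^7 -
    396171632160 * Z^3 * t₃^5 * t₄^7 - 5361270379440 * Z^2 * t₃^6 * t₄^7 -
    5723934259520 * Z * t₃^7 * t₄^7 + 20067909135750 * t₃^8 * t₄^7

/-- The terms of degree 8 in `t₄` of the expression of `y₁`, up to its scalar factor. -/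
noncomputable def Y1Part6 (t₁ t₂ t₃ t₄ Z : ℂ) : ℂ :=
    70200 * Z^7 * t₄^8 - 97251840 * Z^2 * t₁ * t₄^8 + 1534267620 * Z^2 * t₂ * t₄^8 +
    831600 * Z^6 * t₃ * t₄^8 + 2057206620 * Z * t₁ * t₃ * t₄^8 +
    42875701800 * Z * t₂ * t₃ * t₄^8 - 3307950 * Z^5 * t₃^2 * t₄^8 +
    103042663920 * t₁ * t₃^2 * t₄^8 - 249632019090 * t₂ * t₃^2 * t₄^8 +
    160462051440 * Z^4 * t₃^3 * t₄^8 - 159576392790 * Z^3 * t₃^4 * t₄^8 -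
    11200275624000 * Z^2 * t₃^5 * t₄^8 - 29740325063280 * Z * t₃^6 * t₄^8 +
    62134558132320 * t₃^7 * t₄^8

/-- The terms of degree 9 to 15 in `t₄` of the expression of `y₁`, up to its scalar factor. -/
noncomputable def Y1Part7 (t₁ t₂ t₃ t₄ Z : ℂ) : ℂ :=
    535500 * Z^6 * t₄^9 + 712487160 * Z * t₁ * t₄^9 + 13938177080 * Z * t₂ * t₄^9 -
    1452600 * Z^5 * t₃ * t₄^9 + 68111856120 * t₁ * t₃ * t₄^9 -
    203506674360 * t₂ * t₃ * t₄^9 + 84058972000 * Z^4 * t₃^2 * t₄^9 +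
    151452210000 * Z^3 * t₃^3 * t₄^9 - 18131069931360 * Z^2 * t₃^4 * t₄^9 -
    75535900424000 * Z * t₃^5 * t₄^9 + 130861824336350 * t₃^6 * t₄^9 -
    125550 * Z^5 * t₄^10 + 25090865520 * t₁ * t₄^10 - 86556812352 * t₂ * t₄^10 +
    12789015040 * Z^4 * t₃ * t₄^10 + 241285828350 * Z^3 * t₃^2 * t₄^10 -
    22060526165760 * Z^2 * t₃^3 * t₄^10 - 125256834868940 * Z * t₃^4 * t₄^10 +
    186992066838888 * t₃^5 * t₄^10 - 5145601875 * Z^4 * t₄^11 +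
    114867728760 * Z^3 * t₃ * t₄^11 - 18961639423440 * Z^2 * t₃^2 * t₄^11 -
    142926704208480 * Z * t₃^3 * t₄^11 + 171096028587180 * t₃^4 * t₄^11 +
    11533193965 * Z^3 * t₄^12 - 10237991411520 * Z^2 * t₃ * t₄^12 -
    110581088197120 * Z * t₃^2 * t₄^12 + 78681803681760 * t₃^3 * t₄^12 -
    2609003447640 * Z^2 * t₄^13 - 53312566785280 * Z * t₃ * t₄^13 -
    16250437730220 * t₃^2 * t₄^13 - 12255008872620 * Z * t₄^14 -
    46426601177520 * t₃ * t₄^14 - 22667569904962 * t₄^15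

/-- The expression of `y₁`. -/
noncomputable def Y1 (t₁ t₂ t₃ t₄ Z : ℂ) : ℂ :=
    -(2^19 * 5^9 / (3^13 * 7)) *
      (Y1Part0 t₁ t₂ t₃ t₄ Z +
        Y1Part1 t₁ t₂ t₃ t₄ Z +
        Y1Part2 t₁ t₂ t₃ t₄ Z +
        Y1Part3 t₁ t₂ t₃ t₄ Z +
        Y1Part4 t₁ t₂ t₃ t₄ Z +
        Y1Part5 t₁ t₂ t₃ t₄ Z +
        Y1Part6 t₁ t₂ t₃ t₄ Z +
        Y1Part7 t₁ t₂ t₃ t₄ Z)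

/-- The expression of `y₂`. -/
noncomputable def Y2 (t₁ t₂ t₃ t₄ Z : ℂ) : ℂ :=
    -(2^12 * 5^6 / 3^8) * (t₁^2 - 4 * t₁ * t₂ + 3 * t₂^2 - 45 * Z^3 * t₂ * t₃^2 -
    810 * Z * t₂ * t₃^4 - 1026 * t₁ * t₃^5 + 2052 * t₂ * t₃^5 - 405 * Z^4 * t₃^6 -
    4050 * Z^2 * t₃^8 + 10044 * t₃^10 + 10 * Z^4 * t₂ * t₄ - 180 * Z^3 * t₂ * t₃ * t₄ -
    100 * Z^2 * t₂ * t₃^2 * t₄ - 6480 * Z * t₂ * t₃^3 * t₄ - 10260 * t₁ * t₃^4 * t₄ +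
    12220 * t₂ * t₃^4 * t₄ - 4860 * Z^4 * t₃^5 * t₄ - 9085 * Z^3 * t₃^6 * t₄ -
    64800 * Z^2 * t₃^7 * t₄ + 33450 * Z * t₃^8 * t₄ + 200880 * t₃^9 * t₄ -
    225 * Z^3 * t₂ * t₄^2 - 400 * Z^2 * t₂ * t₃ * t₄^2 - 16080 * Z * t₂ * t₃^2 * t₄^2 -
    30780 * t₁ * t₃^3 * t₄^2 - 4840 * t₂ * t₃^3 * t₄^2 - 22485 * Z^4 * t₃^4 * t₄^2 -
    109020 * Z^3 * t₃^5 * t₄^2 - 511200 * Z^2 * t₃^6 * t₄^2 + 535200 * Z * t₃^7 * t₄^2 +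
    1253640 * t₃^8 * t₄^2 - 300 * Z^2 * t₂ * t₄^3 - 12480 * Z * t₂ * t₃ * t₄^3 -
    20520 * t₁ * t₃^2 * t₄^3 - 163520 * t₂ * t₃^2 * t₄^3 - 50280 * Z^4 * t₃^3 * t₄^3 -
    550695 * Z^3 * t₃^4 * t₄^3 - 2505600 * Z^2 * t₃^5 * t₄^3 + 3797100 * Z * t₃^6 * t₄^3 +
    773760 * t₃^7 * t₄^3 + 2410 * Z * t₂ * t₄^4 + 46710 * t₁ * t₃ * t₄^4 -
    380460 * t₂ * t₃ * t₄^4 - 55975 * Z^4 * t₃^2 * t₄^4 - 1498360 * Z^3 * t₃^3 * t₄^4 -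
    8058900 * Z^2 * t₃^4 * t₄^4 + 15594000 * Z * t₃^5 * t₄^4 - 27933080 * t₃^6 * t₄^4 +
    60588 * t₁ * t₄^5 - 287748 * t₂ * t₄^5 - 29020 * Z^4 * t₃ * t₄^5 -
    2341695 * Z^3 * t₃^2 * t₄^5 - 17008800 * Z^2 * t₃^3 * t₄^5 +
    39864360 * Z * t₃^4 * t₄^5 - 162541344 * t₃^5 * t₄^5 - 6375 * Z^4 * t₄^6 -
    2031420 * Z^3 * t₃ * t₄^6 - 22768320 * Z^2 * t₃^2 * t₄^6 + 62921280 * Z * t₃^3 * t₄^6 -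
    465541320 * t₃^4 * t₄^6 - 778805 * Z^3 * t₄^7 - 17671680 * Z^2 * t₃ * t₄^7 +
    56624500 * Z * t₃^2 * t₄^7 - 804407360 * t₃^3 * t₄^7 - 6115770 * Z^2 * t₄^8 +
    23108560 * Z * t₃ * t₄^8 - 886614660 * t₃^2 * t₄^8 + 1355790 * Z * t₄^9 -
    625055760 * t₃ * t₄^9 - 240893344 * t₄^10)

/-- The expression of `y₃`. -/
noncomputable def Y3 (t₁ t₂ t₃ t₄ Z : ℂ) : ℂ :=
    -(2^7 * 5^4 / 3^5) * (-Z * t₂ - 6 * t₁ * t₃ + 12 * t₂ * t₃ + Z^4 * t₃^2 -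
    6 * Z^2 * t₃^4 - 297 * t₃^6 - 12 * t₁ * t₄ + 30 * t₂ * t₄ + 4 * Z^4 * t₃ * t₄ +
    12 * Z^3 * t₃^2 * t₄ - 48 * Z^2 * t₃^3 * t₄ + 15 * Z * t₃^4 * t₄ - 3564 * t₃^5 * t₄ +
    3 * Z^4 * t₄^2 + 48 * Z^3 * t₃ * t₄^2 - 132 * Z^2 * t₃^2 * t₄^2 +
    120 * Z * t₃^3 * t₄^2 - 22365 * t₃^4 * t₄^2 + 52 * Z^3 * t₄^3 - 144 * Z^2 * t₃ * t₄^3 +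
    530 * Z * t₃^2 * t₄^3 - 83880 * t₃^3 * t₄^3 - 54 * Z^2 * t₄^4 + 1160 * Z * t₃ * t₄^4 -
    166515 * t₃^2 * t₄^4 + 843 * Z * t₄^5 - 147084 * t₃ * t₄^5 - 20311 * t₄^6)

/-- The expression of `y₄`. -/
noncomputable def Y4 (t₄ : ℂ) : ℂ :=
    20 * t₄

/-- The four expressions at a point `(t, Z)`. -/
noncomputable def Y (i : Fin 4) (t : Fin 4 → ℂ) (Z : ℂ) : ℂ :=
  ![Y1 (t 0) (t 1) (t 2) (t 3) Z, Y2 (t 0) (t 1) (t 2) (t 3) Z,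
    Y3 (t 0) (t 1) (t 2) (t 3) Z, Y4 (t 3)] i

end H44

/-! The polynomial `P` is linear in t₂, so along a branch t₂ = q(Z, t₃, t₄), and (t₁, Z, t₃, t₄) are
local coordinates: differentiating this equation in t₂ gives q_Z · ∂Z/∂t₂ = 1, hence q_Z ≠ 0. In
these coordinates F and the right-hand sides Yᵢ are polynomials. Their first t-derivatives, and the
second ones of F, are polynomials too, because q_Z divides the Z-derivatives involved. Third
derivatives of F have q_Z in the denominator, but E(F) = (11/5) F differentiated twice expresses
their contraction with E, and so g, by second derivatives.

Everything rests on one comparison. The scalar products of the gradients of the H₄-invariants are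
again invariants, hence polynomials in y₁, …, y₄; they form the matrix `gram` (`sum_pd_y`). The same
matrix, evaluated at Y, gives g(dYᵢ, dYⱼ) (`IsBranch.sum_g_pd_Y`). Part (3) is the conjunction of
the two.

For part (2), let y : ℂ⁴ → ℂ⁴ be the map given by the invariants. It is quasi-homogeneous with
y⁻¹(0) = {0}, hence proper with closed image. Since J Jᵀ = `gram` for its Jacobian matrix J, it is a
local biholomorphism over the locus det `gram` ≠ 0. This locus is connected, so it lies in the image
(`regular_subset_range_yMap`). Where Y(t) is in the locus, a local inverse ψ of y gives x = ψ ∘ Y.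
Cancelling J from the comparison shows that the dxᵢ are orthonormal. The Euler condition follows
from y₄ = ∑ xᵢ² = 20 t₄ and g^{i4} = Eⁱ. Such t are dense because det `gram`(Y) is a nonzero
polynomial in (t₁, Z, t₃, t₄).

For part (1), the transition between two systems of flat coordinates preserves the complex dot
product and is therefore affine; the Euler condition with d ≠ 1 removes the translation
(`IsFlatCoordinates.exists_orthogonal`). Comparing the given x with the coordinates of part (2) near
one point yields R, and the identity theorem carries the relations to all of the connected set U.

The large polynomial identities are verified by Kronecker substitution: a weighted homogeneous
integer polynomial vanishes as soon as its value at suitable rapidly growing powers of 2 does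
(`eval_eq_zero_of_vanishes`). -/

/-! ### Integer polynomial expressions and their verification by Kronecker substitution -/

/-- Integer polynomial expressions in four variables. The leaves are lists of terms
`(c, i, j, k, l)`, which stand for `c * x₀ ^ i * x₁ ^ j * x₂ ^ k * x₃ ^ l`. -/
inductive PolyExpr where
  | terms (l : List (ℤ × ℕ × ℕ × ℕ × ℕ)) : PolyExpr
  | add (p q : PolyExpr) : PolyExpr
  | sub (p q : PolyExpr) : PolyExpr
  | mul (p q : PolyExpr) : PolyExpr

namespace PolyExpr

instance : Add PolyExpr := ⟨add⟩
instance : Sub PolyExpr := ⟨sub⟩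
instance : Mul PolyExpr := ⟨mul⟩

/-- A constant. -/
def const (c : ℤ) : PolyExpr := terms [(c, 0, 0, 0, 0)]

section Eval

variable {R : Type*} [CommRing R]

/-- The value of a term. -/
def evalMonomial (x : Fin 4 → R) (m : ℤ × ℕ × ℕ × ℕ × ℕ) : R :=
  m.1 * x 0 ^ m.2.1 * x 1 ^ m.2.2.1 * x 2 ^ m.2.2.2.1 * x 3 ^ m.2.2.2.2

/-- The sum of the values of the terms of a list. -/
def evalList (x : Fin 4 → R) : List (ℤ × ℕ × ℕ × ℕ × ℕ) → R
  | [] => 0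
  | m :: l => evalMonomial x m + evalList x l

/-- The value of a polynomial expression. -/
def eval (x : Fin 4 → R) : PolyExpr → R
  | terms l => evalList x l
  | add p q => eval x p + eval x q
  | sub p q => eval x p - eval x q
  | mul p q => eval x p * eval x q

variable (x : Fin 4 → R)

@[simp] theorem eval_terms (l) : eval x (terms l) = evalList x l := rfl
@[simp] theorem eval_add (p q : PolyExpr) : eval x (p + q) = eval x p + eval x q := rfl
@[simp] theorem eval_sub (p q : PolyExpr) : eval x (p - q) = eval x p - eval x q := rfl
@[simp] theorem eval_mul (p q : PolyExpr) : eval x (p * q) = eval x p * eval x q := rfl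
@[simp] theorem eval_const (c : ℤ) : eval x (const c) = c := by
  simp [const, evalList, evalMonomial]

/-- This naturality moves an expression between ℤ, iterated polynomial rings over ℤ, and ℂ. -/
theorem map_eval {S : Type*} [CommRing S] (f : R →+* S) (p : PolyExpr) :
    f (p.eval x) = p.eval (fun i => f (x i)) := by
  induction p with
  | terms l =>
    induction l with
    | nil => simp [evalList]
    | cons m l ih => simpa [evalList, evalMonomial] using ih
  | add p q hp hq => simp [eval, hp, hq]
  | sub p q hp hq => simp [eval, hp, hq]
  | mul p q hp hq => simp [eval, hp, hq]

end Eval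

/-- The partial derivative of a term; terms without the variable are dropped. -/
def pderivTerm (a : Fin 4) : ℤ × ℕ × ℕ × ℕ × ℕ → Option (ℤ × ℕ × ℕ × ℕ × ℕ)
  | (c, i, j, k, l) =>
    match a with
    | 0 => match i with
      | 0 => none
      | n + 1 => some (c * (n + 1 : ℕ), n, j, k, l)
    | 1 => match j with
      | 0 => none
      | n + 1 => some (c * (n + 1 : ℕ), i, n, k, l)
    | 2 => match k with
      | 0 => none
      | n + 1 => some (c * (n + 1 : ℕ), i, j, n, l)
    | 3 => match l with
      | 0 => none
      | n + 1 => some (c * (n + 1 : ℕ), i, j, k, n)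

/-- The formal partial derivative. -/
def pderiv (a : Fin 4) : PolyExpr → PolyExpr
  | terms l => terms (l.filterMap (pderivTerm a))
  | add p q => add (pderiv a p) (pderiv a q)
  | sub p q => sub (pderiv a p) (pderiv a q)
  | mul p q => add (mul (pderiv a p) q) (mul p (pderiv a q))

/-! #### Weighted homogeneity -/

/-- The weight of a term; the last variable has weight one. -/
def termWeight (w : ℕ × ℕ × ℕ) (m : ℤ × ℕ × ℕ × ℕ × ℕ) : ℕ :=
  w.1 * m.2.1 + w.2.1 * m.2.2.1 + w.2.2 * m.2.2.2.1 + m.2.2.2.2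

/-- A syntactic check that an expression vanishes. -/
def isNull : PolyExpr → Bool
  | terms l => l.isEmpty
  | add p q => isNull p && isNull q
  | sub p q => isNull p && isNull q
  | mul p q => isNull p || isNull q

/-- The weight of a weighted homogeneous expression. -/
def weight (w : ℕ × ℕ × ℕ) : PolyExpr → ℕ
  | terms [] => 0
  | terms (m :: _) => termWeight w m
  | add p q => if isNull p then weight w q else weight w p
  | sub p q => if isNull p then weight w q else weight w p
  | mul p q => weight w p + weight w q

/-- A check that an expression is weighted homogeneous of weight `d`. -/
def isHomog (w : ℕ × ℕ × ℕ) : PolyExpr → ℕ → Bool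
  | terms l, d => l.all fun m => termWeight w m == d
  | add p q, d => isHomog w p d && isHomog w q d
  | sub p q, d => isHomog w p d && isHomog w q d
  | mul p q, d => isNull p || isNull q ||
      (weight w p + weight w q == d && (isHomog w p (weight w p) && isHomog w q (weight w q)))

theorem eval_eq_zero_of_isNull {R : Type*} [CommRing R] (x : Fin 4 → R) :
    ∀ p : PolyExpr, p.isNull = true → p.eval x = 0
  | terms [], _ => rfl
  | terms (m :: l), h => by simp [isNull] at h
  | add p q, h => by
    simp only [isNull, Bool.and_eq_true] at h
    simp [eval, eval_eq_zero_of_isNull x p h.1, eval_eq_zero_of_isNull x q h.2]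
  | sub p q, h => by
    simp only [isNull, Bool.and_eq_true] at h
    simp [eval, eval_eq_zero_of_isNull x p h.1, eval_eq_zero_of_isNull x q h.2]
  | mul p q, h => by
    simp only [isNull, Bool.or_eq_true] at h
    rcases h with h | h <;> simp [eval, eval_eq_zero_of_isNull x _ h]

/-- Scaling is checked along the tree of the expression. Null factors of a product need a case of
their own: the weight recorded for an empty list is the arbitrary value 0, and formal derivatives
produce such lists. -/
theorem eval_smul_of_isHomog {R : Type*} [CommRing R] (w : ℕ × ℕ × ℕ) (x : Fin 4 → R) (r : R) :
    ∀ (p : PolyExpr) (d : ℕ), p.isHomog w d = true →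
      p.eval ![r ^ w.1 * x 0, r ^ w.2.1 * x 1, r ^ w.2.2 * x 2, r * x 3] = r ^ d * p.eval x
  | terms l, d, h => by
    induction l with
    | nil => simp [evalList]
    | cons m l ih =>
      simp only [isHomog, List.all_cons, Bool.and_eq_true, beq_iff_eq] at h
      have := ih h.2
      simp only [eval_terms, evalList] at this ⊢
      rw [this, mul_add]
      congr 1
      rw [← h.1]
      simp only [evalMonomial, termWeight, Matrix.cons_val, pow_add, pow_mul]
      ring
  | add p q, d, h => by
    simp only [isHomog, Bool.and_eq_true] at h
    simp only [eval, eval_smul_of_isHomog w x r p d h.1, eval_smul_of_isHomog w x r q d h.2]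
    ring
  | sub p q, d, h => by
    simp only [isHomog, Bool.and_eq_true] at h
    simp only [eval, eval_smul_of_isHomog w x r p d h.1, eval_smul_of_isHomog w x r q d h.2]
    ring
  | mul p q, d, h => by
    simp only [isHomog, Bool.or_eq_true, Bool.and_eq_true, beq_iff_eq] at h
    rcases h with (h | h) | ⟨rfl, h1, h2⟩
    · simp [eval, eval_eq_zero_of_isNull _ _ h]
    · simp [eval, eval_eq_zero_of_isNull _ _ h]
    · simp only [eval, eval_smul_of_isHomog w x r p _ h1, eval_smul_of_isHomog w x r q _ h2]
      ring

/-! #### Lengths -/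

/-- A bound for the sum of the absolute values of the coefficients. -/
def lengthList (n : ℕ × ℕ × ℕ) : List (ℤ × ℕ × ℕ × ℕ × ℕ) → ℕ
  | [] => 0
  | (c, i, j, k, _) :: l =>
    c.natAbs * Nat.pow n.1 i * Nat.pow n.2.1 j * Nat.pow n.2.2 k + lengthList n l

/-- A bound for the sum of the absolute values of the coefficients after substitution of elements
of lengths at most `n` for the first three variables and of `1` for the last one. -/
def length (n : ℕ × ℕ × ℕ) : PolyExpr → ℕ
  | terms l => lengthList n l
  | add p q => length n p + length n q
  | sub p q => length n p + length n q
  | mul p q => length n p * length n q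

/-- The value of a list of terms at natural numbers, the last variable being `1`. -/
def valueList (n : ℕ × ℕ × ℕ) : List (ℤ × ℕ × ℕ × ℕ × ℕ) → ℤ
  | [] => 0
  | (c, i, j, k, _) :: l =>
    c * Int.ofNat (Nat.pow n.1 i * Nat.pow n.2.1 j * Nat.pow n.2.2 k) + valueList n l

/-- The value at natural numbers, the last variable being `1`. -/
def value (n : ℕ × ℕ × ℕ) : PolyExpr → ℤ
  | terms l => valueList n l
  | add p q => value n p + value n q
  | sub p q => value n p - value n q
  | mul p q => value n p * value n q

/-- `value` is spelled with `Nat.pow` and `Int.ofNat` so that it computes on integer literals; here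
it is identified with `eval`. -/
theorem value_eq_eval (n : ℕ × ℕ × ℕ) (p : PolyExpr) :
    p.value n = p.eval ![(n.1 : ℤ), (n.2.1 : ℤ), (n.2.2 : ℤ), 1] := by
  induction p with
  | terms l =>
    induction l with
    | nil => rfl
    | cons m l ih =>
      obtain ⟨c, i, j, k, e⟩ := m
      simp only [value, eval, valueList, evalList, evalMonomial] at ih ⊢
      rw [ih]
      simp [mul_assoc]
  | add p q hp hq => simp [value, eval, hp, hq]
  | sub p q hp hq => simp [value, eval, hp, hq]
  | mul p q hp hq => simp [value, eval, hp, hq]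

/-! ### Lengths of iterated polynomials and Kronecker substitution. -/

/-- A commutative ring with a length function like the sum of the absolute values of the
coefficients of an integer polynomial. -/
class LengthRing (R : Type) [CommRing R] where
  len : R → ℕ
  len_intCast (c : ℤ) : len (c : R) ≤ c.natAbs
  len_neg (a : R) : len (-a) = len a
  len_add_le (a b : R) : len (a + b) ≤ len a + len b
  len_mul_le (a b : R) : len (a * b) ≤ len a * len b
  eq_zero_of_dvd (m : ℕ) (a : R) : (m : R) ∣ a → len a < m → a = 0

open LengthRing

theorem len_zero {R : Type} [CommRing R] [LengthRing R] : len (0 : R) = 0 := by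
  simpa using len_intCast (R := R) 0

theorem len_one_le {R : Type} [CommRing R] [LengthRing R] : len (1 : R) ≤ 1 := by
  simpa using len_intCast (R := R) 1

theorem len_natCast {R : Type} [CommRing R] [LengthRing R] (c : ℕ) : len (c : R) ≤ c := by
  simpa using len_intCast (R := R) c

theorem len_pow_le {R : Type} [CommRing R] [LengthRing R] {a : R} {m : ℕ} (h : len a ≤ m) (n : ℕ) :
    len (a ^ n) ≤ m ^ n := by
  induction n with
  | zero => simpa using len_one_le
  | succ n ih =>
    rw [pow_succ, pow_succ]
    exact (len_mul_le _ _).trans (Nat.mul_le_mul ih h)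

theorem len_sum_le {R : Type} [CommRing R] [LengthRing R] {ι : Type*} (s : Finset ι) (f : ι → R) :
    len (∑ i ∈ s, f i) ≤ ∑ i ∈ s, len (f i) :=
  Finset.le_sum_of_subadditive len len_zero.le len_add_le s f

instance : LengthRing ℤ where
  len := Int.natAbs
  len_intCast c := by simp
  len_neg := Int.natAbs_neg
  len_add_le := Int.natAbs_add_le
  len_mul_le a b := (Int.natAbs_mul a b).le
  eq_zero_of_dvd m a h hl := by
    by_contra ha
    exact absurd (Nat.le_of_dvd (Int.natAbs_pos.mpr ha) (Int.natCast_dvd.mp h)) (by omega)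

open Polynomial in
noncomputable instance {R : Type} [CommRing R] [LengthRing R] : LengthRing R[X] where
  len p := ∑ i ∈ p.support, len (p.coeff i)
  len_intCast c := by
    refine (Finset.sum_le_sum_of_subset (t := {0}) ?_).trans ?_
    · rw [← Polynomial.C_eq_intCast]
      exact Polynomial.support_C_subset _
    · rw [Finset.sum_singleton, ← Polynomial.C_eq_intCast, Polynomial.coeff_C_zero]
      exact len_intCast c
  len_neg p := by simp [len_neg]
  len_add_le p q := by
    have key : ∀ (r : R[X]) (s : Finset ℕ), r.support ⊆ s →
        ∑ i ∈ r.support, len (r.coeff i) = ∑ i ∈ s, len (r.coeff i) := fun r s h =>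
      Finset.sum_subset h fun i _ hi => by
        rw [Polynomial.notMem_support_iff.mp hi, len_zero]
    rw [key (p + q) (p.support ∪ q.support) Polynomial.support_add,
      key p (p.support ∪ q.support) Finset.subset_union_left,
      key q (p.support ∪ q.support) Finset.subset_union_right, ← Finset.sum_add_distrib]
    exact Finset.sum_le_sum fun i _ => by
      rw [Polynomial.coeff_add]; exact len_add_le _ _
  len_mul_le p q := by
    set N := p.natDegree + q.natDegree + 1
    have key : ∀ (r : R[X]) (M : ℕ), r.natDegree < M →
        ∑ i ∈ r.support, len (r.coeff i) = ∑ i ∈ Finset.range M, len (r.coeff i) := fun r M h =>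
      Finset.sum_subset (fun i hi => Finset.mem_range.mpr
        ((Polynomial.le_natDegree_of_mem_supp i hi).trans_lt h)) fun i _ hi => by
        rw [Polynomial.notMem_support_iff.mp hi, len_zero]
    rw [key (p * q) N (by have := Polynomial.natDegree_mul_le (p := p) (q := q); omega),
      Finset.sum_mul_sum, ← Finset.sum_product']
    -- The products of coefficients are grouped by the sum of their indices; subadditivity is
    -- applied on each group, and the groups exhaust the product of the supports.
    calc ∑ i ∈ Finset.range N, len ((p * q).coeff i)
        ≤ ∑ i ∈ Finset.range N, ∑ x ∈ (p.support ×ˢ q.support).filter (fun x => x.1 + x.2 = i),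
            len (p.coeff x.1) * len (q.coeff x.2) := by
          refine Finset.sum_le_sum fun i _ => ?_
          have : (p * q).coeff i =
              ∑ x ∈ (p.support ×ˢ q.support).filter (fun x => x.1 + x.2 = i),
                p.coeff x.1 * q.coeff x.2 := by
            rw [Polynomial.coeff_mul]
            symm
            refine Finset.sum_subset (fun x hx => ?_) fun x hx hx' => ?_
            · simpa using (Finset.mem_filter.mp hx).2
            · by_contra hne
              apply hx'
              rw [Finset.mem_filter, Finset.mem_product]
              exact ⟨⟨Polynomial.mem_support_iff.mpr (left_ne_zero_of_mul hne),
                Polynomial.mem_support_iff.mpr (right_ne_zero_of_mul hne)⟩, by simpa using hx⟩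
          rw [this]
          exact (len_sum_le _ _).trans (Finset.sum_le_sum fun x _ => len_mul_le _ _)
      _ = _ := by
          refine Finset.sum_fiberwise_of_maps_to (g := fun x : ℕ × ℕ => x.1 + x.2)
            (f := fun x => len (p.coeff x.1) * len (q.coeff x.2)) fun x hx => ?_
          rw [Finset.mem_product] at hx
          have h1 := Polynomial.le_natDegree_of_mem_supp _ hx.1
          have h2 := Polynomial.le_natDegree_of_mem_supp _ hx.2
          exact Finset.mem_range.mpr (by omega)
  eq_zero_of_dvd m p h hl := by
    ext i
    rw [Polynomial.coeff_zero]
    by_cases hi : i ∈ p.support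
    · refine eq_zero_of_dvd m _ ?_ ((Finset.single_le_sum (f := fun i => len (p.coeff i))
        (fun _ _ => Nat.zero_le _) hi).trans_lt hl)
      obtain ⟨q, rfl⟩ := h
      rw [← Polynomial.C_eq_natCast, Polynomial.coeff_C_mul]
      exact dvd_mul_right _ _
    · exact Polynomial.notMem_support_iff.mp hi

open Polynomial in
theorem len_C_le {R : Type} [CommRing R] [LengthRing R] (a : R) : len (C a) ≤ len a := by
  refine (Finset.sum_le_sum_of_subset (Polynomial.support_C_subset a)).trans ?_
  simp

open Polynomial in
theorem len_X_le {R : Type} [CommRing R] [LengthRing R] : len (X : R[X]) ≤ 1 := by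
  refine (Finset.sum_le_sum_of_subset (t := {1}) fun i hi => ?_).trans ?_
  · by_contra h
    exact Polynomial.mem_support_iff.mp hi
      (Polynomial.coeff_X_of_ne_one (by simpa using h))
  · simpa using len_one_le

open Polynomial in
/-- **Kronecker substitution**: a polynomial whose length is less than `m` vanishes if its value at
`m` does. -/
theorem eq_zero_of_eval_natCast {R : Type} [CommRing R] [IsDomain R] [CharZero R] [LengthRing R]
    {m : ℕ} (p : R[X]) (hl : len p < m) (h0 : p.eval (m : R) = 0) : p = 0 := by
  have hm : (m : R) ≠ 0 := Nat.cast_ne_zero.mpr (by omega)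
  have coeff_le : ∀ (q : R[X]) (i : ℕ), len (q.coeff i) ≤ len q := fun q i => by
    by_cases hi : i ∈ q.support
    · exact Finset.single_le_sum (f := fun i => len (q.coeff i)) (fun _ _ => Nat.zero_le _) hi
    · rw [Polynomial.notMem_support_iff.mp hi, len_zero]
      exact Nat.zero_le _
  -- The claim is stated for all polynomials with small coefficients, so that the induction on `i`
  -- can pass from `q` to `q.divX`.
  suffices H : ∀ (i : ℕ) (q : R[X]), q.eval (m : R) = 0 → (∀ i, len (q.coeff i) < m) →
      q.coeff i = 0 by
    ext i
    exact H i p h0 fun i => (coeff_le p i).trans_lt hl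
  intro i
  induction i with
  | zero =>
    intro q hq hl
    -- From q(m) = 0 the constant coefficient is divisible by m, and its length is below m.
    refine eq_zero_of_dvd m _ ⟨-(q.divX.eval (m : R)), ?_⟩ (hl 0)
    have := congrArg (Polynomial.eval (m : R)) q.divX_mul_X_add
    simp only [Polynomial.eval_add, Polynomial.eval_mul, eval_X, eval_C, hq] at this
    linear_combination this
  | succ i ih =>
    intro q hq hl
    have h0 : q.coeff 0 = 0 := by
      refine eq_zero_of_dvd m _ ⟨-(q.divX.eval (m : R)), ?_⟩ (hl 0)
      have := congrArg (Polynomial.eval (m : R)) q.divX_mul_X_add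
      simp only [Polynomial.eval_add, Polynomial.eval_mul, eval_X, eval_C, hq] at this
      linear_combination this
    have := congrArg (Polynomial.eval (m : R)) q.divX_mul_X_add
    simp only [Polynomial.eval_add, Polynomial.eval_mul, eval_X, eval_C, hq, h0, add_zero] at this
    rw [← Polynomial.coeff_divX]
    exact ih _ ((mul_eq_zero.mp this).resolve_right hm) fun j => by
      rw [Polynomial.coeff_divX]; exact hl _

/-- Submultiplicativity of the length turns the number computed by `length` into an a priori bound
for every admissible substitution. -/
theorem len_eval_le {R : Type} [CommRing R] [LengthRing R] (n : ℕ × ℕ × ℕ) (x : Fin 4 → R)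
    (h0 : len (x 0) ≤ n.1) (h1 : len (x 1) ≤ n.2.1) (h2 : len (x 2) ≤ n.2.2) (h3 : x 3 = 1)
    (p : PolyExpr) : len (p.eval x) ≤ p.length n := by
  induction p with
  | terms l =>
    induction l with
    | nil => exact len_zero.le
    | cons m l ih =>
      obtain ⟨c, i, j, k, e⟩ := m
      refine (len_add_le _ _).trans (Nat.add_le_add ?_ ih)
      simp only [evalMonomial, h3, one_pow, mul_one]
      exact (len_mul_le _ _).trans (Nat.mul_le_mul ((len_mul_le _ _).trans (Nat.mul_le_mul
        ((len_mul_le _ _).trans (Nat.mul_le_mul (len_intCast c) (len_pow_le h0 i)))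
        (len_pow_le h1 j))) (len_pow_le h2 k))
  | add p q hp hq => exact (len_add_le _ _).trans (Nat.add_le_add hp hq)
  | sub p q hp hq =>
    simp only [eval, sub_eq_add_neg]
    refine (len_add_le _ _).trans (Nat.add_le_add hp ?_)
    rwa [len_neg]
  | mul p q hp hq => exact (len_mul_le _ _).trans (Nat.mul_le_mul hp hq)

/-- A check that a weighted homogeneous expression vanishes identically: the values
`2 ^ a`, `2 ^ b`, `2 ^ c`, `1` are substituted for the variables. -/
def vanishes (w : ℕ × ℕ × ℕ) (a b c : ℕ) (p : PolyExpr) : Bool :=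
  p.isHomog w (p.weight w) &&
  Nat.ble (p.length (1, 1, 1) + 1) (Nat.pow 2 a) &&
  Nat.ble (p.length (Nat.pow 2 a, 1, 1) + 1) (Nat.pow 2 b) &&
  Nat.ble (p.length (Nat.pow 2 a, Nat.pow 2 b, 1) + 1) (Nat.pow 2 c) &&
  (p.value (Nat.pow 2 a, Nat.pow 2 b, Nat.pow 2 c) == 0)

-- The substituted powers of two are turned back into indeterminates one at a time, beginning with
-- the third variable. Each inequality in `vanishes` says that the polynomial in the released
-- variable has length below the power that replaced it, with the powers still substituted counted
-- in the length. Homogeneity then restores the last variable.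
open Polynomial in
theorem eval_eq_zero_of_vanishes {w : ℕ × ℕ × ℕ} {a b c : ℕ} {p : PolyExpr}
    (h : p.vanishes w a b c = true) (x : Fin 4 → ℂ) : p.eval x = 0 := by
  simp only [vanishes, Bool.and_eq_true, Nat.ble_eq, beq_iff_eq, value_eq_eval] at h
  obtain ⟨⟨⟨⟨hom, l1⟩, l2⟩, l3⟩, h0⟩ := h
  have e3 : p.eval ![((Nat.pow 2 a : ℕ) : ℤ[X]), ((Nat.pow 2 b : ℕ) : ℤ[X]), X, 1] = 0 := by
    refine eq_zero_of_eval_natCast (m := Nat.pow 2 c) _ (lt_of_le_of_lt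
      (len_eval_le (R := ℤ[X]) (Nat.pow 2 a, Nat.pow 2 b, 1) ![_, _, _, _] (len_natCast _) (len_natCast _) len_X_le rfl p)
      l3) ?_
    rw [← Polynomial.coe_evalRingHom, map_eval, ← h0]
    congr 1
    funext i
    fin_cases i <;> simp
  have e2 : p.eval ![((Nat.pow 2 a : ℕ) : ℤ[X][X]), X, C X, 1] = 0 := by
    refine eq_zero_of_eval_natCast (m := Nat.pow 2 b) _ (lt_of_le_of_lt
      (len_eval_le (R := ℤ[X][X]) (Nat.pow 2 a, 1, 1) ![_, _, _, _] (len_natCast _) len_X_le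
        ((len_C_le _).trans len_X_le) rfl p) l2) ?_
    rw [← Polynomial.coe_evalRingHom, map_eval, ← e3]
    congr 1
    funext i
    fin_cases i <;> simp
  have e1 : p.eval ![(X : ℤ[X][X][X]), C X, C (C X), 1] = 0 := by
    refine eq_zero_of_eval_natCast (m := Nat.pow 2 a) _ (lt_of_le_of_lt
      (len_eval_le (R := ℤ[X][X][X]) (1, 1, 1) ![_, _, _, _] len_X_le ((len_C_le _).trans len_X_le)
        ((len_C_le _).trans ((len_C_le _).trans len_X_le)) rfl p) l1) ?_
    refine (map_eval (R := ℤ[X][X][X]) (S := ℤ[X][X]) _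
      (evalRingHom ((Nat.pow 2 a : ℕ) : ℤ[X][X])) p).trans ?_
    rw [← e2]
    congr 1
    funext i
    fin_cases i <;> simp
  have e0 : ∀ u v t : ℂ, p.eval ![u, v, t, 1] = 0 := fun u v t => by
    have := congrArg (eval₂RingHom (eval₂RingHom (eval₂RingHom (Int.castRingHom ℂ) t) v) u) e1
    refine Eq.trans ?_ 
      ((map_eval (R := ℤ[X][X][X]) (S := ℂ) _ _ p).symm.trans (this.trans (map_zero _)))
    congr 1
    funext i
    fin_cases i <;> simp
  -- Rescaling the slice with last coordinate 1 reaches every point whose last coordinate is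
  -- nonzero; the remaining hyperplane follows by continuity.
  have key : ∀ z : ℂ, z ≠ 0 → p.eval ![x 0, x 1, x 2, z] = 0 := fun z hz => by
    have := eval_smul_of_isHomog w ![x 0 / z ^ w.1, x 1 / z ^ w.2.1, x 2 / z ^ w.2.2, 1] z p _ hom
    simp only [Matrix.cons_val, e0, mul_zero] at this
    rw [← this]
    congr 1
    funext i
    fin_cases i <;> simp <;> field_simp
  have cont : Continuous fun z : ℂ => p.eval ![x 0, x 1, x 2, z] := by
    clear * -
    induction p with
    | terms l =>
      induction l with
      | nil => exact continuous_const
      | cons m l ih =>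
        simp only [eval_terms, evalList, evalMonomial, Matrix.cons_val] at ih ⊢
        exact (by fun_prop : Continuous fun z : ℂ => _).add ih
    | add p q hp hq => exact hp.add hq
    | sub p q hp hq => exact hp.sub hq
    | mul p q hp hq => exact hp.mul hq
  have := cont.ext_on (dense_compl_singleton (0 : ℂ)) continuous_const (fun z hz => key z hz)
  have hx := congrFun this (x 3)
  rw [← hx]
  congr 1
  funext i
  fin_cases i <;> rfl

end PolyExpr

namespace H44

open PolyExpr

/-! ### The polynomial data in the coordinates `(t₁, Z, t₃, t₄)` -/

/-- The coordinate `t₂` as a polynomial in `(t₁, Z, t₃, t₄)`. -/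
def qE : PolyExpr :=
  .terms [(1, 0, 5, 0, 0), (10, 0, 3, 2, 0), (40, 0, 3, 1, 1), (30, 0, 3, 0, 2),
    (60, 0, 2, 2, 1), (240, 0, 2, 1, 2), (260, 0, 2, 0, 3), (-15, 0, 1, 4, 0), (-120, 0, 1, 3, 1),
    (-330, 0, 1, 2, 2), (-360, 0, 1, 1, 3), (-135, 0, 1, 0, 4), (15, 0, 0, 4, 1),
    (120, 0, 0, 3, 2), (530, 0, 0, 2, 3), (1160, 0, 0, 1, 4), (843, 0, 0, 0, 5)]

/-- The coefficient of `t₂ ^ 0` in `prepE`. -/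
def prepE0 : PolyExpr :=
  .terms [(99, 2, 0, 0, 1), (-150, 0, 11, 0, 0), (-396, 0, 10, 1, 0), (-495, 0, 10, 0, 1),
    (-2750, 0, 9, 2, 0), (-11000, 0, 9, 1, 1), (-8250, 0, 9, 0, 2), (-7920, 0, 8, 3, 0),
    (-56430, 0, 8, 2, 1), (-122760, 0, 8, 1, 2), (-94050, 0, 8, 0, 3), (-9900, 0, 7, 4, 0),
    (-126720, 0, 7, 3, 1), (-467280, 0, 7, 2, 2), (-681120, 0, 7, 1, 3), (-346500, 0, 7, 0, 4),
    (-27720, 0, 6, 5, 0), (-395010, 0, 6, 4, 1), (-1995840, 0, 6, 3, 2), (-4661580, 0, 6, 2, 3),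
    (-5146680, 0, 6, 1, 4), (-2113650, 0, 6, 0, 5), (26730, 0, 5, 6, 0), (-166320, 0, 5, 5, 1),
    (-3391740, 0, 5, 4, 2), (-16022160, 0, 5, 3, 3), (-34603470, 0, 5, 2, 4),
    (-36026496, 0, 5, 1, 5), (-14735160, 0, 5, 0, 6), (118800, 0, 4, 7, 0), (1722600, 0, 4, 6, 1),
    (8910000, 0, 4, 5, 2), (20097000, 0, 4, 4, 3), (12870000, 0, 4, 3, 4),
    (-25403400, 0, 4, 2, 5), (-48510000, 0, 4, 1, 6), (-23661000, 0, 4, 0, 7),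
    (-14850, 0, 3, 8, 0), (356400, 0, 3, 7, 1), (5969700, 0, 3, 6, 2), (32630400, 0, 3, 5, 3),
    (88149600, 0, 3, 4, 4), (131131440, 0, 3, 3, 5), (112642860, 0, 3, 2, 6),
    (58285920, 0, 3, 1, 7), (15656850, 0, 3, 0, 8), (-89100, 0, 2, 9, 0), (-1536975, 0, 2, 8, 1),
    (-12117600, 0, 2, 7, 2), (-58895100, 0, 2, 6, 3), (-206652600, 0, 2, 5, 4),
    (-548039250, 0, 2, 4, 5), (-1029504960, 0, 2, 3, 6), (-1213844940, 0, 2, 2, 7),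
    (-752988060, 0, 2, 1, 8), (-164061975, 0, 2, 0, 9), (178200, 0, 1, 9, 1),
    (3519450, 0, 1, 8, 2), (32313600, 0, 1, 7, 3), (173448000, 0, 1, 6, 4),
    (579720240, 0, 1, 5, 5), (1222430220, 0, 1, 4, 6), (1599396480, 0, 1, 3, 7),
    (1234316160, 0, 1, 2, 8), (502607160, 0, 1, 1, 9), (80501850, 0, 1, 0, 10),
    (-4455, 0, 0, 10, 1), (-178200, 0, 0, 9, 2), (-2569050, 0, 0, 8, 3), (-21740400, 0, 0, 7, 4),
    (-120561210, 0, 0, 6, 5), (-458678880, 0, 0, 5, 6), (-1191552120, 0, 0, 4, 7),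
    (-2004227280, 0, 0, 3, 8), (-1955070535, 0, 0, 2, 9), (-858257224, 0, 0, 1, 10),
    (-45669270, 0, 0, 0, 11)]

/-- The coefficient of `t₂ ^ 1` in `prepE`. -/
def prepE1 : PolyExpr :=
  .terms [(198, 1, 0, 1, 0)]

/-- The prepotential, multiplied by `198`. -/
def prepE : PolyExpr :=
  prepE0 + qE * prepE1

/-- The coefficient of `t₂ ^ 0` in `yE1`. -/
def yE10 : PolyExpr :=
  .terms [(-164430, 2, 0, 4, 1), (-1315440, 2, 0, 3, 2), (-3844260, 2, 0, 2, 3),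
    (-4853520, 2, 0, 1, 4), (-2164806, 2, 0, 0, 5), (-46620, 1, 4, 5, 1), (-466200, 1, 4, 4, 2),
    (-1773240, 1, 4, 3, 3), (-3180240, 1, 4, 2, 4), (-2653140, 1, 4, 1, 5), (-803880, 1, 4, 0, 6),
    (114240, 1, 3, 7, 0), (1599360, 1, 3, 6, 1), (9705150, 1, 3, 5, 2), (33077100, 1, 3, 4, 3),
    (69522180, 1, 3, 3, 4), (92617560, 1, 3, 2, 5), (74024790, 1, 3, 1, 6),
    (27351660, 1, 3, 0, 7), (-15120, 1, 2, 7, 1), (-211680, 1, 2, 6, 2), (-3845520, 1, 2, 5, 3),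
    (-29988000, 1, 2, 4, 4), (-113047200, 1, 2, 3, 5), (-225570240, 1, 2, 2, 6),
    (-231759360, 1, 2, 1, 7), (-97251840, 1, 2, 0, 8), (-141120, 1, 1, 9, 0),
    (-2540160, 1, 1, 8, 1), (-17575740, 1, 1, 7, 2), (-56395080, 1, 1, 6, 3),
    (-38118780, 1, 1, 5, 4), (357293160, 1, 1, 4, 5), (1399923420, 1, 1, 3, 6),
    (2400609960, 1, 1, 2, 7), (2057206620, 1, 1, 1, 8), (712487160, 1, 1, 0, 9),
    (28513800, 1, 0, 9, 1), (513248400, 1, 0, 8, 2), (4000050600, 1, 0, 7, 3),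
    (17678161200, 1, 0, 6, 4), (49036806000, 1, 0, 5, 5), (89821989600, 1, 0, 4, 6),
    (113150026920, 1, 0, 3, 7), (103042663920, 1, 0, 2, 8), (68111856120, 1, 0, 1, 9),
    (25090865520, 1, 0, 0, 10), (225, 0, 8, 4, 3), (1800, 0, 8, 3, 4), (4950, 0, 8, 2, 5),
    (5400, 0, 8, 1, 6), (2025, 0, 8, 0, 7), (5400, 0, 7, 4, 4), (43200, 0, 7, 3, 5),
    (126000, 0, 7, 2, 6), (158400, 0, 7, 1, 7), (70200, 0, 7, 0, 8), (-2700, 0, 6, 6, 3),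
    (-32400, 0, 6, 5, 4), (-121500, 0, 6, 4, 5), (-108000, 0, 6, 3, 6), (337500, 0, 6, 2, 7),
    (831600, 0, 6, 1, 8), (535500, 0, 6, 0, 9), (-25650, 0, 5, 6, 4), (-307800, 0, 5, 5, 5),
    (-1415250, 0, 5, 4, 6), (-3114000, 0, 5, 3, 7), (-3307950, 0, 5, 2, 8),
    (-1452600, 0, 5, 1, 9), (-125550, 0, 5, 0, 10), (16561860, 0, 4, 10, 1),
    (331237200, 0, 4, 9, 2), (2939165645, 0, 4, 8, 3), (15227879120, 0, 4, 7, 4),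
    (50844400500, 0, 4, 6, 5), (113517812720, 0, 4, 5, 6), (169129871150, 0, 4, 4, 7),
    (160462051440, 0, 4, 3, 8), (84058972000, 0, 4, 2, 9), (12789015040, 0, 4, 1, 10),
    (-5145601875, 0, 4, 0, 11), (-13482560, 0, 3, 12, 0), (-323581440, 0, 3, 11, 1),
    (-3429078870, 0, 3, 10, 2), (-21122966200, 0, 3, 9, 3), (-83502915015, 0, 3, 8, 4),
    (-219447220080, 0, 3, 7, 5), (-379424004920, 0, 3, 6, 6), (-396171632160, 0, 3, 5, 7),
    (-159576392790, 0, 3, 4, 8), (151452210000, 0, 3, 3, 9), (241285828350, 0, 3, 2, 10),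
    (114867728760, 0, 3, 1, 11), (11533193965, 0, 3, 0, 12), (-64723680, 0, 2, 12, 1),
    (-1553368320, 0, 2, 11, 2), (-17379662880, 0, 2, 10, 3), (-119765904000, 0, 2, 9, 4),
    (-570111869640, 0, 2, 8, 5), (-1998548319360, 0, 2, 7, 6), (-5361270379440, 0, 2, 6, 7),
    (-11200275624000, 0, 2, 5, 8), (-18131069931360, 0, 2, 4, 9), (-22060526165760, 0, 2, 3, 10),
    (-18961639423440, 0, 2, 2, 11), (-10237991411520, 0, 2, 1, 12), (-2609003447640, 0, 2, 0, 13),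
    (42611520, 0, 1, 14, 0), (1193122560, 0, 1, 13, 1), (14721448140, 0, 1, 12, 2),
    (105145262880, 0, 1, 11, 3), (469572887280, 0, 1, 10, 4), (1249790969280, 0, 1, 9, 5),
    (1114813850860, 0, 1, 8, 6), (-5723934259520, 0, 1, 7, 7), (-29740325063280, 0, 1, 6, 8),
    (-75535900424000, 0, 1, 5, 9), (-125256834868940, 0, 1, 4, 10),
    (-142926704208480, 0, 1, 3, 11), (-110581088197120, 0, 1, 2, 12),
    (-53312566785280, 0, 1, 1, 13), (-12255008872620, 0, 1, 0, 14), (-29292690, 0, 0, 14, 1),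
    (-820195320, 0, 0, 13, 2), (-6999178480, 0, 0, 12, 3), (2620343040, 0, 0, 11, 4),
    (479633884512, 0, 0, 10, 5), (4204075665280, 0, 0, 9, 6), (20067909135750, 0, 0, 8, 7),
    (62134558132320, 0, 0, 7, 8), (130861824336350, 0, 0, 6, 9), (186992066838888, 0, 0, 5, 10),
    (171096028587180, 0, 0, 4, 11), (78681803681760, 0, 0, 3, 12), (-16250437730220, 0, 0, 2, 13),
    (-46426601177520, 0, 0, 1, 14), (-22667569904962, 0, 0, 0, 15)]

/-- The coefficient of `t₂ ^ 1` in `yE1`. -/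
def yE11 : PolyExpr :=
  .terms [(42, 2, 0, 0, 0), (-210, 1, 4, 1, 0), (-420, 1, 4, 0, 1), (-1890, 1, 3, 1, 1),
    (-3780, 1, 3, 0, 2), (2100, 1, 2, 3, 0), (12600, 1, 2, 2, 1), (23100, 1, 2, 1, 2),
    (12600, 1, 2, 0, 3), (-104580, 1, 1, 3, 1), (-627480, 1, 1, 2, 2), (-1244460, 1, 1, 1, 3),
    (-815640, 1, 1, 0, 4), (89250, 1, 0, 5, 0), (1550220, 1, 0, 4, 1), (8585220, 1, 0, 3, 2),
    (21037800, 1, 0, 2, 3), (23828490, 1, 0, 1, 4), (10008684, 1, 0, 0, 5), (-450, 0, 5, 2, 3),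
    (-1800, 0, 5, 1, 4), (-1350, 0, 5, 0, 5), (228620, 0, 4, 6, 0), (2836680, 0, 4, 5, 1),
    (15817200, 0, 4, 4, 2), (49466480, 0, 4, 3, 3), (91783860, 0, 4, 2, 4),
    (96693240, 0, 4, 1, 5), (45585960, 0, 4, 0, 6), (-228480, 0, 3, 7, 0), (-2240700, 0, 3, 6, 1),
    (-7914060, 0, 3, 5, 2), (-11938395, 0, 3, 4, 3), (-11884320, 0, 3, 3, 4),
    (-43361430, 0, 3, 2, 5), (-107328900, 0, 3, 1, 6), (-87125115, 0, 3, 0, 7),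
    (2465680, 0, 2, 8, 0), (39481120, 0, 2, 7, 1), (289891980, 0, 2, 6, 2),
    (1272065200, 0, 2, 5, 3), (3617141020, 0, 2, 4, 4), (6749433120, 0, 2, 3, 5),
    (7964410020, 0, 2, 2, 6), (5344717200, 0, 2, 1, 7), (1534267620, 0, 2, 0, 8),
    (282240, 0, 1, 9, 0), (38725680, 0, 1, 8, 1), (573477240, 0, 1, 7, 2),
    (3895595560, 0, 1, 6, 3), (15323659800, 0, 1, 5, 4), (38092662600, 0, 1, 4, 5),
    (61840178440, 0, 1, 3, 6), (65461451880, 0, 1, 2, 7), (42875701800, 0, 1, 1, 8),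
    (13938177080, 0, 1, 0, 9), (-5667634, 0, 0, 10, 0), (-170380280, 0, 0, 9, 1),
    (-1955803360, 0, 0, 8, 2), (-11987148880, 0, 0, 7, 3), (-44692143980, 0, 0, 6, 4),
    (-108705602416, 0, 0, 5, 5), (-183359111760, 0, 0, 4, 6), (-234714455760, 0, 0, 3, 7),
    (-249632019090, 0, 0, 2, 8), (-203506674360, 0, 0, 1, 9), (-86556812352, 0, 0, 0, 10)]

/-- The coefficient of `t₂ ^ 2` in `yE1`. -/
def yE12 : PolyExpr :=
  .terms [(-168, 1, 0, 0, 0), (420, 0, 4, 1, 0), (1050, 0, 4, 0, 1), (1050, 0, 3, 2, 0),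
    (7980, 0, 3, 1, 1), (8820, 0, 3, 0, 2), (-4200, 0, 2, 3, 0), (-20790, 0, 2, 2, 1),
    (-28560, 0, 2, 1, 2), (-3290, 0, 2, 0, 3), (27300, 0, 1, 4, 0), (427560, 0, 1, 3, 1),
    (1892100, 0, 1, 2, 2), (3290280, 0, 1, 1, 3), (2080680, 0, 1, 0, 4), (-178500, 0, 0, 5, 0),
    (-2334570, 0, 0, 4, 1), (-11043480, 0, 0, 3, 2), (-24410930, 0, 0, 2, 3),
    (-26013980, 0, 0, 1, 4), (-11210172, 0, 0, 0, 5)]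

/-- The coefficient of `t₂ ^ 3` in `yE1`. -/
def yE13 : PolyExpr :=
  .terms [(168, 0, 0, 0, 0)]

/-- The expression of `y₁`, up to its scalar factor. -/
def yE1 : PolyExpr :=
  yE10 + qE * (yE11 + qE * (yE12 + qE * yE13))

/-- The coefficient of `t₂ ^ 0` in `yE2`. -/
def yE20 : PolyExpr :=
  .terms [(1, 2, 0, 0, 0), (-1026, 1, 0, 5, 0), (-10260, 1, 0, 4, 1), (-30780, 1, 0, 3, 2),
    (-20520, 1, 0, 2, 3), (46710, 1, 0, 1, 4), (60588, 1, 0, 0, 5), (-405, 0, 4, 6, 0),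
    (-4860, 0, 4, 5, 1), (-22485, 0, 4, 4, 2), (-50280, 0, 4, 3, 3), (-55975, 0, 4, 2, 4),
    (-29020, 0, 4, 1, 5), (-6375, 0, 4, 0, 6), (-9085, 0, 3, 6, 1), (-109020, 0, 3, 5, 2),
    (-550695, 0, 3, 4, 3), (-1498360, 0, 3, 3, 4), (-2341695, 0, 3, 2, 5), (-2031420, 0, 3, 1, 6),
    (-778805, 0, 3, 0, 7), (-4050, 0, 2, 8, 0), (-64800, 0, 2, 7, 1), (-511200, 0, 2, 6, 2),
    (-2505600, 0, 2, 5, 3), (-8058900, 0, 2, 4, 4), (-17008800, 0, 2, 3, 5),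
    (-22768320, 0, 2, 2, 6), (-17671680, 0, 2, 1, 7), (-6115770, 0, 2, 0, 8), (33450, 0, 1, 8, 1),
    (535200, 0, 1, 7, 2), (3797100, 0, 1, 6, 3), (15594000, 0, 1, 5, 4), (39864360, 0, 1, 4, 5),
    (62921280, 0, 1, 3, 6), (56624500, 0, 1, 2, 7), (23108560, 0, 1, 1, 8), (1355790, 0, 1, 0, 9),
    (10044, 0, 0, 10, 0), (200880, 0, 0, 9, 1), (1253640, 0, 0, 8, 2), (773760, 0, 0, 7, 3),
    (-27933080, 0, 0, 6, 4), (-162541344, 0, 0, 5, 5), (-465541320, 0, 0, 4, 6),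
    (-804407360, 0, 0, 3, 7), (-886614660, 0, 0, 2, 8), (-625055760, 0, 0, 1, 9),
    (-240893344, 0, 0, 0, 10)]

/-- The coefficient of `t₂ ^ 1` in `yE2`. -/
def yE21 : PolyExpr :=
  .terms [(-4, 1, 0, 0, 0), (10, 0, 4, 0, 1), (-45, 0, 3, 2, 0), (-180, 0, 3, 1, 1),
    (-225, 0, 3, 0, 2), (-100, 0, 2, 2, 1), (-400, 0, 2, 1, 2), (-300, 0, 2, 0, 3),
    (-810, 0, 1, 4, 0), (-6480, 0, 1, 3, 1), (-16080, 0, 1, 2, 2), (-12480, 0, 1, 1, 3),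
    (2410, 0, 1, 0, 4), (2052, 0, 0, 5, 0), (12220, 0, 0, 4, 1), (-4840, 0, 0, 3, 2),
    (-163520, 0, 0, 2, 3), (-380460, 0, 0, 1, 4), (-287748, 0, 0, 0, 5)]

/-- The coefficient of `t₂ ^ 2` in `yE2`. -/
def yE22 : PolyExpr :=
  .terms [(3, 0, 0, 0, 0)]

/-- The expression of `y₂`, up to its scalar factor. -/
def yE2 : PolyExpr :=
  yE20 + qE * (yE21 + qE * yE22)

/-- The coefficient of `t₂ ^ 0` in `yE3`. -/
def yE30 : PolyExpr :=
  .terms [(-30, 1, 0, 1, 0), (-60, 1, 0, 0, 1), (5, 0, 4, 2, 0), (20, 0, 4, 1, 1),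
    (15, 0, 4, 0, 2), (60, 0, 3, 2, 1), (240, 0, 3, 1, 2), (260, 0, 3, 0, 3), (-30, 0, 2, 4, 0),
    (-240, 0, 2, 3, 1), (-660, 0, 2, 2, 2), (-720, 0, 2, 1, 3), (-270, 0, 2, 0, 4),
    (75, 0, 1, 4, 1), (600, 0, 1, 3, 2), (2650, 0, 1, 2, 3), (5800, 0, 1, 1, 4),
    (4215, 0, 1, 0, 5), (-1485, 0, 0, 6, 0), (-17820, 0, 0, 5, 1), (-111825, 0, 0, 4, 2),
    (-419400, 0, 0, 3, 3), (-832575, 0, 0, 2, 4), (-735420, 0, 0, 1, 5), (-101555, 0, 0, 0, 6)]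

/-- The coefficient of `t₂ ^ 1` in `yE3`. -/
def yE31 : PolyExpr :=
  .terms [(-5, 0, 1, 0, 0), (60, 0, 0, 1, 0), (150, 0, 0, 0, 1)]

/-- The expression of `y₃`, multiplied by `5` and up to its scalar factor. -/
def yE3 : PolyExpr :=
  yE30 + qE * yE31

/-- The derivative of `prepE` with respect to `t₂`. -/
def prepZ : PolyExpr :=
  .terms [(198, 1, 0, 1, 0), (-330, 0, 6, 0, 0), (-792, 0, 5, 1, 0), (-990, 0, 5, 0, 1),
    (-2970, 0, 4, 2, 0), (-11880, 0, 4, 1, 1), (-8910, 0, 4, 0, 2), (-7920, 0, 3, 3, 0),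
    (-57420, 0, 3, 2, 1), (-126720, 0, 3, 1, 2), (-98340, 0, 3, 0, 3), (2970, 0, 2, 4, 0),
    (-23760, 0, 2, 3, 1), (-184140, 0, 2, 2, 2), (-372240, 0, 2, 1, 3), (-230670, 0, 2, 0, 4),
    (11880, 0, 1, 5, 0), (109890, 0, 1, 4, 1), (380160, 0, 1, 3, 2), (611820, 0, 1, 2, 3),
    (463320, 0, 1, 1, 4), (133650, 0, 1, 0, 5), (-11880, 0, 0, 5, 1), (-139590, 0, 0, 4, 2),
    (-776160, 0, 0, 3, 3), (-1997820, 0, 0, 2, 4), (-2132856, 0, 0, 1, 5), (-596310, 0, 0, 0, 6)]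

/-- The derivative with respect to `t₂` of the derivative of `prepE` with respect to the coordinate 0. -/
def prepZ1 : PolyExpr :=
  .terms [(198, 0, 0, 1, 0)]

/-- The derivative with respect to `t₂` of the derivative of `prepE` with respect to the coordinate 1. -/
def prepZ2 : PolyExpr :=
  .terms [(-396, 0, 1, 0, 0), (-792, 0, 0, 1, 0), (-990, 0, 0, 0, 1)]

/-- The derivative with respect to `t₂` of the derivative of `prepE` with respect to the coordinate 2. -/
def prepZ3 : PolyExpr :=
  .terms [(198, 1, 0, 0, 0), (-792, 0, 5, 0, 0), (1980, 0, 4, 1, 0), (3960, 0, 4, 0, 1),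
    (-7920, 0, 3, 2, 0), (-15840, 0, 3, 1, 1), (7920, 0, 3, 0, 2), (-11880, 0, 2, 3, 0),
    (-118800, 0, 2, 2, 1), (-320760, 0, 2, 1, 2), (-277200, 0, 2, 0, 3), (11880, 0, 1, 4, 0),
    (118800, 0, 1, 3, 1), (403920, 0, 1, 2, 2), (704880, 0, 1, 1, 3), (566280, 0, 1, 0, 4),
    (-11880, 0, 0, 4, 1), (-213840, 0, 0, 3, 2), (-1132560, 0, 0, 2, 3), (-2027520, 0, 0, 1, 4),
    (-984456, 0, 0, 0, 5)]

/-- The derivative with respect to `t₂` of the derivative of `prepE` with respect to the coordinate 3. -/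
def prepZ4 : PolyExpr :=
  .terms [(-990, 0, 5, 0, 0), (3960, 0, 4, 1, 0), (5940, 0, 4, 0, 1), (-1980, 0, 3, 2, 0),
    (23760, 0, 3, 1, 1), (73260, 0, 3, 0, 2), (-23760, 0, 2, 3, 0), (-190080, 0, 2, 2, 1),
    (-451440, 0, 2, 1, 2), (-364320, 0, 2, 0, 3), (20790, 0, 1, 4, 0), (213840, 0, 1, 3, 1),
    (956340, 0, 1, 2, 2), (2193840, 0, 1, 1, 3), (1802790, 0, 1, 0, 4), (-74250, 0, 0, 4, 1),
    (-831600, 0, 0, 3, 2), (-2742300, 0, 0, 2, 3), (-2732400, 0, 0, 1, 4), (594990, 0, 0, 0, 5)]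

/-- The derivative of `yE1` with respect to `t₂`. -/
def yZ1 : PolyExpr :=
  .terms [(42, 2, 0, 0, 0), (-336, 1, 5, 0, 0), (-378, 1, 4, 1, 0), (-756, 1, 4, 0, 1),
    (-3360, 1, 3, 2, 0), (-16464, 1, 3, 1, 1), (-16128, 1, 3, 0, 2), (2268, 1, 2, 3, 0),
    (-6552, 1, 2, 2, 1), (-55692, 1, 2, 1, 2), (-73752, 1, 2, 0, 3), (5040, 1, 1, 4, 0),
    (-95760, 1, 1, 3, 1), (-705600, 1, 1, 2, 2), (-1496880, 1, 1, 1, 3), (-1013040, 1, 1, 0, 4),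
    (98658, 1, 0, 5, 0), (1639260, 1, 0, 4, 1), (8861580, 1, 0, 3, 2), (21254520, 1, 0, 2, 3),
    (23471490, 1, 0, 1, 4), (9540972, 1, 0, 0, 5), (504, 0, 10, 0, 0), (1176, 0, 9, 1, 0),
    (2940, 0, 9, 0, 1), (12810, 0, 8, 2, 0), (61068, 0, 8, 1, 1), (53172, 0, 8, 0, 2),
    (3024, 0, 7, 3, 0), (95760, 0, 7, 2, 1), (343728, 0, 7, 1, 2), (352464, 0, 7, 0, 3),
    (125160, 0, 6, 4, 0), (1651440, 0, 6, 3, 1), (6722520, 0, 6, 2, 2), (10951920, 0, 6, 1, 3),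
    (6541920, 0, 6, 0, 4), (-480816, 0, 5, 5, 0), (-4996152, 0, 5, 4, 1), (-18831456, 0, 5, 3, 2),
    (-32025840, 0, 5, 2, 3), (-24369072, 0, 5, 1, 4), (-7542360, 0, 5, 0, 5),
    (844326, 0, 4, 6, 0), (14384412, 0, 4, 5, 1), (97462764, 0, 4, 4, 2), (334753272, 0, 4, 3, 3),
    (625939902, 0, 4, 2, 4), (617380092, 0, 4, 1, 5), (255529176, 0, 4, 0, 6),
    (-3855600, 0, 3, 7, 0), (-60344928, 0, 3, 6, 1), (-357040656, 0, 3, 5, 2),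
    (-1019408880, 0, 3, 4, 3), (-1383743760, 0, 3, 3, 4), (-521169600, 0, 3, 2, 5),
    (611080848, 0, 3, 1, 6), (493866576, 0, 3, 0, 7), (3296916, 0, 2, 8, 0),
    (22881096, 0, 2, 7, 1), (-88700724, 0, 2, 6, 2), (-1431587304, 0, 2, 5, 3),
    (-6282819900, 0, 2, 4, 4), (-14133278376, 0, 2, 3, 5), (-17829967596, 0, 2, 2, 6),
    (-12166974456, 0, 2, 1, 7), (-3608503416, 0, 2, 0, 8), (5919480, 0, 1, 9, 0),
    (172711980, 0, 1, 8, 1), (1884859200, 0, 1, 7, 2), (11044333440, 0, 1, 6, 3),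
    (39747319920, 0, 1, 5, 4), (93399014520, 0, 1, 4, 5), (146476350720, 0, 1, 3, 6),
    (151408807200, 0, 1, 2, 7), (96231625560, 0, 1, 1, 8), (29553333180, 0, 1, 0, 9),
    (-8508402, 0, 0, 10, 0), (-232832880, 0, 0, 9, 1), (-2572112340, 0, 0, 8, 2),
    (-15629362560, 0, 0, 7, 3), (-59333308020, 0, 0, 6, 4), (-151360541136, 0, 0, 5, 5),
    (-274662232320, 0, 0, 4, 6), (-374445224160, 0, 0, 3, 7), (-393656152890, 0, 0, 2, 8),
    (-293213770080, 0, 0, 1, 9), (-112310162412, 0, 0, 0, 10)]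

/-- The derivative of `yE2` with respect to `t₂`. -/
def yZ2 : PolyExpr :=
  .terms [(-4, 1, 0, 0, 0), (6, 0, 5, 0, 0), (18, 0, 4, 0, 1), (-12, 0, 3, 2, 0),
    (-48, 0, 3, 1, 1), (-180, 0, 3, 0, 2), (252, 0, 2, 2, 1), (1008, 0, 2, 1, 2),
    (1236, 0, 2, 0, 3), (-1170, 0, 1, 4, 0), (-9360, 0, 1, 3, 1), (-23580, 0, 1, 2, 2),
    (-19440, 0, 1, 1, 3), (1710, 0, 1, 0, 4), (2052, 0, 0, 5, 0), (10890, 0, 0, 4, 1),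
    (-15480, 0, 0, 3, 2), (-194820, 0, 0, 2, 3), (-420540, 0, 0, 1, 4), (-307782, 0, 0, 0, 5)]

/-- The derivative of `yE3` with respect to `t₂`. -/
def yZ3 : PolyExpr :=
  .terms [(-6, 0, 1, 0, 0), (60, 0, 0, 1, 0), (150, 0, 0, 0, 1)]

/-- The derivatives with respect to `t₁, t₂, t₃, t₄` of an expression `p` in `(t₁, Z, t₃, t₄)`,
where `p'` is the derivative with respect to `t₂`. -/
def tDeriv (p p' : PolyExpr) : Fin 4 → PolyExpr
  | 0 => pderiv 0 p
  | 1 => p'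
  | 2 => pderiv 2 p - pderiv 2 qE * p'
  | 3 => pderiv 3 p - pderiv 3 qE * p'

/-- The condition on `p'` in `tDeriv`. -/
def IsZDeriv (p p' : PolyExpr) : Prop :=
  ∀ u : Fin 4 → ℂ, (pderiv 1 qE).eval u * p'.eval u = (pderiv 1 p).eval u

/-- The first derivatives of the prepotential, multiplied by `198`. -/
def prepD : Fin 4 → PolyExpr := tDeriv prepE prepZ

/-- The derivatives of `prepD` with respect to `t₂`. -/
def prepDZ : Fin 4 → PolyExpr
  | 0 => prepZ1
  | 1 => prepZ2
  | 2 => prepZ3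
  | 3 => prepZ4

/-- The components of the Euler vector field, multiplied by `5`. -/
def eulerE : Fin 4 → PolyExpr
  | 0 => .terms [(5, 1, 0, 0, 0)]
  | 1 => const 5 * qE
  | 2 => .terms [(1, 0, 0, 1, 0)]
  | 3 => .terms [(1, 0, 0, 0, 1)]

/-- The weights of the coordinates, multiplied by `5`. -/
def weightE : Fin 4 → ℤ
  | 0 => 5
  | 1 => 5
  | 2 => 1
  | 3 => 1

/-- The contravariant intersection form with lowered indices, multiplied by `990`. -/
def formE (l m : Fin 4) : PolyExpr :=
  const (11 - weightE m) * tDeriv (prepD m) (prepDZ m) l -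
    const (weightE l) * tDeriv (prepD l) (prepDZ l) m

/-- The intersection form of two functions. -/
def pairE (p p' q q' : PolyExpr) : PolyExpr :=
  let row (l : Fin 4) : PolyExpr :=
    tDeriv p p' l * (formE l.rev 3 * tDeriv q q' 0 + formE l.rev 2 * tDeriv q q' 1 +
      formE l.rev 1 * tDeriv q q' 2 + formE l.rev 0 * tDeriv q q' 3)
  row 0 + row 1 + row 2 + row 3

/-- The expression of `y₄`, divided by `20`. -/
def yE4 : PolyExpr := .terms [(1, 0, 0, 0, 1)]

/-! ### Certificates for the derivatives with respect to t₂. -/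

/-- The quotient of the Z-derivative by ∂t₂/∂Z is supplied explicitly, so only a product has to be
compared and no division is carried out. -/
theorem isZDeriv_of_vanishes {p p' : PolyExpr} {a b c : ℕ}
    (h : (pderiv 1 qE * p' - pderiv 1 p).vanishes (5, 1, 1) a b c = true) : IsZDeriv p p' :=
  fun u => sub_eq_zero.mp (eval_eq_zero_of_vanishes h u)

/-- Any exponents satisfying the length bounds in `vanishes` serve equally well, here and below. -/
theorem isZDeriv_prepE : IsZDeriv prepE prepZ :=
  isZDeriv_of_vanishes (a := 60) (b := 500) (c := 6000) (by decide +kernel)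

theorem isZDeriv_prepD0 : IsZDeriv (prepD 0) (prepDZ 0) :=
  isZDeriv_of_vanishes (a := 60) (b := 500) (c := 6000) (by decide +kernel)

theorem isZDeriv_prepD1 : IsZDeriv (prepD 1) (prepDZ 1) :=
  isZDeriv_of_vanishes (a := 60) (b := 500) (c := 6000) (by decide +kernel)

theorem isZDeriv_prepD2 : IsZDeriv (prepD 2) (prepDZ 2) :=
  isZDeriv_of_vanishes (a := 60) (b := 500) (c := 6000) (by decide +kernel)

theorem isZDeriv_prepD3 : IsZDeriv (prepD 3) (prepDZ 3) :=
  isZDeriv_of_vanishes (a := 60) (b := 500) (c := 6000) (by decide +kernel)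

theorem isZDeriv_yE1 : IsZDeriv yE1 yZ1 :=
  isZDeriv_of_vanishes (a := 90) (b := 500) (c := 9000) (by decide +kernel)

theorem isZDeriv_yE2 : IsZDeriv yE2 yZ2 :=
  isZDeriv_of_vanishes (a := 90) (b := 500) (c := 9000) (by decide +kernel)

theorem isZDeriv_yE3 : IsZDeriv yE3 yZ3 :=
  isZDeriv_of_vanishes (a := 90) (b := 500) (c := 9000) (by decide +kernel)
-- The intersection form in terms of the right-hand sides.
-- In each of these six identities the subtracted polynomial is an entry of `gram`, rewritten for
-- the rescaled invariants `yE`. The constant in front of `pairE` clears the denominators caused by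
-- the rescaling.
theorem pairE11_vanishes :
    (const 5 * pairE yE1 yZ1 yE1 yZ1 - (
      const 13471920000 * yE1 * yE2 * yE4 * yE4 * yE4 * yE4 - const 22453200 * yE1 * yE3 * yE3 *
      yE4 * yE4 - const 2829103200 * yE2 * yE2 * yE3 * yE4 * yE4 * yE4 + const 10128888 * yE2 *
      yE3 * yE3 * yE3 * yE4)).vanishes
      (5, 1, 1) 250 1800 60000 = true := by
  decide +kernel

theorem pairE12_vanishes :
    (const 25 * pairE yE1 yZ1 yE2 yZ2 - (
      const (-160380000) * yE1 * yE3 * yE4 * yE4 * yE4 + const 20207880000 * yE2 * yE2 * yE4 * yE4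
      * yE4 * yE4 + const 52390800 * yE2 * yE3 * yE3 * yE4 * yE4 - const 16632 * yE3 * yE3 * yE3 *
      yE3)).vanishes
      (5, 1, 1) 250 1800 60000 = true := by
  decide +kernel

theorem pairE13_vanishes :
    (const 1 * pairE yE1 yZ1 yE3 yZ3 - (
      const 1924560000 * yE1 * yE4 * yE4 * yE4 * yE4 * yE4 - const 1247400 * yE2 * yE2 - const
      269438400 * yE2 * yE3 * yE4 * yE4 * yE4 * yE4 + const 99792 * yE3 * yE3 * yE3 * yE4 * yE4)).vanishes
      (5, 1, 1) 250 1800 60000 = true := by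
  decide +kernel

theorem pairE22_vanishes :
    (const 35 * pairE yE2 yZ2 yE2 yZ2 - (
      const (-106920000) * yE1 * yE4 * yE4 * yE4 * yE4 - const 104781600 * yE2 * yE3 * yE4 * yE4 *
      yE4 - const 105336 * yE3 * yE3 * yE3 * yE4)).vanishes
      (5, 1, 1) 250 1800 60000 = true := by
  decide +kernel

theorem pairE23_vanishes :
    (const 7 * pairE yE2 yZ2 yE3 yZ3 - (
      const 29700 * yE1 + const 8083152000 * yE2 * yE4 * yE4 * yE4 * yE4 * yE4 + const 2993760 *
      yE3 * yE3 * yE4 * yE4 * yE4)).vanishes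
      (5, 1, 1) 250 1800 60000 = true := by
  decide +kernel

theorem pairE33_vanishes :
    (const 1 * pairE yE3 yZ3 yE3 yZ3 - (
      const (-1960200) * yE2 * yE4 + const 384912000 * yE3 * yE4 * yE4 * yE4 * yE4 * yE4)).vanishes
      (5, 1, 1) 250 1800 60000 = true := by
  decide +kernel
-- The prepotential has degree 3 − d = 11/5; the denominator is absorbed by the factor 5 in
-- `eulerE`.
theorem euler_vanishes :
    (eulerE 0 * prepD 0 + eulerE 1 * prepD 1 + eulerE 2 * prepD 2 + eulerE 3 * prepD 3 -
      const 11 * prepE).vanishes (5, 1, 1) 60 500 6000 = true := by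
  decide +kernel

/-! ### The invariants in terms of `(h10, h6, x₁ ^ 2, h2)` -/

/-- The invariant `y₁` as a polynomial in `(h10, h6, x₁ ^ 2, h2)`, multiplied by `15`. -/
def hE1 : PolyExpr :=
  .terms [(20, 3, 0, 0, 0), (5220, 2, 1, 2, 0), (48600, 2, 0, 5, 0), (-48480, 2, 0, 4, 1),
    (17520, 2, 0, 3, 2), (-2280, 2, 0, 2, 3), (120, 2, 0, 1, 4), (-1305, 1, 3, 1, 0),
    (-45, 1, 3, 0, 1), (-13590, 1, 2, 4, 0), (-28620, 1, 2, 3, 1), (6120, 1, 2, 2, 2),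
    (-630, 1, 2, 1, 3), (-114300, 1, 1, 7, 0), (352620, 1, 1, 6, 1), (-379980, 1, 1, 5, 2),
    (163620, 1, 1, 4, 3), (-32580, 1, 1, 3, 4), (900, 1, 1, 2, 5), (5400, 1, 0, 10, 0),
    (-43200, 1, 0, 9, 1), (150360, 1, 0, 8, 2), (-252840, 1, 0, 7, 3), (213240, 1, 0, 6, 4),
    (-107400, 1, 0, 5, 5), (32160, 1, 0, 4, 6), (-5160, 1, 0, 3, 7), (240, 1, 0, 2, 8),
    (27, 0, 5, 0, 0), (35910, 0, 4, 3, 0), (-13635, 0, 4, 2, 1), (2025, 0, 4, 1, 2),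
    (-86940, 0, 3, 6, 0), (110250, 0, 3, 5, 1), (-29340, 0, 3, 4, 2), (4320, 0, 3, 3, 3),
    (1260, 0, 3, 2, 4), (-90, 0, 3, 1, 5), (16200, 0, 2, 9, 0), (-84420, 0, 2, 8, 1),
    (278820, 0, 2, 7, 2), (-410940, 0, 2, 6, 3), (299520, 0, 2, 5, 4), (-103860, 0, 2, 4, 5),
    (19980, 0, 2, 3, 6), (-1260, 0, 2, 2, 7), (-1800, 0, 1, 11, 1), (10080, 0, 1, 10, 2),
    (-24120, 0, 1, 9, 3), (18720, 0, 1, 8, 4), (-18720, 0, 1, 6, 6), (24120, 0, 1, 5, 7),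
    (-10080, 0, 1, 4, 8), (1800, 0, 1, 3, 9), (160, 0, 0, 12, 3), (-1200, 0, 0, 11, 4),
    (4032, 0, 0, 10, 5), (-6640, 0, 0, 9, 6), (4080, 0, 0, 8, 7), (4080, 0, 0, 7, 8),
    (-6640, 0, 0, 6, 9), (4032, 0, 0, 5, 10), (-1200, 0, 0, 4, 11), (160, 0, 0, 3, 12)]

/-- The invariant `y₂` as a polynomial in `(h10, h6, x₁ ^ 2, h2)`, multiplied by `2`. -/
def hE2 : PolyExpr :=
  .terms [(2, 2, 0, 0, 0), (-228, 1, 1, 2, 0), (360, 1, 0, 5, 0), (-928, 1, 0, 4, 1),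
    (592, 1, 0, 3, 2), (-152, 1, 0, 2, 3), (8, 1, 0, 1, 4), (57, 0, 3, 1, 0), (-3, 0, 3, 0, 1),
    (588, 0, 2, 4, 0), (-612, 0, 2, 3, 1), (336, 0, 2, 2, 2), (-42, 0, 2, 1, 3),
    (-60, 0, 1, 7, 0), (276, 0, 1, 6, 1), (-804, 0, 1, 5, 2), (804, 0, 1, 4, 3),
    (-276, 0, 1, 3, 4), (60, 0, 1, 2, 5), (8, 0, 0, 8, 2), (-40, 0, 0, 7, 3), (88, 0, 0, 6, 4),
    (-88, 0, 0, 5, 5), (88, 0, 0, 4, 6), (-40, 0, 0, 3, 7), (8, 0, 0, 2, 8)]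

/-- The invariant `y₃` as a polynomial in `(h10, h6, x₁ ^ 2, h2)`, multiplied by `2`. -/
def hE3 : PolyExpr :=
  .terms [(22, 1, 0, 1, 0), (-2, 1, 0, 0, 1), (3, 0, 2, 0, 0), (66, 0, 1, 3, 0),
    (-66, 0, 1, 2, 1), (-4, 0, 0, 5, 1), (12, 0, 0, 4, 2), (-28, 0, 0, 3, 3), (12, 0, 0, 2, 4),
    (-4, 0, 0, 1, 5)]

/-- The invariant `y₄` as a polynomial in `(h10, h6, x₁ ^ 2, h2)`. -/
def hE4 : PolyExpr :=
  .terms [(1, 0, 0, 1, 0), (1, 0, 0, 0, 1)]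

/-- The scalar product of the gradients of two polynomials in `(h10, h6, x₁ ^ 2, h2)`. -/
def hPairE (p q : PolyExpr) : PolyExpr :=
  .terms [(8, 1, 0, 0, 4), (36, 0, 2, 0, 3), (30, 0, 3, 0, 0)] * (pderiv 0 p * pderiv 0 q) +
  .terms [(8, 0, 1, 0, 4), (28, 0, 2, 0, 1)] * (pderiv 0 p * pderiv 1 q + pderiv 1 p * pderiv 0 q) +
  .terms [(20, 1, 0, 0, 0)] * (pderiv 0 p * pderiv 3 q + pderiv 3 p * pderiv 0 q) +
  .terms [(8, 0, 1, 0, 2), (8, 1, 0, 0, 0)] * (pderiv 1 p * pderiv 1 q) +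
  .terms [(12, 0, 1, 0, 0)] * (pderiv 1 p * pderiv 3 q + pderiv 3 p * pderiv 1 q) +
  .terms [(4, 0, 0, 1, 0)] * (pderiv 2 p * pderiv 2 q) +
  .terms [(4, 0, 0, 0, 1)] * (pderiv 3 p * pderiv 3 q)

/-- The entries of `gram` for the actual invariants. Working in (h10, h6, x₁², h2) instead of x
keeps the degrees small and removes √5 from the coefficients. The weights are half of the degrees in
x. -/
theorem hPairE11_vanishes :
    (const 1 * hPairE hE1 hE1 - (
      const 1200 * hE1 * hE2 * hE4 * hE4 * hE4 * hE4 + const 900 * hE1 * hE3 * hE3 * hE4 * hE4 +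
      const 2700 * hE2 * hE2 * hE3 * hE4 * hE4 * hE4 + const 4350 * hE2 * hE3 * hE3 * hE3 * hE4)).vanishes
      (5, 3, 1) 120 900 20000 = true := by
  decide +kernel

theorem hPairE12_vanishes :
    (const 1 * hPairE hE1 hE2 - (
      const (-120) * hE1 * hE3 * hE4 * hE4 * hE4 + const 360 * hE2 * hE2 * hE4 * hE4 * hE4 * hE4 -
      const 420 * hE2 * hE3 * hE3 * hE4 * hE4 - const 60 * hE3 * hE3 * hE3 * hE3)).vanishes
      (5, 3, 1) 120 900 20000 = true := by
  decide +kernel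

theorem hPairE13_vanishes :
    (const 1 * hPairE hE1 hE3 - (
      const (-80) * hE1 * hE4 * hE4 * hE4 * hE4 * hE4 - const 600 * hE2 * hE2 - const 120 * hE2 *
      hE3 * hE4 * hE4 * hE4 * hE4 - const 20 * hE3 * hE3 * hE3 * hE4 * hE4)).vanishes
      (5, 3, 1) 120 900 20000 = true := by
  decide +kernel

theorem hPairE22_vanishes :
    (const 3 * hPairE hE2 hE2 - (
      const 16 * hE1 * hE4 * hE4 * hE4 * hE4 - const 168 * hE2 * hE3 * hE4 * hE4 * hE4 + const 76
      * hE3 * hE3 * hE3 * hE4)).vanishes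
      (5, 3, 1) 120 900 20000 = true := by
  decide +kernel

theorem hPairE23_vanishes :
    (const 1 * hPairE hE2 hE3 - (
      const (-8) * hE1 - const 48 * hE2 * hE4 * hE4 * hE4 * hE4 * hE4 + const 8 * hE3 * hE3 * hE4
      * hE4 * hE4)).vanishes
      (5, 3, 1) 120 900 20000 = true := by
  decide +kernel

theorem hPairE33_vanishes :
    (const 1 * hPairE hE3 hE3 - (
      const 88 * hE2 * hE4 - const 16 * hE3 * hE4 * hE4 * hE4 * hE4 * hE4)).vanishes
      (5, 3, 1) 120 900 20000 = true := by
  decide +kernel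
-- The gradient of y₄ = ∑ xᵢ² is twice the radial field, so pairing with it multiplies an invariant
-- by twice its degree; hence 60, 40, 24 and 4.
theorem hPairE14_vanishes : (hPairE hE1 hE4 - const 60 * hE1).vanishes (5, 3, 1) 60 500 6000 = true := by
  decide +kernel

theorem hPairE24_vanishes : (hPairE hE2 hE4 - const 40 * hE2).vanishes (5, 3, 1) 60 500 6000 = true := by
  decide +kernel

theorem hPairE34_vanishes : (hPairE hE3 hE4 - const 24 * hE3).vanishes (5, 3, 1) 60 500 6000 = true := by
  decide +kernel

theorem hPairE44_vanishes : (hPairE hE4 hE4 - const 4 * hE4).vanishes (5, 3, 1) 60 500 6000 = true := by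
  decide +kernel

/-! ### Agreement of the coefficient lists with the stated formulas. -/

theorem eval_hE1 (c b s a : ℂ) : hE1.eval ![c, b, s ^ 2, a] = 15 * y1Aux s a b c := by
  simp only [hE1, eval_terms, evalList, evalMonomial, Matrix.cons_val, y1Aux, Int.cast_ofNat, Int.cast_neg, pow_zero, mul_one, pow_one]
  ring

theorem eval_hE2 (c b s a : ℂ) : hE2.eval ![c, b, s ^ 2, a] = 2 * y2Aux s a b c := by
  simp only [hE2, eval_terms, evalList, evalMonomial, Matrix.cons_val, y2Aux, Int.cast_ofNat, Int.cast_neg, pow_zero, mul_one, pow_one]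
  ring

theorem eval_hE3 (c b s a : ℂ) : hE3.eval ![c, b, s ^ 2, a] = 2 * y3Aux s a b c := by
  simp only [hE3, eval_terms, evalList, evalMonomial, Matrix.cons_val, y3Aux, Int.cast_ofNat, Int.cast_neg, pow_zero, mul_one, pow_one]
  ring

theorem eval_hE4 (c b s a : ℂ) : hE4.eval ![c, b, s ^ 2, a] = y4Aux s a := by
  simp only [hE4, eval_terms, evalList, evalMonomial, Matrix.cons_val, y4Aux, Int.cast_one, pow_zero, mul_one, pow_one]
  ring

theorem eval_qE (a z v w : ℂ) : qE.eval ![a, z, v, w] = relP 0 v w z := by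
  simp only [qE, eval_terms, evalList, evalMonomial, Matrix.cons_val, relP, Int.cast_ofNat, Int.cast_neg, Int.cast_one, pow_zero, mul_one, pow_one]
  ring

/-- Since t₂ enters `relP` only through −t₂, the relation can be solved for it. -/
theorem eval_qE_of_relP {a z v w b : ℂ} (h : relP b v w z = 0) : qE.eval ![a, z, v, w] = b := by
  rw [eval_qE]
  simp only [relP] at h ⊢
  linear_combination h

/-- The lists are arranged by powers of t₂, for which `qE` is put; on the relation these powers turn
back into those of the stated formula. -/
theorem eval_prepE {a z v w b : ℂ} (h : relP b v w z = 0) :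
    prepE.eval ![a, z, v, w] = 198 * prepotential a b v w z := by
  simp only [prepE, eval_add, eval_mul, eval_qE_of_relP h, prepE0, prepE1, eval_terms, evalList,
    evalMonomial, Matrix.cons_val, prepotential, Int.cast_ofNat, Int.cast_neg, pow_zero,
    mul_one, pow_one]
  ring

theorem eval_yE3 {a z v w b : ℂ} (h : relP b v w z = 0) :
    -(2 ^ 7 * 5 ^ 3 / 3 ^ 5) * yE3.eval ![a, z, v, w] = Y3 a b v w z := by
  simp only [yE3, eval_add, eval_mul, eval_qE_of_relP h, yE30, yE31, eval_terms, evalList,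
    evalMonomial, Matrix.cons_val, Y3, Int.cast_ofNat, Int.cast_neg, pow_zero,
    mul_one, pow_one]
  ring

theorem eval_yE2 {a z v w b : ℂ} (h : relP b v w z = 0) :
    -(2 ^ 12 * 5 ^ 6 / 3 ^ 8) * yE2.eval ![a, z, v, w] = Y2 a b v w z := by
  simp only [yE2, eval_add, eval_mul, eval_qE_of_relP h, yE20, yE21, yE22, eval_terms, evalList,
    evalMonomial, Matrix.cons_val, Y2, Int.cast_ofNat, Int.cast_neg, Int.cast_one, pow_zero,
    mul_one, pow_one]
  ring

set_option maxHeartbeats 4000000 in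
theorem eval_yE1 {a z v w b : ℂ} (h : relP b v w z = 0) :
    -(2 ^ 19 * 5 ^ 9 / (3 ^ 13 * 7)) * yE1.eval ![a, z, v, w] = Y1 a b v w z := by
  rw [Y1]
  congr 1
  simp only [yE1, eval_add, eval_mul, eval_qE_of_relP h, yE10, yE11, yE12, yE13, eval_terms,
    evalList, evalMonomial, Matrix.cons_val, Int.cast_ofNat, Int.cast_neg,
    pow_zero, mul_one, pow_one]
  simp only [Y1Part0, Y1Part1, Y1Part2, Y1Part3, Y1Part4, Y1Part5, Y1Part6, Y1Part7]
  ring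

end H44

/-! ### Holomorphic functions of several variables -/

section Holomorphic

open MeasureTheory Metric Filter Topology

variable {E F : Type*} [NormedAddCommGroup E] [NormedSpace ℂ E]
  [NormedAddCommGroup F] [NormedSpace ℂ F] [FiniteDimensional ℂ F]

/-- The identity theorem for holomorphic functions of several variables. -/
theorem eq_zero_of_differentiableOn_of_eventually_eq_zero {f : E → F} {U : Set E} (hU : IsOpen U)
    (hc : IsPreconnected U) (hf : DifferentiableOn ℂ f U) {z₀ : E} (hz₀ : z₀ ∈ U)
    (h0 : ∀ᶠ z in 𝓝 z₀, f z = 0) {z : E} (hz : z ∈ U) : f z = 0 := by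
  have : CompleteSpace F := FiniteDimensional.complete ℂ F
  -- The points near which f vanishes identically form an open set; it remains to see that this set
  -- is closed in U.
  have hclosed : U ⊆ {z | ∀ᶠ y in 𝓝 z, f y = 0} := by
    refine hc.subset_of_closure_inter_subset isOpen_setOfPred_eventually_nhds ⟨z₀, hz₀, h0⟩ ?_
    rintro y ⟨hy, hyU⟩
    obtain ⟨ε, hε, hball⟩ := Metric.isOpen_iff.mp hU y hyU
    obtain ⟨p, hpy, hp⟩ := mem_closure_iff.mp hy (ball y ε) isOpen_ball (mem_ball_self hε)
    refine Filter.eventually_of_mem (ball_mem_nhds y hε) fun q hq => ?_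
    -- The complex line with p at parameter 0 and q at parameter 1. It meets the ball in a convex
    -- set, so the one-variable identity theorem carries the vanishing from p to q.
    set ℓ : ℂ → E := fun w => p + w • (q - p) with hℓ
    have hℓd : Differentiable ℂ ℓ := by fun_prop
    have hopen : IsOpen (ℓ ⁻¹' ball y ε) := isOpen_ball.preimage hℓd.continuous
    have hconv : IsPreconnected (ℓ ⁻¹' ball y ε) := by
      refine Convex.isPreconnected fun a ha b hb s t hs ht hst => ?_
      have : ℓ (s • a + t • b) = s • ℓ a + t • ℓ b := by
        simp only [hℓ, smul_add, add_smul, smul_assoc]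
        have : p = s • p + t • p := by rw [← add_smul, hst, one_smul]
        nth_rewrite 1 [this]
        abel
      simp only [Set.mem_preimage, this] at ha hb ⊢
      exact convex_ball y ε ha hb hs ht hst
    have han : AnalyticOnNhd ℂ (f ∘ ℓ) (ℓ ⁻¹' ball y ε) :=
      ((hf.mono hball).comp hℓd.differentiableOn (Set.mapsTo_preimage _ _)).analyticOnNhd hopen
    have hev : f ∘ ℓ =ᶠ[𝓝 0] 0 := by
      have : Tendsto ℓ (𝓝 0) (𝓝 p) := by
        have := hℓd.continuous.tendsto 0
        simpa [hℓ] using this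
      exact this.eventually hp
    have h1 := han.eqOn_zero_of_preconnected_of_eventuallyEq_zero hconv
      (show (0 : ℂ) ∈ ℓ ⁻¹' ball y ε by simpa [hℓ] using mem_ball.mp hpy) hev
      (show (1 : ℂ) ∈ ℓ ⁻¹' ball y ε by simpa [hℓ] using mem_ball.mp hq)
    simpa [hℓ] using h1
  exact (hclosed hz).self_of_nhds

variable [FiniteDimensional ℂ E]

/-- Cauchy's formula on the complex line through z in the direction v gives f′(z)v = (2πi)⁻¹ ∮ f(z +
wv) w⁻² dw. The right-hand side may be differentiated in z under the integral sign. -/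
theorem differentiableAt_fderiv_apply_of_differentiableOn {f : E → F} {U : Set E} (hU : IsOpen U)
    (hf : DifferentiableOn ℂ f U) (v : E) {z₀ : E} (hz₀ : z₀ ∈ U) :
    DifferentiableAt ℂ (fun z => fderiv ℂ f z v) z₀ := by
  have : CompleteSpace F := FiniteDimensional.complete ℂ F
  have : ProperSpace E := FiniteDimensional.proper ℂ E
  have : ProperSpace F := FiniteDimensional.proper ℂ F
  borelize E
  have hdiff : ∀ z ∈ U, DifferentiableAt ℂ f z := fun z hz => (hf z hz).differentiableAt
    (hU.mem_nhds hz)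
  obtain ⟨ρ, hρ, hball⟩ : ∃ ρ > 0, ∀ z ∈ ball z₀ (3 * ρ), z ∈ U ∧ dist (f z) (f z₀) < 1 := by
    obtain ⟨ε, hε, h⟩ := Metric.eventually_nhds_iff_ball.mp ((hU.eventually_mem hz₀).and
      ((hdiff z₀ hz₀).continuousAt.eventually (ball_mem_nhds (f z₀) one_pos)))
    exact ⟨ε / 3, by positivity, fun z hz => h z (by rwa [mul_div_cancel₀ _ (by norm_num)] at hz)⟩
  -- Cauchy's estimate on a ball of radius ρ, which f maps into a ball of radius 2. The points z +
  -- wv used below stay within 2ρ of z₀, so a margin of ρ remains inside the ball of radius 3ρ.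
  have hbound : ∀ z ∈ ball z₀ (2 * ρ), ‖fderiv ℂ f z‖ ≤ 2 / ρ := fun z hz => by
    have hsub : ball z ρ ⊆ ball z₀ (3 * ρ) := ball_subset_ball' (by
      rw [mem_ball] at hz; linarith)
    refine Complex.norm_fderiv_le_div_of_mapsTo_ball
      (hf.mono fun y hy => (hball y (hsub hy)).1) (fun y hy => ?_) hρ
    have h1 := (hball y (hsub hy)).2
    have h2 := (hball z (ball_subset_ball (by linarith) hz)).2
    rw [dist_comm] at h2
    exact mem_closedBall.mpr ((dist_triangle _ (f z₀) _).trans (by linarith))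
  obtain ⟨r, hr, hrv⟩ : ∃ r > 0, r * ‖v‖ < ρ :=
    ⟨ρ / (‖v‖ + 1), by positivity, by
      rw [div_mul_eq_mul_div, div_lt_iff₀ (by positivity)]; nlinarith⟩
  have hmem : ∀ z ∈ ball z₀ ρ, ∀ w : ℂ, ‖w‖ ≤ r → z + w • v ∈ ball z₀ (2 * ρ) := by
    intro z hz w hw
    rw [mem_ball, dist_eq_norm] at hz ⊢
    calc ‖z + w • v - z₀‖ = ‖(z - z₀) + w • v‖ := by congr 1; abel
      _ ≤ ‖z - z₀‖ + ‖w‖ * ‖v‖ := (norm_add_le _ _).trans (by rw [norm_smul])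
      _ < 2 * ρ := by nlinarith [mul_le_mul_of_nonneg_right hw (norm_nonneg v)]
  have hmemU : ∀ z ∈ ball z₀ ρ, ∀ w : ℂ, ‖w‖ ≤ r → z + w • v ∈ U := fun z hz w hw =>
    (hball _ (ball_subset_ball (by linarith) (hmem z hz w hw))).1
  have hcirc : ∀ θ : ℝ, ‖circleMap 0 r θ‖ ≤ r := fun θ => by
    rw [norm_circleMap_zero, abs_of_pos hr]
  set k : ℝ → ℂ := fun θ => deriv (circleMap 0 r) θ * (1 / (circleMap 0 r θ - 0) ^ 2) with hk
  have hkc : Continuous k := by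
    simp only [hk, deriv_circleMap, sub_zero]
    refine ((continuous_circleMap 0 r).mul continuous_const).mul
      (continuous_const.div ((continuous_circleMap 0 r).pow 2) fun θ => ?_)
    exact pow_ne_zero _ (circleMap_ne_center hr.ne')
  have hline : Continuous fun θ : ℝ => circleMap 0 r θ • v :=
    (continuous_circleMap 0 r).smul continuous_const
  have hcont : ∀ z ∈ ball z₀ ρ, Continuous fun θ : ℝ => f (z + circleMap 0 r θ • v) :=
    fun z hz => hf.continuousOn.comp_continuous (continuous_const.add hline)
      fun θ => hmemU z hz _ (hcirc θ)
  have hz₀ρ : z₀ ∈ ball z₀ ρ := mem_ball_self hρ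
  -- Continuity of the derivative is not yet known; its measurability and the bound 2/ρ are enough
  -- for dominated differentiation.
  have key := (hasFDerivAt_integral_of_dominated_loc_of_lip (𝕜 := ℂ)
    (μ := volume.restrict (Set.Ioc 0 (2 * Real.pi)))
    (F := fun z θ => k θ • f (z + circleMap 0 r θ • v))
    (F' := fun θ => k θ • fderiv ℂ f (z₀ + circleMap 0 r θ • v))
    (bound := fun θ => ‖k θ‖ * (2 / ρ)) (x₀ := z₀) (s := ball z₀ ρ) (ball_mem_nhds _ hρ)
    (Filter.eventually_of_mem (ball_mem_nhds _ hρ) fun z hz =>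
      (hkc.smul (hcont z hz)).aestronglyMeasurable)
    ((hkc.smul (hcont z₀ hz₀ρ)).integrableOn_Ioc)
    (hkc.aestronglyMeasurable.smul
      ((measurable_fderiv ℂ f).comp
        (continuous_const.add hline).measurable).aestronglyMeasurable)
    (Filter.Eventually.of_forall fun θ => ?_)
    ((hkc.norm.mul continuous_const).integrableOn_Ioc)
    (Filter.Eventually.of_forall fun θ => ?_)).2
  · refine (key.differentiableAt.const_smul ((2 * Real.pi * Complex.I : ℂ)⁻¹)).congr_of_eventuallyEq ?_
    filter_upwards [ball_mem_nhds z₀ hρ] with z hz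
    have hd : DifferentiableOn ℂ (fun w : ℂ => f (z + w • v)) (closedBall 0 r) := fun w hw => by
      refine DifferentiableAt.differentiableWithinAt ?_
      exact DifferentiableAt.comp w (hdiff _ (hmemU z hz w (by simpa using hw)))
        (by fun_prop)
    have h1 := hd.deriv_eq_smul_circleIntegral hr
    have h2 : deriv (fun w : ℂ => f (z + w • v)) 0 = fderiv ℂ f z v := by
      have : HasDerivAt (fun w : ℂ => z + w • v) v 0 := by
        simpa using ((hasDerivAt_id (0 : ℂ)).smul_const v).const_add z
      have h3 := (hdiff z (by simpa using hmemU z hz 0 (by simpa using hr.le))).hasFDerivAt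
      have h4 : HasFDerivAt f (fderiv ℂ f z) (z + (0 : ℂ) • v) := by simpa using h3
      exact (h4.comp_hasDerivAt (0 : ℂ) this).deriv
    rw [h2] at h1
    rw [Pi.smul_apply, eq_inv_smul_iff₀ Complex.two_pi_I_ne_zero, ← h1, circleIntegral,
      intervalIntegral.integral_of_le Real.two_pi_pos.le]
    simp only [hk, smul_smul]
  · refine Convex.lipschitzOnWith_of_nnnorm_hasFDerivWithin_le (𝕜 := ℂ)
      (f' := fun z => k θ • fderiv ℂ f (z + circleMap 0 r θ • v)) (fun z hz => ?_)
      (fun z hz => ?_) (convex_ball z₀ ρ)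
    · have h := (hdiff _ (hmemU z hz _ (hcirc θ))).hasFDerivAt
      exact ((h.comp z ((hasFDerivAt_id z).add_const _)).const_smul (k θ)).hasFDerivWithinAt
    · rw [← NNReal.coe_le_coe, coe_nnnorm, Real.coe_nnabs, norm_smul, abs_of_nonneg (by positivity)]
      exact mul_le_mul_of_nonneg_left (hbound _ (hmem z hz _ (hcirc θ))) (norm_nonneg _)
  · have h := (hdiff _ (hmemU z₀ hz₀ρ _ (hcirc θ))).hasFDerivAt
    exact (h.comp z₀ ((hasFDerivAt_id z₀).add_const _)).const_smul (k θ)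

/-- A holomorphic function of several variables is smooth. -/
theorem contDiffOn_of_differentiableOn_complex {U : Set E} (hU : IsOpen U) (n : ℕ) :
    ∀ {f : E → F}, DifferentiableOn ℂ f U → ContDiffOn ℂ n f U := by
  induction n with
  | zero => exact fun hf => contDiffOn_zero.mpr hf.continuousOn
  | succ n ih =>
    intro f hf
    have := FiniteDimensional.complete ℂ E
    rw [Nat.cast_succ, contDiffOn_succ_iff_fderiv_of_isOpen hU]
    refine ⟨hf, fun h => absurd h (by simp), contDiffOn_clm_apply.mpr fun v => ih fun z hz => ?_⟩
    exact (differentiableAt_fderiv_apply_of_differentiableOn hU hf v hz).differentiableWithinAt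

/-- A holomorphic map which preserves the dot product is the restriction of an affine map. -/
theorem exists_eq_add_of_dotProduct_fderiv {n : ℕ} {f : (Fin n → ℂ) → (Fin n → ℂ)}
    {W : Set (Fin n → ℂ)} (hW : IsOpen W) (hc : IsPreconnected W) (hf : DifferentiableOn ℂ f W)
    (h : ∀ z ∈ W, ∀ u v, fderiv ℂ f z u ⬝ᵥ fderiv ℂ f z v = u ⬝ᵥ v) {z₀ : Fin n → ℂ} (hz₀ : z₀ ∈ W) :
    ∃ b, ∀ z ∈ W, f z = fderiv ℂ f z₀ z + b := by
  have hdiff : ∀ z ∈ W, DifferentiableAt ℂ f z := fun z hz =>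
    (hf z hz).differentiableAt (hW.mem_nhds hz)
  have hC2 := contDiffOn_of_differentiableOn_complex hW 2 hf
  have hd' : ∀ z ∈ W, DifferentiableAt ℂ (fderiv ℂ f) z := fun z hz =>
    ((hC2.contDiffAt (hW.mem_nhds hz)).fderiv_right (m := 1) (by norm_num)).differentiableAt
      (by norm_num)
  have hzero : ∀ z ∈ W, fderiv ℂ (fderiv ℂ f) z = 0 := by
    intro z hz
    set T := fderiv ℂ (fderiv ℂ f) z with hT
    have hsymm : ∀ u v, T u v = T v u := fun u v =>
      ((hC2.contDiffAt (hW.mem_nhds hz)).isSymmSndFDerivAt (by simp)) u v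
    -- The derivative in the direction k of the constant f′u · f′v.
    have hanti : ∀ k u v, T k u ⬝ᵥ fderiv ℂ f z v + fderiv ℂ f z u ⬝ᵥ T k v = 0 := by
      intro k u v
      have hl : HasDerivAt (fun s : ℂ => z + s • k) k 0 := by
        simpa using ((hasDerivAt_id (0 : ℂ)).smul_const k).const_add z
      have hz' : HasFDerivAt (fderiv ℂ f) T (z + (0 : ℂ) • k) := by
        simpa using (hd' z hz).hasFDerivAt
      have h0 : HasDerivAt (fun s : ℂ => fderiv ℂ f (z + s • k)) (T k) 0 :=
        hz'.comp_hasDerivAt (0 : ℂ) hl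
      have h1 : ∀ w, HasDerivAt (fun s : ℂ => fderiv ℂ f (z + s • k) w) (T k w) 0 := fun w =>
        (ContinuousLinearMap.apply ℂ (Fin n → ℂ) w).hasFDerivAt.comp_hasDerivAt (0 : ℂ) h0
      have h2 : HasDerivAt (fun s : ℂ => fderiv ℂ f (z + s • k) u ⬝ᵥ fderiv ℂ f (z + s • k) v)
          (T k u ⬝ᵥ fderiv ℂ f z v + fderiv ℂ f z u ⬝ᵥ T k v) 0 := by
        simp only [dotProduct, ← Finset.sum_add_distrib]
        refine HasDerivAt.fun_sum fun i _ => ?_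
        have := (hasDerivAt_pi.1 (h1 u) i).fun_mul (hasDerivAt_pi.1 (h1 v) i)
        simpa only [zero_smul, add_zero] using this
      have h3 : (fun s : ℂ => fderiv ℂ f (z + s • k) u ⬝ᵥ fderiv ℂ f (z + s • k) v) =ᶠ[𝓝 0]
          fun _ => u ⬝ᵥ v := by
        have : ∀ᶠ s : ℂ in 𝓝 0, z + s • k ∈ W :=
          hl.continuousAt.eventually (hW.mem_nhds (by simpa using hz))
        filter_upwards [this] with s hs using h _ hs u v
      exact h2.unique ((hasDerivAt_const (0 : ℂ) (u ⬝ᵥ v)).congr_of_eventuallyEq h3)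
    -- The complex dot product is not definite, but it is nondegenerate, and that suffices.
    have hinj : Function.Injective (fderiv ℂ f z) := by
      rw [injective_iff_map_eq_zero]
      intro v hv
      refine dotProduct_eq_zero _ fun u => ?_
      rw [dotProduct_comm, ← h z hz u v, hv, dotProduct_zero]
    have hsurj : Function.Surjective (fderiv ℂ f z) :=
      LinearMap.injective_iff_surjective.mp hinj
    refine ContinuousLinearMap.ext fun k => ContinuousLinearMap.ext fun u => ?_
    refine dotProduct_eq_zero _ fun w => ?_
    obtain ⟨v, rfl⟩ := hsurj w
    -- The argument that determines the Levi-Civita connection: by symmetry of the second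
    -- derivative, the alternating sum of the three permuted identities is twice T k u · f′v.
    have e1 := hanti k u v
    have e2 := hanti u v k
    have e3 := hanti v k u
    rw [hsymm u v, dotProduct_comm _ (T u k), hsymm u k] at e2
    rw [dotProduct_comm _ (T v u), hsymm v k] at e3
    rw [dotProduct_comm _ (T k v)] at e1
    linear_combination (e1 + e2 - e3) / 2
  have hconst : ∀ z ∈ W, fderiv ℂ f z = fderiv ℂ f z₀ := fun z hz =>
    hW.is_const_of_fderiv_eq_zero hc (fun z hz => (hd' z hz).differentiableWithinAt)
      hzero hz hz₀
  refine ⟨f z₀ - fderiv ℂ f z₀ z₀, fun z hz => ?_⟩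
  have := hW.is_const_of_fderiv_eq_zero (f := fun z => f z - fderiv ℂ f z₀ z) hc
    (hf.sub (fderiv ℂ f z₀).differentiable.differentiableOn) (fun z hz => ?_) hz hz₀
  · rw [← this]; abel
  · rw [fderiv_fun_sub (hdiff z hz) (fderiv ℂ f z₀).differentiableAt, hconst z hz,
      ContinuousLinearMap.fderiv, sub_self]
    rfl

end Holomorphic

namespace H44

open PolyExpr Filter Topology

/-! ### Symmetry of the intersection form and the fourth invariant -/

/-- Equality of mixed second derivatives, read off from the polynomials; it yields the symmetry of
`formE`, whose definition distinguishes the two orders. -/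
theorem prepD_symm_vanishes : ∀ l m : Fin 4,
    (tDeriv (prepD m) (prepDZ m) l - tDeriv (prepD l) (prepDZ l) m).vanishes (5, 1, 1)
      60 500 6000 = true := by
  decide +kernel

/-- ∂F/∂t₁ = t₂t₃ + t₁t₄ carries the whole metric η: its second derivatives form a constant
antidiagonal matrix. -/
theorem prepD_zero_vanishes :
    (prepD 0 - const 198 * (qE * .terms [(1, 0, 0, 1, 0)] + .terms [(1, 1, 0, 0, 1)])).vanishes
      (5, 1, 1) 60 500 6000 = true := by
  decide +kernel

/-- This encodes g^{i4} = Eⁱ, with 990 = 198 · 5 accounting for the scalings of `formE` and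
`eulerE`. -/
theorem formE_zero_vanishes : ∀ l : Fin 4,
    (formE l.rev 0 - const 198 * eulerE l).vanishes (5, 1, 1) 60 500 6000 = true := by
  decide +kernel

/-- The expressions of the invariants up to scalar factors. -/
def yE : Fin 4 → PolyExpr
  | 0 => yE1
  | 1 => yE2
  | 2 => yE3
  | 3 => yE4

/-- The derivatives of `yE` with respect to `t₂`. -/
def yZ : Fin 4 → PolyExpr
  | 0 => yZ1
  | 1 => yZ2
  | 2 => yZ3
  | 3 => .terms []

/-- The degrees of the invariants as integers. -/
def degE : Fin 4 → ℤ
  | 0 => 30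
  | 1 => 20
  | 2 => 12
  | 3 => 2

/-- Because g^{i4} = Eⁱ, pairing with dt₄ is the derivative along E, under which the invariant of
degree n has weight n/10; and 990 · n/10 = 99 n. -/
theorem pairE_yE4_vanishes : ∀ i : Fin 4,
    (pairE (yE i) (yZ i) yE4 (.terms []) - const (99 * degE i) * yE i).vanishes (5, 1, 1)
      250 1800 60000 = true := by
  decide +kernel

/-! ### Calculus on the domain of a branch -/

theorem eval_pderiv_cons (x : Fin 4 → ℂ) (k : Fin 4) (m : ℤ × ℕ × ℕ × ℕ × ℕ)
    (l : List (ℤ × ℕ × ℕ × ℕ × ℕ)) :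
    (pderiv k (.terms (m :: l))).eval x =
      (pderiv k (.terms [m])).eval x + (pderiv k (.terms l)).eval x := by
  simp only [pderiv, eval_terms, List.filterMap_cons, List.filterMap_nil]
  cases pderivTerm k m <;> simp [evalList]

theorem hasFDerivAt_evalMonomial {E : Type*} [NormedAddCommGroup E] [NormedSpace ℂ E]
    {u : E → Fin 4 → ℂ} {u' : Fin 4 → E →L[ℂ] ℂ} {t : E}
    (h : ∀ k, HasFDerivAt (fun s => u s k) (u' k) t) (m : ℤ × ℕ × ℕ × ℕ × ℕ) :
    HasFDerivAt (fun s => evalMonomial (u s) m)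
      (∑ k, (pderiv k (.terms [m])).eval (u t) • u' k) t := by
  obtain ⟨c, i, j, k, e⟩ := m
  have h1 := ((((((h 0).pow i).const_mul (c : ℂ)).mul ((h 1).pow j))).mul
    ((h 2).pow k)).mul ((h 3).pow e)
  refine h1.congr_fderiv ?_
  ext v
  -- Vanishing exponents are separated because `pderivTerm` drops the corresponding terms.
  cases i <;> cases j <;> cases k <;> cases e <;>
    simp [pderiv, List.filterMap_cons, pderivTerm, Fin.sum_univ_four, evalList, evalMonomial] <;> ring

theorem hasFDerivAt_eval {E : Type*} [NormedAddCommGroup E] [NormedSpace ℂ E]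
    {u : E → Fin 4 → ℂ} {u' : Fin 4 → E →L[ℂ] ℂ} {t : E}
    (h : ∀ k, HasFDerivAt (fun s => u s k) (u' k) t) (p : PolyExpr) :
    HasFDerivAt (fun s => p.eval (u s)) (∑ k, (pderiv k p).eval (u t) • u' k) t := by
  induction p with
  | terms l =>
    induction l with
    | nil =>
      refine (hasFDerivAt_const (0 : ℂ) t).congr_fderiv ?_
      ext v
      simp [pderiv, evalList]
    | cons m l ih =>
      refine ((hasFDerivAt_evalMonomial h m).add ih).congr_fderiv ?_
      ext v
      simp only [eval_pderiv_cons _ _ m l]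
      simp [Fin.sum_univ_four]
      ring
  | add p q hp hq =>
    refine (hp.add hq).congr_fderiv ?_
    ext v
    simp [pderiv, eval, Fin.sum_univ_four]
    ring
  | sub p q hp hq =>
    refine (hp.sub hq).congr_fderiv ?_
    ext v
    simp [pderiv, eval, Fin.sum_univ_four]
    ring
  | mul p q hp hq =>
    refine (hp.mul hq).congr_fderiv ?_
    ext v
    simp [pderiv, eval, Fin.sum_univ_four]
    ring

theorem pd_congr {f g : (Fin 4 → ℂ) → ℂ} {U : Set (Fin 4 → ℂ)} (hU : IsOpen U)
    (h : ∀ t ∈ U, f t = g t) {t : Fin 4 → ℂ} (ht : t ∈ U) (i : Fin 4) : pd i f t = pd i g t := by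
  rw [pd, pd, (Filter.eventuallyEq_of_mem (hU.mem_nhds ht) h).fderiv_eq]

theorem pd_const_mul {f : (Fin 4 → ℂ) → ℂ} {t : Fin 4 → ℂ} (hf : DifferentiableAt ℂ f t) (c : ℂ)
    (i : Fin 4) : pd i (fun s => c * f s) t = c * pd i f t := by
  simp [pd, fderiv_const_mul hf]

theorem pd_coord (i j : Fin 4) (t : Fin 4 → ℂ) :
    pd i (fun s => s j) t = if i = j then 1 else 0 := by
  rw [pd, (hasFDerivAt_apply j t).fderiv]
  simp [Pi.single_apply, eq_comm]

theorem pd_sum_mul (w : Fin 4 → ℂ) {b : Fin 4 → (Fin 4 → ℂ) → ℂ} {t : Fin 4 → ℂ}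
    (hb : ∀ k, DifferentiableAt ℂ (b k) t) (l : Fin 4) :
    pd l (fun s => ∑ k, w k * s k * b k s) t = w l * b l t + ∑ k, w k * t k * pd l (b k) t := by
  have h : HasFDerivAt (fun s : Fin 4 → ℂ => ∑ k, w k * s k * b k s)
      (∑ k, ((w k * t k) • fderiv ℂ (b k) t +
        b k t • (w k • ContinuousLinearMap.proj (R := ℂ) (φ := fun _ : Fin 4 => ℂ) k))) t :=
    HasFDerivAt.fun_sum fun k _ => ((hasFDerivAt_apply k t).const_mul (w k)).mul (hb k).hasFDerivAt
  rw [pd, h.fderiv]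
  simp only [sum_apply, add_apply, smul_apply, ContinuousLinearMap.proj_apply, smul_eq_mul,
    Finset.sum_add_distrib, pd]
  rw [add_comm]
  congr 1
  rw [Finset.sum_eq_single l]
  · simp [mul_comm]
  · intro k _ hk
    simp [hk]
  · simp

/-- The coordinates `(t₁, Z, t₃, t₄)`. -/
def chart (ζ : (Fin 4 → ℂ) → ℂ) (t : Fin 4 → ℂ) : Fin 4 → ℂ := ![t 0, ζ t, t 2, t 3]

@[simp] theorem chart_zero (ζ : (Fin 4 → ℂ) → ℂ) (t : Fin 4 → ℂ) : chart ζ t 0 = t 0 := rfl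
@[simp] theorem chart_one (ζ : (Fin 4 → ℂ) → ℂ) (t : Fin 4 → ℂ) : chart ζ t 1 = ζ t := rfl
@[simp] theorem chart_two (ζ : (Fin 4 → ℂ) → ℂ) (t : Fin 4 → ℂ) : chart ζ t 2 = t 2 := rfl
@[simp] theorem chart_three (ζ : (Fin 4 → ℂ) → ℂ) (t : Fin 4 → ℂ) : chart ζ t 3 = t 3 := rfl

section Branch

variable {U : Set (Fin 4 → ℂ)} {ζ : (Fin 4 → ℂ) → ℂ} {t : Fin 4 → ℂ}

theorem IsBranch.differentiableAt (hζ : IsBranch U ζ) (ht : t ∈ U) : DifferentiableAt ℂ ζ t :=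
  (hζ.holo t ht).differentiableAt (hζ.isOpen.mem_nhds ht)

theorem IsBranch.eval_qE (hζ : IsBranch U ζ) (ht : t ∈ U) : qE.eval (chart ζ t) = t 1 :=
  eval_qE_of_relP (hζ.root t ht)

/-- The differentials of the coordinates `(t₁, Z, t₃, t₄)`. -/
theorem IsBranch.hasFDerivAt_chart (hζ : IsBranch U ζ) (ht : t ∈ U) (k : Fin 4) :
    HasFDerivAt (fun s => chart ζ s k)
      ((![ContinuousLinearMap.proj 0, fderiv ℂ ζ t, ContinuousLinearMap.proj 2,
        ContinuousLinearMap.proj 3] : Fin 4 → (Fin 4 → ℂ) →L[ℂ] ℂ) k) t := by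
  fin_cases k
  · exact hasFDerivAt_apply 0 t
  · exact (hζ.differentiableAt ht).hasFDerivAt
  · exact hasFDerivAt_apply 2 t
  · exact hasFDerivAt_apply 3 t

theorem IsBranch.hasFDerivAt_eval (hζ : IsBranch U ζ) (ht : t ∈ U) (p : PolyExpr) :
    HasFDerivAt (fun s => p.eval (chart ζ s)) (∑ k, (pderiv k p).eval (chart ζ t) •
      (![ContinuousLinearMap.proj 0, fderiv ℂ ζ t, ContinuousLinearMap.proj 2,
        ContinuousLinearMap.proj 3] : Fin 4 → (Fin 4 → ℂ) →L[ℂ] ℂ) k) t :=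
  H44.hasFDerivAt_eval (hζ.hasFDerivAt_chart ht) p

theorem IsBranch.differentiableAt_eval (hζ : IsBranch U ζ) (ht : t ∈ U) (p : PolyExpr) :
    DifferentiableAt ℂ (fun s => p.eval (chart ζ s)) t :=
  (hζ.hasFDerivAt_eval ht p).differentiableAt

theorem IsBranch.fderiv_eval (hζ : IsBranch U ζ) (ht : t ∈ U) (p : PolyExpr) (v : Fin 4 → ℂ) :
    fderiv ℂ (fun s => p.eval (chart ζ s)) t v =
      (pderiv 0 p).eval (chart ζ t) * v 0 + (pderiv 1 p).eval (chart ζ t) * fderiv ℂ ζ t v +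
      (pderiv 2 p).eval (chart ζ t) * v 2 + (pderiv 3 p).eval (chart ζ t) * v 3 := by
  rw [(hζ.hasFDerivAt_eval ht p).fderiv]
  simp [Fin.sum_univ_four]

/-- Implicit differentiation of q(Z, t₃, t₄) = t₂. -/
theorem IsBranch.fderiv_mul (hζ : IsBranch U ζ) (ht : t ∈ U) (v : Fin 4 → ℂ) :
    (pderiv 1 qE).eval (chart ζ t) * fderiv ℂ ζ t v = v 1 -
      (pderiv 2 qE).eval (chart ζ t) * v 2 - (pderiv 3 qE).eval (chart ζ t) * v 3 := by
  have h1 := hζ.fderiv_eval ht qE v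
  have h2 : (fun s => qE.eval (chart ζ s)) =ᶠ[𝓝 t] fun s => s 1 :=
    Filter.eventuallyEq_of_mem (hζ.isOpen.mem_nhds ht) fun s hs => hζ.eval_qE hs
  have h3 : (pderiv 0 qE).eval (chart ζ t) = 0 := eval_eq_zero_of_isNull _ _ (by decide +kernel)
  rw [h2.fderiv_eq, (hasFDerivAt_apply 1 t).fderiv, h3, ContinuousLinearMap.proj_apply] at h1
  linear_combination -h1

/-- Along the t₂-direction the preceding identity reads q_Z · ∂Z/∂t₂ = 1: a holomorphic branch never
meets the ramification locus. -/
theorem IsBranch.deriv_qE_ne_zero (hζ : IsBranch U ζ) (ht : t ∈ U) : (pderiv 1 qE).eval (chart ζ t) ≠ 0 := by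
  intro h
  have := hζ.fderiv_mul ht (Pi.single 1 1)
  simp [h] at this

/-- In the chain rule the factor q_Z of ∂p/∂Z = q_Z p′ cancels the denominator of the derivatives of
Z, so the result is again polynomial. -/
theorem IsBranch.pd_eval (hζ : IsBranch U ζ) {p p' : PolyExpr} (hp : IsZDeriv p p') (ht : t ∈ U) (l : Fin 4) :
    pd l (fun s => p.eval (chart ζ s)) t = (tDeriv p p' l).eval (chart ζ t) := by
  have h0 := hζ.deriv_qE_ne_zero ht
  have h1 := hζ.fderiv_eval ht p (Pi.single l 1)
  have h2 := hζ.fderiv_mul ht (Pi.single l 1)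
  rw [pd, h1, ← hp, mul_right_comm, h2]
  fin_cases l <;> simp [tDeriv] <;> ring

/-! ### The intersection form -/

/-- The prepotential on the domain of a branch. -/
theorem IsBranch.prepotential_eq (hζ : IsBranch U ζ) (ht : t ∈ U) :
    prepotential (t 0) (t 1) (t 2) (t 3) (ζ t) = 1 / 198 * prepE.eval (chart ζ t) := by
  rw [chart, eval_prepE (hζ.root t ht)]
  ring

theorem IsBranch.pd_prepotential (hζ : IsBranch U ζ) (ht : t ∈ U) (k : Fin 4) :
    pd k (fun t => prepotential (t 0) (t 1) (t 2) (t 3) (ζ t)) t =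
      1 / 198 * (prepD k).eval (chart ζ t) := by
  rw [pd_congr hζ.isOpen (fun t ht => hζ.prepotential_eq ht) ht,
    pd_const_mul (hζ.differentiableAt_eval ht _), hζ.pd_eval isZDeriv_prepE ht, prepD]

theorem isZDeriv_prepD : ∀ k, IsZDeriv (prepD k) (prepDZ k)
  | 0 => isZDeriv_prepD0
  | 1 => isZDeriv_prepD1
  | 2 => isZDeriv_prepD2
  | 3 => isZDeriv_prepD3

theorem IsBranch.pd_pd_prepotential (hζ : IsBranch U ζ) (ht : t ∈ U) (m k : Fin 4) :
    pd m (pd k (fun t => prepotential (t 0) (t 1) (t 2) (t 3) (ζ t))) t =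
      1 / 198 * (tDeriv (prepD k) (prepDZ k) m).eval (chart ζ t) := by
  rw [pd_congr hζ.isOpen (fun t ht => hζ.pd_prepotential ht k) ht,
    pd_const_mul (hζ.differentiableAt_eval ht _), hζ.pd_eval (isZDeriv_prepD k) ht]

theorem eval_eulerE (hζ : IsBranch U ζ) (ht : t ∈ U) (k : Fin 4) :
    (eulerE k).eval (chart ζ t) = 5 * (euler k * t k) := by
  have := hζ.eval_qE ht
  fin_cases k <;> simp [eulerE, euler, evalList, evalMonomial, this]

theorem euler_eq (l : Fin 4) : euler l = (weightE l : ℂ) / 5 := by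
  fin_cases l <;> simp [euler, weightE]

theorem IsBranch.sum_euler_prepD (hζ : IsBranch U ζ) (ht : t ∈ U) :
    ∑ k, euler k * t k * (prepD k).eval (chart ζ t) = 11 / 5 * prepE.eval (chart ζ t) := by
  have h := eval_eq_zero_of_vanishes euler_vanishes (chart ζ t)
  simp only [eval_sub, eval_add, eval_mul, eval_const, eval_eulerE hζ ht] at h
  rw [Fin.sum_univ_four]
  push_cast at h
  linear_combination h / 5

/-- The homogeneity of F, differentiated once; each derivative lowers the degree by the weight of
its variable. -/
theorem IsBranch.sum_euler_pd_prepD (hζ : IsBranch U ζ) (ht : t ∈ U) (m : Fin 4) :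
    ∑ k, euler k * t k * (tDeriv (prepD k) (prepDZ k) m).eval (chart ζ t) =
      (11 / 5 - euler m) * (prepD m).eval (chart ζ t) := by
  have h1 := pd_congr hζ.isOpen (fun t ht => hζ.sum_euler_prepD ht) ht m
  rw [pd_sum_mul euler (fun k => hζ.differentiableAt_eval ht _),
    pd_const_mul (hζ.differentiableAt_eval ht _), hζ.pd_eval isZDeriv_prepE ht] at h1
  simp only [fun k => hζ.pd_eval (isZDeriv_prepD k) ht m] at h1
  rw [← prepD] at h1
  linear_combination h1

/-- Differentiating homogeneity a second time trades the contraction of third derivatives with E for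
second derivatives. The third derivatives themselves leave the polynomials; for example ∂³F/∂t₂³ =
−2/q_Z. -/
theorem IsBranch.sum_euler_cLow (hζ : IsBranch U ζ) (ht : t ∈ U) (l m : Fin 4) :
    ∑ k, euler k * t k *
        cLow (fun t => prepotential (t 0) (t 1) (t 2) (t 3) (ζ t)) l m k t =
      1 / 990 * (formE l m).eval (chart ζ t) := by
  have h1 := pd_congr hζ.isOpen (fun t ht => hζ.sum_euler_pd_prepD ht m) ht l
  rw [pd_sum_mul euler (fun k => hζ.differentiableAt_eval ht _),
    pd_const_mul (hζ.differentiableAt_eval ht _), hζ.pd_eval (isZDeriv_prepD m) ht] at h1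
  have h2 : ∀ k, cLow (fun t => prepotential (t 0) (t 1) (t 2) (t 3) (ζ t)) l m k t =
      1 / 198 * pd l (fun s => (tDeriv (prepD k) (prepDZ k) m).eval (chart ζ s)) t := fun k => by
    rw [cLow, pd_congr hζ.isOpen (fun t ht => hζ.pd_pd_prepotential ht m k) ht,
      pd_const_mul (hζ.differentiableAt_eval ht _)]
  have h3 : ∀ k, euler k * t k *
      cLow (fun t => prepotential (t 0) (t 1) (t 2) (t 3) (ζ t)) l m k t =
      1 / 198 * (euler k * t k *
        pd l (fun s => (tDeriv (prepD k) (prepDZ k) m).eval (chart ζ s)) t) := fun k => by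
    rw [h2]; ring
  simp only [h3, ← Finset.mul_sum]
  rw [formE, eval_sub, eval_mul, eval_mul, eval_const, eval_const]
  push_cast
  rw [euler_eq l, euler_eq m] at h1
  linear_combination h1 / 198

theorem IsBranch.eta_eq (hζ : IsBranch U ζ) (ht : t ∈ U) :
    eta (fun t => prepotential (t 0) (t 1) (t 2) (t 3) (ζ t)) t =
      Matrix.of fun i j => if i = j.rev then 1 else 0 := by
  have h0 : ∀ t ∈ U, pd 0 (fun t => prepotential (t 0) (t 1) (t 2) (t 3) (ζ t)) t =
      t 1 * t 2 + t 0 * t 3 := fun t ht => by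
    have h := eval_eq_zero_of_vanishes prepD_zero_vanishes (chart ζ t)
    simp only [eval_sub, eval_add, eval_mul, eval_const, hζ.eval_qE ht, eval_terms, evalList,
      evalMonomial] at h
    simp at h
    rw [hζ.pd_prepotential ht]
    linear_combination h / 198
  have h1 : ∀ j, ∀ t ∈ U,
      pd j (pd 0 (fun t => prepotential (t 0) (t 1) (t 2) (t 3) (ζ t))) t = t j.rev :=
    fun j t ht => by
    have h' (k : Fin 4) : HasFDerivAt (fun t : Fin 4 → ℂ => t k)
        (ContinuousLinearMap.proj (R := ℂ) (φ := fun _ : Fin 4 => ℂ) k) t := hasFDerivAt_apply k t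
    have h : HasFDerivAt (fun t : Fin 4 → ℂ => t 1 * t 2 + t 0 * t 3) _ t :=
      ((h' 1).mul (h' 2)).add ((h' 0).mul (h' 3))
    rw [pd_congr hζ.isOpen h0 ht, pd, h.fderiv]
    fin_cases j <;> simp [Fin.rev]
  ext i j
  rw [eta, Matrix.of_apply, Matrix.of_apply, cLow, pd_congr hζ.isOpen (h1 j) ht, pd_coord]

/-- The metric η is antidiagonal with entries 1 and is its own inverse, so raising an index just
reverses it. -/
theorem IsBranch.g_eq (hζ : IsBranch U ζ) (ht : t ∈ U) (i j : Fin 4) :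
    g ζ t i j = 1 / 990 * (formE i.rev j.rev).eval (chart ζ t) := by
  have ne : ∀ a b : Fin 4, b ≠ a.rev → a ≠ b.rev := fun a b h h' => h (by rw [h', Fin.rev_rev])
  have hinv : (eta (fun t => prepotential (t 0) (t 1) (t 2) (t 3) (ζ t)) t)⁻¹ =
      Matrix.of fun i j => if i = j.rev then 1 else 0 := by
    rw [hζ.eta_eq ht]
    refine Matrix.inv_eq_right_inv ?_
    ext i j
    rw [Matrix.mul_apply, Finset.sum_eq_single i.rev]
    · simp [Matrix.one_apply]
    · intro b _ hb
      simp [ne i b hb]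
    · simp
  have hup : ∀ k, cUp (fun t => prepotential (t 0) (t 1) (t 2) (t 3) (ζ t)) i j k t =
      cLow (fun t => prepotential (t 0) (t 1) (t 2) (t 3) (ζ t)) i.rev j.rev k t := fun k => by
    simp only [cUp, hinv, Matrix.of_apply]
    rw [Finset.sum_eq_single i.rev, Finset.sum_eq_single j.rev]
    · simp
    · intro b _ hb
      simp [ne j b hb]
    · simp
    · intro b _ hb
      simp [ne i b hb]
    · simp
  rw [g, intersectionForm, Matrix.of_apply, ← hζ.sum_euler_cLow ht]
  simp only [hup]

end Branch

/-! ### The scalar products of the gradients of the invariants -/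

/-- The scalar product of the gradients of two polynomials in `x`. -/
def gradE (p q : PolyExpr) : PolyExpr :=
  pderiv 0 p * pderiv 0 q + pderiv 1 p * pderiv 1 q + pderiv 2 p * pderiv 2 q +
    pderiv 3 p * pderiv 3 q

/-- The elementary symmetric function `ε₁` of the squares of the last three variables. -/
def eps1E : PolyExpr := .terms [(1, 0, 2, 0, 0), (1, 0, 0, 2, 0), (1, 0, 0, 0, 2)]

/-- The elementary symmetric function `ε₂` of the squares of the last three variables. -/
def eps2E : PolyExpr := .terms [(1, 0, 2, 2, 0), (1, 0, 2, 0, 2), (1, 0, 0, 2, 2)]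

/-- The elementary symmetric function `ε₃` of the squares of the last three variables. -/
def eps3E : PolyExpr := .terms [(1, 0, 2, 2, 2)]

/-- The factor `δ`. -/
def delE : PolyExpr :=
  .terms [(1, 0, 2, 0, 0), (-1, 0, 0, 2, 0)] * .terms [(1, 0, 2, 0, 0), (-1, 0, 0, 0, 2)] *
    .terms [(1, 0, 0, 2, 0), (-1, 0, 0, 0, 2)]

/-- The coefficients of `√5` in `(h10, h6, x₁ ^ 2, h2)`. -/
def hIrr : Fin 4 → PolyExpr
  | 0 => const 3 * (delE * eps2E)
  | 1 => delE
  | 2 => .terms []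
  | 3 => .terms []

/-- The rational parts of `(h10, h6, x₁ ^ 2, h2)`. -/
def hRat : Fin 4 → PolyExpr
  | 0 => const 95 * (eps2E * eps3E) - const 32 * (eps1E * eps1E * eps3E) -
      const 5 * (eps1E * eps2E * eps2E) + const 2 * (eps1E * eps1E * eps1E * eps2E)
  | 1 => eps1E * eps2E - const 11 * eps3E
  | 2 => .terms [(1, 2, 0, 0, 0)]
  | 3 => eps1E

/-- The rational parts of the scalar products of the gradients of `(h10, h6, x₁ ^ 2, h2)`. -/
def gramRat : Fin 4 → Fin 4 → PolyExpr
  | 0, 0 => const 8 * (eps1E * eps1E * eps1E * eps1E * hRat 0) +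
      const 36 * (eps1E * eps1E * eps1E * (const 5 * (delE * delE) + hRat 1 * hRat 1)) +
      const 30 * (hRat 1 * hRat 1 * hRat 1 + const 15 * (delE * delE * hRat 1))
  | 0, 1 => const 8 * (eps1E * eps1E * eps1E * eps1E * hRat 1) +
      const 28 * (eps1E * (const 5 * (delE * delE) + hRat 1 * hRat 1))
  | 0, 3 => const 20 * hRat 0
  | 1, 1 => const 8 * (eps1E * eps1E * hRat 1) + const 8 * hRat 0
  | 1, 3 => const 12 * hRat 1
  | 2, 2 => const 4 * hRat 2
  | 3, 3 => const 4 * hRat 3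
  | _, _ => .terms []

/-- The coefficients of `√5` in the scalar products of the gradients of `(h10, h6, x₁ ^ 2, h2)`. -/
def gramIrr : Fin 4 → Fin 4 → PolyExpr
  | 0, 0 => const 8 * (eps1E * eps1E * eps1E * eps1E * hIrr 0) +
      const 72 * (eps1E * eps1E * eps1E * (delE * hRat 1)) +
      const 30 * (const 5 * (delE * delE * delE) + const 3 * (delE * hRat 1 * hRat 1))
  | 0, 1 => const 8 * (eps1E * eps1E * eps1E * eps1E * delE) +
      const 56 * (eps1E * (delE * hRat 1))
  | 0, 3 => const 20 * hIrr 0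
  | 1, 1 => const 8 * (eps1E * eps1E * delE) + const 8 * hIrr 0
  | 1, 3 => const 12 * delE
  | _, _ => .terms []

/-- The scalar products have coefficients in ℤ[√5]. Splitting off the coefficient of √5 leaves two
identities over ℤ; by symmetry k ≤ l is enough. -/
theorem gramRat_vanishes : ∀ k l : Fin 4, k ≤ l →
    (const 5 * gradE (hIrr k) (hIrr l) + gradE (hRat k) (hRat l) - gramRat k l).vanishes
      (1, 1, 1) 60 1000 20000 = true := by
  decide +kernel

theorem gramIrr_vanishes : ∀ k l : Fin 4, k ≤ l →
    (gradE (hIrr k) (hRat l) + gradE (hRat k) (hIrr l) - gramIrr k l).vanishes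
      (1, 1, 1) 60 1000 20000 = true := by
  decide +kernel

/-- The functions `(h10, h6, x₁ ^ 2, h2)`. -/
noncomputable def hMap (x : Fin 4 → ℂ) : Fin 4 → ℂ :=
  ![h10 (x 1) (x 2) (x 3), h6 (x 1) (x 2) (x 3), x 0 ^ 2, h2 (x 1) (x 2) (x 3)]

/-- The number `√5`. -/
noncomputable def sqrt5 : ℂ := ((Real.sqrt 5 : ℝ) : ℂ)

theorem sqrt5_sq : sqrt5 ^ 2 = 5 := by
  rw [sqrt5, ← Complex.ofReal_pow, Real.sq_sqrt (by norm_num)]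
  norm_num

theorem hMap_eq (x : Fin 4 → ℂ) (k : Fin 4) :
    hMap x k = sqrt5 * (hIrr k).eval x + (hRat k).eval x := by
  fin_cases k <;>
    simp [hMap, hIrr, hRat, h10, h6, h2, eps1E, eps2E, eps3E, delE, evalList, evalMonomial, eps1, eps2,
      eps3, del, sqrt5] <;> ring

/-- The derivative of the `k`-th component of `hMap` with respect to the `a`-th variable. -/
noncomputable def hMapD (x : Fin 4 → ℂ) (k a : Fin 4) : ℂ :=
  sqrt5 * (pderiv a (hIrr k)).eval x + (pderiv a (hRat k)).eval x

theorem hasFDerivAt_hMap (x : Fin 4 → ℂ) (k : Fin 4) :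
    HasFDerivAt (fun s => hMap s k)
      (∑ a, hMapD x k a • ContinuousLinearMap.proj (R := ℂ) (φ := fun _ : Fin 4 => ℂ) a) x := by
  have h1 (p : PolyExpr) := hasFDerivAt_eval (u := fun s : Fin 4 → ℂ => s)
    (fun a => hasFDerivAt_apply (𝕜 := ℂ) (F' := fun _ : Fin 4 => ℂ) a x) p
  have h2 := ((h1 (hIrr k)).const_mul sqrt5).add (h1 (hRat k))
  refine (h2.congr_of_eventuallyEq (Eventually.of_forall fun s => hMap_eq s k)).congr_fderiv ?_
  ext v
  simp [Fin.sum_univ_four, hMapD]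
  ring

theorem sum_hMapD (x : Fin 4 → ℂ) (k l : Fin 4) :
    ∑ a, hMapD x k a * hMapD x l a =
      (const 5 * gradE (hIrr k) (hIrr l) + gradE (hRat k) (hRat l)).eval x +
        sqrt5 * (gradE (hIrr k) (hRat l) + gradE (hRat k) (hIrr l)).eval x := by
  simp only [Fin.sum_univ_four, hMapD, gradE, eval_add, eval_mul, eval_const]
  push_cast
  linear_combination ((pderiv 0 (hIrr k)).eval x * (pderiv 0 (hIrr l)).eval x +
    (pderiv 1 (hIrr k)).eval x * (pderiv 1 (hIrr l)).eval x +
    (pderiv 2 (hIrr k)).eval x * (pderiv 2 (hIrr l)).eval x +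
    (pderiv 3 (hIrr k)).eval x * (pderiv 3 (hIrr l)).eval x) * sqrt5_sq

theorem sum_hMapD_of_le (x : Fin 4 → ℂ) {k l : Fin 4} (h : k ≤ l) :
    ∑ a, hMapD x k a * hMapD x l a = (gramRat k l).eval x + sqrt5 * (gramIrr k l).eval x := by
  have h1 := eval_eq_zero_of_vanishes (gramRat_vanishes k l h) x
  have h2 := eval_eq_zero_of_vanishes (gramIrr_vanishes k l h) x
  rw [eval_sub] at h1 h2
  rw [sum_hMapD]
  linear_combination h1 + sqrt5 * h2

/-- The scalar products of the gradients of `(h10, h6, x₁ ^ 2, h2)`. -/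
noncomputable def hGram (u : Fin 4 → ℂ) : Matrix (Fin 4) (Fin 4) ℂ :=
  !![8 * u 0 * u 3 ^ 4 + 36 * u 1 ^ 2 * u 3 ^ 3 + 30 * u 1 ^ 3,
      8 * u 1 * u 3 ^ 4 + 28 * u 1 ^ 2 * u 3, 0, 20 * u 0;
    8 * u 1 * u 3 ^ 4 + 28 * u 1 ^ 2 * u 3, 8 * u 1 * u 3 ^ 2 + 8 * u 0, 0, 12 * u 1;
    0, 0, 4 * u 2, 0;
    20 * u 0, 12 * u 1, 0, 4 * u 3]

theorem sum_hMapD_eq_of_le (x : Fin 4 → ℂ) {k l : Fin 4} (h : k ≤ l) :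
    ∑ a, hMapD x k a * hMapD x l a = hGram (hMap x) k l := by
  rw [sum_hMapD_of_le x h]
  have h0 := hMap_eq x 0
  have h1 := hMap_eq x 1
  have h2 := hMap_eq x 2
  have h3 := hMap_eq x 3
  simp only [hIrr, eval_terms, evalList, mul_zero, zero_add] at h2 h3
  have hA : (hIrr 1).eval x = delE.eval x := rfl
  have hB : (hRat 3).eval x = eps1E.eval x := rfl
  rw [hA] at h1
  rw [hB] at h3
  fin_cases k <;> fin_cases l <;> first | (exfalso; revert h; decide) | skip
  all_goals
    simp only [hGram, gramRat, gramIrr, Fin.zero_eta, Fin.mk_one, Fin.reduceFinMk, Matrix.of_apply,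
      Matrix.cons_val, h0, h1, h2, h3, eval_add, eval_mul, eval_const, eval_terms, evalList, hB]
    push_cast
  -- The multiples of √5² = 5 reduce the higher powers of √5 in the square and the cube of h6.
  · linear_combination (-(36 * eps1E.eval x ^ 3 * delE.eval x ^ 2) -
      90 * delE.eval x ^ 2 * (hRat 1).eval x - 30 * sqrt5 * delE.eval x ^ 3) * sqrt5_sq
  · linear_combination (-(28 * eps1E.eval x * delE.eval x ^ 2)) * sqrt5_sq
  all_goals ring

theorem sum_hMapD_eq (x : Fin 4 → ℂ) (k l : Fin 4) :
    ∑ a, hMapD x k a * hMapD x l a = hGram (hMap x) k l := by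
  rcases le_total k l with h | h
  · exact sum_hMapD_eq_of_le x h
  · have h1 := sum_hMapD_eq_of_le x h
    have h2 : hGram (hMap x) l k = hGram (hMap x) k l := by
      fin_cases k <;> fin_cases l <;> rfl
    rw [← h2, ← h1]
    exact Finset.sum_congr rfl fun a _ => mul_comm _ _

/-- The invariants up to scalar factors as polynomials in `(h10, h6, x₁ ^ 2, h2)`. -/
def hE : Fin 4 → PolyExpr
  | 0 => hE1
  | 1 => hE2
  | 2 => hE3
  | 3 => hE4

/-- The scalar factors of the invariants in `hE`. -/
noncomputable def hScale : Fin 4 → ℂ := ![1 / 15, 1 / 2, 1 / 2, 1]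

theorem y_eq (x : Fin 4 → ℂ) (i : Fin 4) : y i x = hScale i * (hE i).eval (hMap x) := by
  fin_cases i
  · simp [y, hScale, hE, hMap, eval_hE1]
  · simp [y, hScale, hE, hMap, eval_hE2]
  · simp [y, hScale, hE, hMap, eval_hE3]
  · simp [y, hScale, hE, hMap, eval_hE4]

theorem hasFDerivAt_y (x : Fin 4 → ℂ) (i : Fin 4) :
    HasFDerivAt (y i) (hScale i • ∑ k, (pderiv k (hE i)).eval (hMap x) •
      ∑ a, hMapD x k a • ContinuousLinearMap.proj (R := ℂ) (φ := fun _ : Fin 4 => ℂ) a) x := by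
  have h := (hasFDerivAt_eval (hasFDerivAt_hMap x) (hE i)).const_mul (hScale i)
  exact h.congr_of_eventuallyEq (Eventually.of_forall fun s => y_eq s i)

theorem pd_y (x : Fin 4 → ℂ) (i a : Fin 4) :
    pd a (y i) x = hScale i * ∑ k, (pderiv k (hE i)).eval (hMap x) * hMapD x k a := by
  rw [pd, (hasFDerivAt_y x i).fderiv]
  fin_cases a <;> simp [Fin.sum_univ_four] <;> ring

/-- The scalar products of the gradients of the invariants as polynomials in the invariants. -/
noncomputable def gram (y : Fin 4 → ℂ) : Matrix (Fin 4) (Fin 4) ℂ :=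
  !![160 * y 0 * y 1 * y 3 ^ 4 + 240 * y 0 * y 2 ^ 2 * y 3 ^ 2 + 96 * y 1 ^ 2 * y 2 * y 3 ^ 3 +
        928 / 3 * y 1 * y 2 ^ 3 * y 3,
      -120 * y 0 * y 2 * y 3 ^ 3 + 48 * y 1 ^ 2 * y 3 ^ 4 - 112 * y 1 * y 2 ^ 2 * y 3 ^ 2 -
        32 * y 2 ^ 4,
      -40 * y 0 * y 3 ^ 5 - 80 * y 1 ^ 2 - 16 * y 1 * y 2 * y 3 ^ 4 - 16 / 3 * y 2 ^ 3 * y 3 ^ 2,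
      60 * y 0;
    -120 * y 0 * y 2 * y 3 ^ 3 + 48 * y 1 ^ 2 * y 3 ^ 4 - 112 * y 1 * y 2 ^ 2 * y 3 ^ 2 -
        32 * y 2 ^ 4,
      20 * y 0 * y 3 ^ 4 - 56 * y 1 * y 2 * y 3 ^ 3 + 152 / 3 * y 2 ^ 3 * y 3,
      -30 * y 0 - 24 * y 1 * y 3 ^ 5 + 8 * y 2 ^ 2 * y 3 ^ 3,
      40 * y 1;
    -40 * y 0 * y 3 ^ 5 - 80 * y 1 ^ 2 - 16 * y 1 * y 2 * y 3 ^ 4 - 16 / 3 * y 2 ^ 3 * y 3 ^ 2,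
      -30 * y 0 - 24 * y 1 * y 3 ^ 5 + 8 * y 2 ^ 2 * y 3 ^ 3,
      44 * y 1 * y 3 - 8 * y 2 * y 3 ^ 5,
      24 * y 2;
    60 * y 0, 40 * y 1, 24 * y 2, 4 * y 3]

theorem gram_symm (y : Fin 4 → ℂ) (i j : Fin 4) : gram y i j = gram y j i := by
  fin_cases i <;> fin_cases j <;> rfl

/-- The chain rule through `hMap`: only the Gram matrix of (h10, h6, x₁², h2) is needed, and it is
polynomial in these functions themselves. -/
theorem sum_pd_y_mul_pd_y (x : Fin 4 → ℂ) (i j : Fin 4) :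
    ∑ a, pd a (y i) x * pd a (y j) x =
      hScale i * hScale j * (hPairE (hE i) (hE j)).eval (hMap x) := by
  have h1 : ∑ a, pd a (y i) x * pd a (y j) x = hScale i * hScale j *
      ∑ k, ∑ l, (pderiv k (hE i)).eval (hMap x) * (pderiv l (hE j)).eval (hMap x) *
        ∑ a, hMapD x k a * hMapD x l a := by
    simp only [pd_y, Fin.sum_univ_four]
    ring
  simp only [h1, sum_hMapD_eq]
  congr 1
  simp only [Fin.sum_univ_four, hGram, hPairE, Matrix.of_apply, Matrix.cons_val, eval_add, eval_mul,
    eval_terms, evalList, evalMonomial]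
  push_cast
  ring

theorem sum_pd_y_of_le (x : Fin 4 → ℂ) {i j : Fin 4} (h : i ≤ j) :
    ∑ a, pd a (y i) x * pd a (y j) x = gram (fun i => y i x) i j := by
  rw [sum_pd_y_mul_pd_y]
  fin_cases i <;> fin_cases j <;> first | (exfalso; revert h; decide) | skip
  all_goals
    simp only [gram, Fin.zero_eta, Fin.mk_one, Fin.reduceFinMk, Matrix.of_apply, Matrix.cons_val,
      y_eq, hScale, hE]
  · have := eval_eq_zero_of_vanishes hPairE11_vanishes (hMap x)
    simp only [eval_sub, eval_add, eval_mul, eval_const] at this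
    push_cast at this
    linear_combination this / 225
  · have := eval_eq_zero_of_vanishes hPairE12_vanishes (hMap x)
    simp only [eval_sub, eval_add, eval_mul, eval_const] at this
    push_cast at this
    linear_combination this / 30
  · have := eval_eq_zero_of_vanishes hPairE13_vanishes (hMap x)
    simp only [eval_sub, eval_mul, eval_const] at this
    push_cast at this
    linear_combination this / 30
  · have := eval_eq_zero_of_vanishes hPairE14_vanishes (hMap x)
    simp only [eval_sub, eval_mul, eval_const] at this
    push_cast at this
    linear_combination this / 15
  · have := eval_eq_zero_of_vanishes hPairE22_vanishes (hMap x)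
    simp only [eval_sub, eval_add, eval_mul, eval_const] at this
    push_cast at this
    linear_combination this / 12
  · have := eval_eq_zero_of_vanishes hPairE23_vanishes (hMap x)
    simp only [eval_sub, eval_add, eval_mul, eval_const] at this
    push_cast at this
    linear_combination this / 4
  · have := eval_eq_zero_of_vanishes hPairE24_vanishes (hMap x)
    simp only [eval_sub, eval_mul, eval_const] at this
    push_cast at this
    linear_combination this / 2
  · have := eval_eq_zero_of_vanishes hPairE33_vanishes (hMap x)
    simp only [eval_sub, eval_mul, eval_const] at this
    push_cast at this
    linear_combination this / 4
  · have := eval_eq_zero_of_vanishes hPairE34_vanishes (hMap x)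
    simp only [eval_sub, eval_mul, eval_const] at this
    push_cast at this
    linear_combination this / 2
  · have := eval_eq_zero_of_vanishes hPairE44_vanishes (hMap x)
    simp only [eval_sub, eval_mul, eval_const] at this
    push_cast at this
    linear_combination this

/-- The scalar products of the gradients of the invariants. -/
theorem sum_pd_y (x : Fin 4 → ℂ) (i j : Fin 4) :
    ∑ a, pd a (y i) x * pd a (y j) x = gram (fun i => y i x) i j := by
  rcases le_total i j with h | h
  · exact sum_pd_y_of_le x h
  · rw [gram_symm, ← sum_pd_y_of_le x h]
    exact Finset.sum_congr rfl fun a _ => mul_comm _ _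

/-! ### The intersection form of the right-hand sides -/

/-- The scalar factors of the right-hand sides in `yE`. -/
noncomputable def yScale : Fin 4 → ℂ :=
  ![-(2 ^ 19 * 5 ^ 9 / (3 ^ 13 * 7)), -(2 ^ 12 * 5 ^ 6 / 3 ^ 8), -(2 ^ 7 * 5 ^ 3 / 3 ^ 5), 20]

section Branch

variable {U : Set (Fin 4 → ℂ)} {ζ : (Fin 4 → ℂ) → ℂ} {t : Fin 4 → ℂ}

theorem IsBranch.Y_eq (hζ : IsBranch U ζ) (ht : t ∈ U) (i : Fin 4) :
    Y i t (ζ t) = yScale i * (yE i).eval (chart ζ t) := by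
  have h := hζ.root t ht
  fin_cases i
  · simp [Y, yScale, yE, ← eval_yE1 h, chart]
  · simp [Y, yScale, yE, ← eval_yE2 h, chart]
  · simp [Y, yScale, yE, ← eval_yE3 h, chart]
  · simp [Y, yScale, yE, Y4, yE4, evalList, evalMonomial]

theorem isZDeriv_yE : ∀ i, IsZDeriv (yE i) (yZ i)
  | 0 => isZDeriv_yE1
  | 1 => isZDeriv_yE2
  | 2 => isZDeriv_yE3
  | 3 => fun u => by
    rw [show pderiv 1 (yE 3) = .terms [] from rfl, show yZ 3 = .terms [] from rfl]
    simp [evalList]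

theorem IsBranch.pd_Y (hζ : IsBranch U ζ) (ht : t ∈ U) (i l : Fin 4) :
    pd l (fun s => Y i s (ζ s)) t =
      yScale i * (tDeriv (yE i) (yZ i) l).eval (chart ζ t) := by
  rw [pd_congr hζ.isOpen (fun t ht => hζ.Y_eq ht i) ht,
    pd_const_mul (hζ.differentiableAt_eval ht _), hζ.pd_eval (isZDeriv_yE i) ht]

theorem eval_formE_symm (u : Fin 4 → ℂ) (l m : Fin 4) :
    (formE l m).eval u = (formE m l).eval u := by
  have := eval_eq_zero_of_vanishes (prepD_symm_vanishes l m) u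
  simp only [formE, eval_sub, eval_mul, eval_const] at this ⊢
  push_cast
  -- The weights cancel in the difference and leave 11 times the difference of the mixed
  -- derivatives.
  linear_combination 11 * this

theorem IsBranch.g_symm (hζ : IsBranch U ζ) (ht : t ∈ U) (i j : Fin 4) :
    g ζ t i j = g ζ t j i := by
  rw [hζ.g_eq ht, hζ.g_eq ht, eval_formE_symm]

theorem IsBranch.g_three (hζ : IsBranch U ζ) (ht : t ∈ U) (i : Fin 4) :
    g ζ t i 3 = euler i * t i := by
  have := eval_eq_zero_of_vanishes (formE_zero_vanishes i) (chart ζ t)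
  rw [eval_sub, eval_mul, eval_const, eval_eulerE hζ ht] at this
  rw [hζ.g_eq ht, show (3 : Fin 4).rev = 0 from rfl]
  push_cast at this
  linear_combination this / 990

theorem IsBranch.sum_g_pd_Y_eq (hζ : IsBranch U ζ) (ht : t ∈ U) (i j : Fin 4) :
    ∑ l, ∑ m, g ζ t l m * pd l (fun s => Y i s (ζ s)) t * pd m (fun s => Y j s (ζ s)) t =
      yScale i * yScale j / 990 * (pairE (yE i) (yZ i) (yE j) (yZ j)).eval (chart ζ t) := by
  simp only [hζ.g_eq ht, hζ.pd_Y ht, Fin.sum_univ_four, pairE, eval_add, eval_mul,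
    show (0 : Fin 4).rev = 3 from rfl, show (1 : Fin 4).rev = 2 from rfl,
    show (2 : Fin 4).rev = 1 from rfl, show (3 : Fin 4).rev = 0 from rfl]
  ring

theorem IsBranch.sum_g_pd_Y_of_le (hζ : IsBranch U ζ) (ht : t ∈ U) {i j : Fin 4} (h : i ≤ j) :
    ∑ l, ∑ m, g ζ t l m * pd l (fun s => Y i s (ζ s)) t * pd m (fun s => Y j s (ζ s)) t =
      gram (fun i => Y i t (ζ t)) i j := by
  rw [hζ.sum_g_pd_Y_eq ht]
  have h4 := fun i => eval_eq_zero_of_vanishes (pairE_yE4_vanishes i) (chart ζ t)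
  simp only [eval_sub, eval_mul, eval_const] at h4
  fin_cases i <;> fin_cases j <;> first | (exfalso; revert h; decide) | skip
  all_goals
    simp only [gram, Fin.zero_eta, Fin.mk_one, Fin.reduceFinMk, Matrix.of_apply, Matrix.cons_val,
      hζ.Y_eq ht, yScale, yE, yZ]
  · have := eval_eq_zero_of_vanishes pairE11_vanishes (chart ζ t)
    simp only [eval_sub, eval_add, eval_mul, eval_const] at this
    push_cast at this
    linear_combination (2 ^ 19 * 5 ^ 9 / (3 ^ 13 * 7)) ^ 2 / (990 * 5) * this
  · have := eval_eq_zero_of_vanishes pairE12_vanishes (chart ζ t)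
    simp only [eval_sub, eval_add, eval_mul, eval_const] at this
    push_cast at this
    linear_combination (2 ^ 19 * 5 ^ 9 / (3 ^ 13 * 7)) * (2 ^ 12 * 5 ^ 6 / 3 ^ 8) / (990 * 25) * this
  · have := eval_eq_zero_of_vanishes pairE13_vanishes (chart ζ t)
    simp only [eval_sub, eval_add, eval_mul, eval_const] at this
    push_cast at this
    linear_combination (2 ^ 19 * 5 ^ 9 / (3 ^ 13 * 7)) * (2 ^ 7 * 5 ^ 3 / 3 ^ 5) / 990 * this
  · have := h4 0
    simp only [yE, yZ, degE] at this
    push_cast at this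
    linear_combination -(2 ^ 19 * 5 ^ 9 / (3 ^ 13 * 7)) * 20 / 990 * this
  · have := eval_eq_zero_of_vanishes pairE22_vanishes (chart ζ t)
    simp only [eval_sub, eval_mul, eval_const] at this
    push_cast at this
    linear_combination (2 ^ 12 * 5 ^ 6 / 3 ^ 8) ^ 2 / (990 * 35) * this
  · have := eval_eq_zero_of_vanishes pairE23_vanishes (chart ζ t)
    simp only [eval_sub, eval_add, eval_mul, eval_const] at this
    push_cast at this
    linear_combination (2 ^ 12 * 5 ^ 6 / 3 ^ 8) * (2 ^ 7 * 5 ^ 3 / 3 ^ 5) / (990 * 7) * this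
  · have := h4 1
    simp only [yE, yZ, degE] at this
    push_cast at this
    linear_combination -(2 ^ 12 * 5 ^ 6 / 3 ^ 8) * 20 / 990 * this
  · have := eval_eq_zero_of_vanishes pairE33_vanishes (chart ζ t)
    simp only [eval_sub, eval_add, eval_mul, eval_const] at this
    push_cast at this
    linear_combination (2 ^ 7 * 5 ^ 3 / 3 ^ 5) ^ 2 / 990 * this
  · have := h4 2
    simp only [yE, yZ, degE] at this
    push_cast at this
    linear_combination -(2 ^ 7 * 5 ^ 3 / 3 ^ 5) * 20 / 990 * this
  · have := h4 3
    simp only [yE, yZ, degE] at this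
    push_cast at this
    linear_combination 20 * 20 / 990 * this

/-- The intersection form in the coordinates given by the right-hand sides of the relations. -/
theorem IsBranch.sum_g_pd_Y (hζ : IsBranch U ζ) (ht : t ∈ U) (i j : Fin 4) :
    ∑ l, ∑ m, g ζ t l m * pd l (fun s => Y i s (ζ s)) t * pd m (fun s => Y j s (ζ s)) t =
      gram (fun i => Y i t (ζ t)) i j := by
  rcases le_total i j with h | h
  · exact hζ.sum_g_pd_Y_of_le ht h
  · rw [gram_symm, ← hζ.sum_g_pd_Y_of_le ht h, Finset.sum_comm]
    refine Finset.sum_congr rfl fun l _ => Finset.sum_congr rfl fun m _ => ?_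
    rw [hζ.g_symm ht m l]
    ring

end Branch

end H44

/-! ### Local inverses of holomorphic maps -/

-- The inverse function theorem, with the target shrunk so that the inverse is holomorphic on all of
-- W and takes values in U.
open Filter Topology in
theorem exists_local_inverse_of_differentiableOn {E : Type*} [NormedAddCommGroup E]
    [NormedSpace ℂ E] [FiniteDimensional ℂ E] {f : E → E} {U : Set E} (hU : IsOpen U)
    (hf : DifferentiableOn ℂ f U) {z₀ : E} (hz₀ : z₀ ∈ U)
    (hinj : Function.Injective (fderiv ℂ f z₀)) :
    ∃ (V W : Set E) (ψ : E → E), IsOpen V ∧ z₀ ∈ V ∧ V ⊆ U ∧ IsOpen W ∧ Set.MapsTo f V W ∧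
      Set.MapsTo ψ W V ∧ Set.LeftInvOn ψ f V ∧ Set.RightInvOn ψ f W ∧
      DifferentiableOn ℂ ψ W := by
  have : CompleteSpace E := FiniteDimensional.complete ℂ E
  let f' : E ≃L[ℂ] E :=
    (LinearEquiv.ofInjectiveEndo (fderiv ℂ f z₀).toLinearMap hinj).toContinuousLinearEquiv
  have hf' : HasFDerivAt f (f' : E →L[ℂ] E) z₀ := by
    have h := ((hf z₀ hz₀).differentiableAt (hU.mem_nhds hz₀)).hasFDerivAt
    exact h.congr_fderiv (by ext v; rfl)
  have hfc : ContDiffAt ℂ 1 f z₀ :=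
    (contDiffOn_of_differentiableOn_complex hU 1 hf).contDiffAt (hU.mem_nhds hz₀)
  let e := hfc.toOpenPartialHomeomorph f hf' one_ne_zero
  have hef : ∀ z, e z = f z := fun z => rfl
  have hz₀s : z₀ ∈ e.source := hfc.mem_toOpenPartialHomeomorph_source hf' one_ne_zero
  have hz₀t : f z₀ ∈ e.target := hfc.image_mem_toOpenPartialHomeomorph_target hf' one_ne_zero
  have hs₀ : e.symm (f z₀) = z₀ := e.left_inv hz₀s
  have hd : ∀ᶠ w in 𝓝 (f z₀), DifferentiableAt ℂ e.symm w :=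
    ((hfc.to_localInverse hf' one_ne_zero).eventually (by simp)).mono fun w hw =>
      hw.differentiableAt one_ne_zero
  have hUw : ∀ᶠ w in 𝓝 (f z₀), e.symm w ∈ U := by
    refine (e.symm.continuousAt hz₀t).eventually (p := fun z => z ∈ U) ?_
    rw [hs₀]
    exact hU.mem_nhds hz₀
  obtain ⟨W, hW, hWo, hz₀W⟩ := eventually_nhds_iff.mp
    ((e.open_target.eventually_mem hz₀t).and (hd.and hUw))
  refine ⟨e.source ∩ e ⁻¹' W, W, e.symm, e.isOpen_inter_preimage hWo, ⟨hz₀s, hz₀W⟩, ?_, hWo,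
    fun z hz => hz.2, ?_, fun z hz => e.left_inv hz.1, fun w hw => e.right_inv (hW w hw).1,
    fun w hw => (hW w hw).2.1.differentiableWithinAt⟩
  · intro z hz
    have := (hW _ hz.2).2.2
    rwa [e.left_inv hz.1] at this
  · intro w hw
    refine ⟨e.map_target (hW w hw).1, ?_⟩
    rw [Set.mem_preimage, e.right_inv (hW w hw).1]
    exact hw

namespace H44

open PolyExpr Filter Topology

/-! ### Jacobian matrices -/

/-- The Jacobian matrix of a map from `ℂ⁴` to itself. -/
noncomputable def jac (f : (Fin 4 → ℂ) → (Fin 4 → ℂ)) (z : Fin 4 → ℂ) : Matrix (Fin 4) (Fin 4) ℂ :=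
  Matrix.of fun i a => pd a (fun s => f s i) z

theorem fderiv_apply_eq_jac {f : (Fin 4 → ℂ) → (Fin 4 → ℂ)} {z : Fin 4 → ℂ}
    (hf : DifferentiableAt ℂ f z) (v : Fin 4 → ℂ) : fderiv ℂ f z v = jac f z *ᵥ v := by
  ext i
  have h1 : fderiv ℂ f z v i = fderiv ℂ (fun s => f s i) z v := by
    have := hasFDerivAt_pi'.mp hf.hasFDerivAt i
    rw [this.fderiv]
    rfl
  have h2 : v = ∑ a, v a • (Pi.single a (1 : ℂ) : Fin 4 → ℂ) := by
    ext b
    simp [Finset.sum_apply, Pi.single_apply]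
  rw [h1]
  conv_lhs => rw [h2]
  simp only [map_sum, map_smul, smul_eq_mul, Matrix.mulVec, dotProduct, jac, Matrix.of_apply, pd]
  exact Finset.sum_congr rfl fun _ _ => mul_comm _ _

theorem jac_comp {f h : (Fin 4 → ℂ) → (Fin 4 → ℂ)} {z : Fin 4 → ℂ}
    (hf : DifferentiableAt ℂ f (h z)) (hh : DifferentiableAt ℂ h z) :
    jac (fun s => f (h s)) z = jac f (h z) * jac h z := by
  have hc : DifferentiableAt ℂ (fun s => f (h s)) z := hf.comp z hh
  refine Matrix.ext_of_mulVec_single fun a => ?_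
  rw [← fderiv_apply_eq_jac hc, ← Matrix.mulVec_mulVec, ← fderiv_apply_eq_jac hh,
    ← fderiv_apply_eq_jac hf, fderiv_fun_comp z hf hh]
  rfl

theorem jac_congr {f h : (Fin 4 → ℂ) → (Fin 4 → ℂ)} {z : Fin 4 → ℂ} (hfh : f =ᶠ[𝓝 z] h) :
    jac f z = jac h z := by
  ext i a
  have : (fun s => f s i) =ᶠ[𝓝 z] fun s => h s i := hfh.mono fun s hs => congrFun hs i
  simp only [jac, Matrix.of_apply, pd, this.fderiv_eq]

theorem injective_fderiv_of_det_jac_ne_zero {f : (Fin 4 → ℂ) → (Fin 4 → ℂ)} {z : Fin 4 → ℂ}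
    (hf : DifferentiableAt ℂ f z) (h : (jac f z).det ≠ 0) :
    Function.Injective (fderiv ℂ f z) := by
  intro v w hvw
  rw [fderiv_apply_eq_jac hf, fderiv_apply_eq_jac hf] at hvw
  exact Matrix.mulVec_injective_of_isUnit
    ((Matrix.isUnit_iff_isUnit_det _).mpr (isUnit_iff_ne_zero.mpr h)) hvw

theorem sum_sum_mul_pd_mul_pd (G : Matrix (Fin 4) (Fin 4) ℂ) (f h : (Fin 4 → ℂ) → (Fin 4 → ℂ))
    (z : Fin 4 → ℂ) (i j : Fin 4) :
    ∑ l, ∑ m, G l m * pd l (fun s => f s i) z * pd m (fun s => h s j) z =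
      (jac f z * G * (jac h z)ᵀ) i j := by
  simp only [Matrix.mul_apply, jac, Matrix.of_apply, Matrix.transpose_apply, Finset.sum_mul]
  rw [Finset.sum_comm]
  exact Finset.sum_congr rfl fun l _ => Finset.sum_congr rfl fun m _ => by ring

/-! ### Surjectivity of the invariants -/

/-- The invariants as a map from `ℂ⁴` to itself. -/
noncomputable def yMap (x : Fin 4 → ℂ) : Fin 4 → ℂ := fun i => y i x

theorem differentiable_yMap : Differentiable ℂ yMap := fun x =>
  differentiableAt_pi.mpr fun i => (hasFDerivAt_y x i).differentiableAt

theorem jac_yMap_mul_transpose (x : Fin 4 → ℂ) :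
    jac yMap x * (jac yMap x)ᵀ = gram (yMap x) := by
  ext i j
  exact sum_pd_y x i j

theorem det_jac_yMap_ne_zero {x : Fin 4 → ℂ} (h : (gram (yMap x)).det ≠ 0) :
    (jac yMap x).det ≠ 0 := by
  intro h0
  rw [← jac_yMap_mul_transpose, Matrix.det_mul, h0, zero_mul] at h
  exact h rfl

/-- The degrees of the invariants. -/
def deg : Fin 4 → ℕ := ![30, 20, 12, 2]

theorem yMap_smul (c : ℂ) (x : Fin 4 → ℂ) (i : Fin 4) : yMap (c • x) i = c ^ deg i * yMap x i := by
  have h2s : h2 (c * x 1) (c * x 2) (c * x 3) = c ^ 2 * h2 (x 1) (x 2) (x 3) := by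
    simp only [h2, eps1]; ring
  have h6s : h6 (c * x 1) (c * x 2) (c * x 3) = c ^ 6 * h6 (x 1) (x 2) (x 3) := by
    simp only [h6, eps1, eps2, eps3, del]; ring
  have h10s : h10 (c * x 1) (c * x 2) (c * x 3) = c ^ 10 * h10 (x 1) (x 2) (x 3) := by
    simp only [h10, eps1, eps2, eps3, del]; ring
  fin_cases i
  · simp [yMap, y, deg, h2s, h6s, h10s, y1Aux]; ring
  · simp [yMap, y, deg, h2s, h6s, h10s, y2Aux]; ring
  · simp [yMap, y, deg, h2s, h6s, h10s, y3Aux]; ring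
  · simp [yMap, y, deg, h2s, y4Aux]; ring

/-- With x₁ = 1, y₄ = 0 forces h2 = −1, and y₃ = 0, which is then linear in h10, expresses h10
through h6. What remains of y₁ and y₂ are two coprime polynomials in h6. -/
theorem yMap_ne_zero_of_apply_zero_eq_one {x : Fin 4 → ℂ} (hx : x 0 = 1) : yMap x ≠ 0 := by
  intro h
  have e1 : y1Aux (x 0) (h2 (x 1) (x 2) (x 3)) (h6 (x 1) (x 2) (x 3)) (h10 (x 1) (x 2) (x 3)) = 0 :=
    congrFun h 0
  have e2 : y2Aux (x 0) (h2 (x 1) (x 2) (x 3)) (h6 (x 1) (x 2) (x 3)) (h10 (x 1) (x 2) (x 3)) = 0 :=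
    congrFun h 1
  have e3 : y3Aux (x 0) (h2 (x 1) (x 2) (x 3)) (h6 (x 1) (x 2) (x 3)) (h10 (x 1) (x 2) (x 3)) = 0 :=
    congrFun h 2
  have e4 : y4Aux (x 0) (h2 (x 1) (x 2) (x 3)) = 0 := congrFun h 3
  rw [hx] at e1 e2 e3 e4
  generalize h10 (x 1) (x 2) (x 3) = b at *
  generalize h6 (x 1) (x 2) (x 3) = a at *
  generalize h2 (x 1) (x 2) (x 3) = c at *
  have hc : c = -1 := by
    simp only [y4Aux] at e4
    linear_combination e4
  subst hc
  have hb : b = -(30 + 66 * a + 3 / 2 * a ^ 2) / 12 := by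
    simp only [y3Aux] at e3
    linear_combination e3 / 12
  subst hb
  simp only [y1Aux] at e1
  simp only [y2Aux] at e2
  refine one_ne_zero (α := ℂ) ?_
  -- Bézout coefficients of these two polynomials in a = h6.
  linear_combination
    (-22233883775 / 844424930131968 + 8438776879 / 1688849860263936 * a +
      196801113 / 1125899906842624 * a ^ 2 + 2022161 / 33776997205278720 * a ^ 3) * e1 +
    (3406803018637 / 6333186975989760 - 2270918942965 / 844424930131968 * a -
      263061784423 / 12666373951979520 * a ^ 2 - 139052604001 / 8444249301319680 * a ^ 3 -
      33767736203 / 506654958079180800 * a ^ 4 + 2022161 / 202661983231672320 * a ^ 5) * e2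

/-- The squares of a, b, c are the roots of X³ − ε₁X² + ε₂X − ε₃. -/
theorem eq_zero_of_eps_eq_zero {a b c : ℂ} (h1 : eps1 a b c = 0) (h2 : eps2 a b c = 0)
    (h3 : eps3 a b c = 0) : a = 0 ∧ b = 0 ∧ c = 0 := by
  simp only [eps1, eps2, eps3] at h1 h2 h3
  refine ⟨pow_eq_zero_iff (n := 6) (by norm_num) |>.mp ?_,
    pow_eq_zero_iff (n := 6) (by norm_num) |>.mp ?_, pow_eq_zero_iff (n := 6) (by norm_num) |>.mp ?_⟩
  · linear_combination a ^ 4 * h1 - a ^ 2 * h2 + h3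
  · linear_combination b ^ 4 * h1 - b ^ 2 * h2 + h3
  · linear_combination c ^ 4 * h1 - c ^ 2 * h2 + h3

/-- With ε₁ = 0 the other two equations give ε₂ε₃ = 0 and 5δ² = 121ε₃², while δ² = −4ε₂³ − 27ε₃² is
the discriminant of the cubic with roots a², b², c². Both cases force ε₂ = ε₃ = 0. -/
theorem eq_zero_of_h_eq_zero {a b c : ℂ} (e2 : h2 a b c = 0) (e6 : h6 a b c = 0)
    (e10 : h10 a b c = 0) : a = 0 ∧ b = 0 ∧ c = 0 := by
  have hdisc : del a b c ^ 2 = eps1 a b c ^ 2 * eps2 a b c ^ 2 - 4 * eps2 a b c ^ 3 -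
      4 * eps1 a b c ^ 3 * eps3 a b c + 18 * eps1 a b c * eps2 a b c * eps3 a b c -
      27 * eps3 a b c ^ 2 := by
    simp only [del, eps1, eps2, eps3]; ring
  simp only [h2] at e2
  simp only [h6, e2] at e6
  simp only [h10, e2] at e10
  rw [e2] at hdisc
  have h5 := sqrt5_sq
  rw [sqrt5] at h5
  have hp : eps2 a b c * eps3 a b c = 0 := by
    linear_combination (e10 - 3 * eps2 a b c * e6) / 128
  have hd : 5 * del a b c ^ 2 = 121 * eps3 a b c ^ 2 := by
    linear_combination (((Real.sqrt 5 : ℝ) : ℂ) * del a b c + 11 * eps3 a b c) * e6 -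
      del a b c ^ 2 * h5
  rcases mul_eq_zero.mp hp with h | h
  · refine eq_zero_of_eps_eq_zero e2 h (pow_eq_zero_iff (n := 2) (by norm_num) |>.mp ?_)
    rw [h] at hdisc
    linear_combination (5 * hdisc - hd) / 256
  · refine eq_zero_of_eps_eq_zero e2 (pow_eq_zero_iff (n := 3) (by norm_num) |>.mp ?_) h
    rw [h] at hdisc hd
    linear_combination (5 * hdisc - hd) / 20

theorem eq_zero_of_yMap_eq_zero {x : Fin 4 → ℂ} (h : yMap x = 0) : x = 0 := by
  have hx : x 0 = 0 := by
    by_contra hx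
    refine yMap_ne_zero_of_apply_zero_eq_one (x := (x 0)⁻¹ • x) (by simp [hx]) ?_
    ext i
    simp [yMap_smul, h]
  have e2 : h2 (x 1) (x 2) (x 3) = 0 := by
    have : y4Aux (x 0) (h2 (x 1) (x 2) (x 3)) = 0 := congrFun h 3
    simpa [y4Aux, hx] using this
  have e6 : h6 (x 1) (x 2) (x 3) = 0 := by
    have : y3Aux (x 0) (h2 (x 1) (x 2) (x 3)) (h6 (x 1) (x 2) (x 3)) (h10 (x 1) (x 2) (x 3)) = 0 :=
      congrFun h 2
    simpa [y3Aux, hx, e2] using this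
  have e10 : h10 (x 1) (x 2) (x 3) = 0 := by
    have : y2Aux (x 0) (h2 (x 1) (x 2) (x 3)) (h6 (x 1) (x 2) (x 3)) (h10 (x 1) (x 2) (x 3)) = 0 :=
      congrFun h 1
    simpa [y2Aux, hx, e2] using this
  obtain ⟨h1, h2, h3⟩ := eq_zero_of_h_eq_zero e2 e6 e10
  ext i
  fin_cases i <;> assumption

/-- The degrees are at least 1 and the only zero is the origin. Scaling from the compact unit
sphere, where ‖y‖ has a positive minimum m, gives ‖y(x)‖ ≥ m‖x‖ for ‖x‖ ≥ 1; thus the map is proper.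
-/
theorem isClosed_range_yMap : IsClosed (Set.range yMap) := by
  obtain ⟨s, hs, hmin⟩ := (isCompact_sphere (0 : Fin 4 → ℂ) 1).exists_isMinOn
    (NormedSpace.sphere_nonempty.mpr zero_le_one)
    (differentiable_yMap.continuous.norm.continuousOn)
  have hpos : 0 < ‖yMap s‖ := norm_pos_iff.mpr fun h => by
    rw [eq_zero_of_yMap_eq_zero h] at hs
    simp at hs
  have hbound : ∀ x : Fin 4 → ℂ, 1 ≤ ‖x‖ → ‖x‖ * ‖yMap s‖ ≤ ‖yMap x‖ := fun x hx => by
    have hx0 : 0 < ‖x‖ := by linarith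
    have hn : ‖(‖x‖ : ℂ)‖ = ‖x‖ := by simp
    have hunit : ((‖x‖ : ℂ)⁻¹ • x) ∈ Metric.sphere (0 : Fin 4 → ℂ) 1 := by
      rw [mem_sphere_zero_iff_norm, norm_smul, norm_inv, hn, inv_mul_cancel₀ hx0.ne']
    have hle : ‖yMap s‖ ≤ ‖yMap ((‖x‖ : ℂ)⁻¹ • x)‖ := hmin hunit
    have hxe : x = (‖x‖ : ℂ) • ((‖x‖ : ℂ)⁻¹ • x) := by
      rw [smul_smul, mul_inv_cancel₀ (by exact_mod_cast hx0.ne'), one_smul]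
    rw [mul_comm, ← le_div_iff₀ hx0]
    refine hle.trans ((pi_norm_le_iff_of_nonneg
      (div_nonneg (norm_nonneg _) (norm_nonneg _))).mpr fun i => ?_)
    rw [le_div_iff₀ hx0]
    refine le_trans ?_ (norm_le_pi_norm (yMap x) i)
    have hy := yMap_smul (‖x‖ : ℂ) ((‖x‖ : ℂ)⁻¹ • x) i
    rw [← hxe] at hy
    rw [hy, norm_mul, norm_pow, hn, mul_comm]
    refine mul_le_mul_of_nonneg_right (le_self_pow₀ hx ?_) (norm_nonneg _)
    fin_cases i <;> simp [deg]
  refine IsProperMap.isClosed_range (isProperMap_iff_tendsto_cocompact.mpr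
    ⟨differentiable_yMap.continuous, ?_⟩)
  rw [← Metric.cobounded_eq_cocompact, ← tendsto_norm_atTop_iff_cobounded]
  refine tendsto_atTop_mono' _ ((tendsto_norm_cobounded_atTop.eventually_ge_atTop 1).mono hbound) ?_
  exact tendsto_norm_cobounded_atTop.atTop_mul_const hpos

/-- The complement of the discriminant. -/
def regular : Set (Fin 4 → ℂ) := {v | (gram v).det ≠ 0}

theorem differentiable_det_gram : Differentiable ℂ fun v : Fin 4 → ℂ => (gram v).det := by
  have h : ∀ i j, Differentiable ℂ fun v : Fin 4 → ℂ => gram v i j := fun i j => by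
    fin_cases i <;> fin_cases j <;> simp [gram] <;> fun_prop
  simp only [Matrix.det_apply']
  fun_prop

theorem isOpen_regular : IsOpen regular :=
  isOpen_ne_fun differentiable_det_gram.continuous continuous_const

/-- On the complex line through two points of the set, det `gram` is a nonzero entire function of
one variable. Its zeros are countable, and a plane minus a countable set is path connected. -/
theorem isPreconnected_regular : IsPreconnected regular := by
  refine isPreconnected_of_forall_pair fun a ha b hb => ?_
  set l : ℂ → Fin 4 → ℂ := fun z => a + z • (b - a) with hl
  have hld : Differentiable ℂ l := by fun_prop
  have han : AnalyticOnNhd ℂ (fun z => (gram (l z)).det) Set.univ :=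
    (differentiable_det_gram.comp hld).differentiableOn.analyticOnNhd isOpen_univ
  have h0 : (gram (l 0)).det ≠ 0 := by simpa [hl, regular] using ha
  have hc := han.preimage_zero_mem_codiscrete h0
  have hcount : ((fun z => (gram (l z)).det) ⁻¹' {0}).Countable := by
    have hd := (mem_codiscrete'.mp hc).2
    rw [Set.preimage_compl, compl_compl] at hd
    have := hd.to_subtype
    exact Set.countable_coe_iff.mp countable_of_Lindelof_of_discrete
  have hconn := (hcount.isPathConnected_compl_of_one_lt_rank (by
    rw [Complex.rank_real_complex]; norm_num)).isConnected.isPreconnected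
  refine ⟨l '' ((fun z => (gram (l z)).det) ⁻¹' {0})ᶜ, ?_, ⟨0, h0, by simp [hl]⟩,
    ⟨1, ?_, by simp [hl]⟩, hconn.image _ hld.continuous.continuousOn⟩
  · rintro _ ⟨z, hz, rfl⟩
    exact hz
  · simpa [hl, regular] using hb

theorem det_gram_of_single (c : ℂ) : (gram ![0, c, 0, 0]).det = (80 * c ^ 2) ^ 2 * (40 * c) ^ 2 := by
  simp [gram, Matrix.det_succ_row_zero, Fin.sum_univ_succ, Fin.succAbove]
  ring

/-- The point has x₂ = x₃, so δ = 0 and √5 disappears from the values. -/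
theorem yMap_mem_regular : yMap ![1, 2, 2, 4] ∈ regular := by
  have h2v : h2 2 2 4 = 24 := by norm_num [h2, eps1]
  have h6v : h6 2 2 4 = 640 := by norm_num [h6, eps1, eps2, eps3, del]
  have h10v : h10 2 2 4 = 276480 := by norm_num [h10, eps1, eps2, eps3, del]
  have hy : yMap ![1, 2, 2, 4] =
      ![583808370600960000, 576328711680, -17590320, 25] := by
    ext i
    fin_cases i <;> simp [yMap, y, h2v, h6v, h10v, y1Aux, y2Aux, y3Aux, y4Aux] <;> norm_num
  rw [regular, Set.mem_ofPred_eq, hy]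
  simp [gram, Matrix.det_succ_row_zero, Fin.sum_univ_succ, Fin.succAbove]
  norm_num

/-- The part of the image in the connected set `regular` is open by the inverse function theorem,
closed by properness, and nonempty. -/
theorem regular_subset_range_yMap : regular ⊆ Set.range yMap := by
  have hopen : IsOpen (Set.range yMap ∩ regular) := by
    refine isOpen_iff_mem_nhds.mpr ?_
    rintro _ ⟨⟨x, rfl⟩, hx⟩
    obtain ⟨V, W, ψ, -, hxV, -, hW, hVW, -, -, hψ, -⟩ := exists_local_inverse_of_differentiableOn
      isOpen_univ differentiable_yMap.differentiableOn (Set.mem_univ x)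
      (injective_fderiv_of_det_jac_ne_zero (differentiable_yMap x) (det_jac_yMap_ne_zero hx))
    exact inter_mem (mem_of_superset (hW.mem_nhds (hVW hxV)) fun w hw => ⟨ψ w, hψ hw⟩)
      (isOpen_regular.mem_nhds hx)
  refine (isPreconnected_regular.subset_of_closure_inter_subset hopen
    ⟨_, yMap_mem_regular, ⟨_, rfl⟩, yMap_mem_regular⟩ ?_).trans Set.inter_subset_left
  rintro v ⟨hv, hvr⟩
  exact ⟨closure_minimal Set.inter_subset_left isClosed_range_yMap hv, hvr⟩

/-! ### Flat coordinates -/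

/-- Applied with A the Jacobian of the invariants and B that of x: the comparison of Gram matrices
becomes orthonormality of the dxᵢ. -/
theorem mul_mul_transpose_eq_one_of_mul {A B G : Matrix (Fin 4) (Fin 4) ℂ} (hA : A.det ≠ 0)
    (h : A * B * G * (A * B)ᵀ = A * Aᵀ) : B * G * Bᵀ = 1 := by
  have hu : IsUnit A := (Matrix.isUnit_iff_isUnit_det _).mpr (isUnit_iff_ne_zero.mpr hA)
  have hut : IsUnit Aᵀ := (Matrix.isUnit_iff_isUnit_det _).mpr
    (isUnit_iff_ne_zero.mpr (by rwa [Matrix.det_transpose]))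
  refine hu.mul_left_cancel (hut.mul_right_cancel ?_)
  rw [mul_one, ← h, Matrix.transpose_mul]
  simp only [mul_assoc]

theorem IsFlatCoordinates.jac_mul_mul_transpose {w : Fin 4 → ℂ} {d : ℂ}
    {G : (Fin 4 → ℂ) → Matrix (Fin 4) (Fin 4) ℂ} {U : Set (Fin 4 → ℂ)}
    {x : (Fin 4 → ℂ) → (Fin 4 → ℂ)} (hx : IsFlatCoordinates w d G U x) {t : Fin 4 → ℂ}
    (ht : t ∈ U) : jac x t * G t * (jac x t)ᵀ = 1 := by
  ext i j
  rw [← sum_sum_mul_pd_mul_pd, hx.orthonormal t ht, Matrix.one_apply]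

theorem IsFlatCoordinates.det_jac_ne_zero {w : Fin 4 → ℂ} {d : ℂ}
    {G : (Fin 4 → ℂ) → Matrix (Fin 4) (Fin 4) ℂ} {U : Set (Fin 4 → ℂ)}
    {x : (Fin 4 → ℂ) → (Fin 4 → ℂ)} (hx : IsFlatCoordinates w d G U x) {t : Fin 4 → ℂ}
    (ht : t ∈ U) : (jac x t).det ≠ 0 := by
  intro h
  have := congrArg Matrix.det (hx.jac_mul_mul_transpose ht)
  simp [Matrix.det_mul, h] at this

theorem IsFlatCoordinates.jac_mulVec {w : Fin 4 → ℂ} {d : ℂ}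
    {G : (Fin 4 → ℂ) → Matrix (Fin 4) (Fin 4) ℂ} {U : Set (Fin 4 → ℂ)}
    {x : (Fin 4 → ℂ) → (Fin 4 → ℂ)} (hx : IsFlatCoordinates w d G U x) {t : Fin 4 → ℂ}
    (ht : t ∈ U) : (jac x t) *ᵥ (fun l => w l * t l) = ((1 - d) / 2) • x t := by
  ext i
  rw [Pi.smul_apply, smul_eq_mul, ← hx.euler t ht i, Matrix.mulVec, dotProduct]
  exact Finset.sum_congr rfl fun l _ => mul_comm _ _

/-- The transition map x′ ∘ x⁻¹ preserves the complex dot product, so it is affine, and a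
translation would violate homogeneity of nonzero degree (1 − d)/2. -/
theorem IsFlatCoordinates.exists_orthogonal {w : Fin 4 → ℂ} {d : ℂ} (hd : d ≠ 1)
    {G : (Fin 4 → ℂ) → Matrix (Fin 4) (Fin 4) ℂ} {U V : Set (Fin 4 → ℂ)} (hU : IsOpen U)
    (hV : IsOpen V) (hVU : V ⊆ U) {x x' : (Fin 4 → ℂ) → (Fin 4 → ℂ)}
    (hx : IsFlatCoordinates w d G U x) (hx' : IsFlatCoordinates w d G V x') {t₀ : Fin 4 → ℂ}
    (ht₀ : t₀ ∈ V) :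
    ∃ R : Matrix (Fin 4) (Fin 4) ℂ, Rᵀ * R = 1 ∧ ∀ᶠ t in 𝓝 t₀, x' t = R *ᵥ x t := by
  have hdx : ∀ t ∈ V, DifferentiableAt ℂ x t := fun t ht =>
    (hx.holo t (hVU ht)).differentiableAt (hU.mem_nhds (hVU ht))
  have hdx' : ∀ t ∈ V, DifferentiableAt ℂ x' t := fun t ht =>
    (hx'.holo t ht).differentiableAt (hV.mem_nhds ht)
  obtain ⟨V₁, W, ψ, hV₁, ht₀₁, hV₁V, hW, hxm, hψm, hl, hr, hψ⟩ :=
    exists_local_inverse_of_differentiableOn hV (hx.holo.mono hVU) ht₀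
      (injective_fderiv_of_det_jac_ne_zero (hdx t₀ ht₀) (hx.det_jac_ne_zero (hVU ht₀)))
  obtain ⟨ε, hε, hball⟩ := Metric.isOpen_iff.mp hW (x t₀) (hxm ht₀₁)
  have hψd : ∀ z ∈ W, DifferentiableAt ℂ ψ z := fun z hz =>
    (hψ z hz).differentiableAt (hW.mem_nhds hz)
  have hf : ∀ z ∈ W, DifferentiableAt ℂ (fun z => x' (ψ z)) z := fun z hz =>
    (hdx' _ (hV₁V (hψm hz))).comp z (hψd z hz)
  have hort : ∀ z ∈ W, (jac (fun z => x' (ψ z)) z)ᵀ * jac (fun z => x' (ψ z)) z = 1 :=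
    fun z hz => by
    have ht := hψm hz
    have e1 : jac (fun z => x' (ψ z)) z * jac x (ψ z) = jac x' (ψ z) := by
      have h1 : jac (fun t => x' (ψ (x t))) (ψ z) =
          jac (fun z => x' (ψ z)) (x (ψ z)) * jac x (ψ z) :=
        jac_comp (f := fun z => x' (ψ z)) (by rw [hr hz]; exact hf z hz) (hdx _ (hV₁V ht))
      rw [hr hz] at h1
      rw [← h1]
      exact jac_congr (eventually_of_mem (hV₁.mem_nhds ht) fun s hs => by
        show x' (ψ (x s)) = x' s
        rw [hl hs])
    have e2 := hx'.jac_mul_mul_transpose (hV₁V ht)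
    rw [← e1, Matrix.transpose_mul] at e2
    rw [mul_eq_one_comm]
    calc _ = jac (fun z => x' (ψ z)) z * (jac x (ψ z) * G (ψ z) * (jac x (ψ z))ᵀ) *
          (jac (fun z => x' (ψ z)) z)ᵀ := by
          rw [hx.jac_mul_mul_transpose (hVU (hV₁V ht)), mul_one]
      _ = 1 := by rw [← e2]; simp only [mul_assoc]
  obtain ⟨b, hb⟩ := exists_eq_add_of_dotProduct_fderiv (f := fun z => x' (ψ z))
    Metric.isOpen_ball (convex_ball (x t₀) ε).isPreconnected
    (fun z hz => (hf z (hball hz)).differentiableWithinAt) (fun z hz u v => by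
      rw [fderiv_apply_eq_jac (hf z (hball hz)), fderiv_apply_eq_jac (hf z (hball hz)),
        Matrix.dotProduct_mulVec, Matrix.vecMul_mulVec, hort z (hball hz), Matrix.vecMul_one])
    (Metric.mem_ball_self hε)
  set R := jac (fun z => x' (ψ z)) (x t₀) with hR
  have hev : ∀ᶠ t in 𝓝 t₀, x' t = R *ᵥ x t + b := by
    have h1 : ∀ᶠ t in 𝓝 t₀, x t ∈ Metric.ball (x t₀) ε :=
      (hdx t₀ ht₀).continuousAt.eventually (Metric.ball_mem_nhds _ hε)
    filter_upwards [h1, hV₁.mem_nhds ht₀₁] with t h1 h2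
    have := hb _ h1
    simp only [hl h2] at this
    rw [this, fderiv_apply_eq_jac (hf _ (hxm ht₀₁))]
  refine ⟨R, hort _ (hxm ht₀₁), ?_⟩
  -- Differentiating x′ = Rx + b along E gives (1 − d)/2 · (Rx + b) = (1 − d)/2 · Rx.
  have hb0 : b = 0 := by
    have hRd : ∀ z, HasFDerivAt (fun z : Fin 4 → ℂ => R *ᵥ z + b)
        (LinearMap.toContinuousLinearMap (Matrix.mulVecLin R)) z := fun z =>
      (LinearMap.toContinuousLinearMap (Matrix.mulVecLin R)).hasFDerivAt.add_const b
    have e1 : fderiv ℂ x' t₀ = (LinearMap.toContinuousLinearMap (Matrix.mulVecLin R)).comp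
        (fderiv ℂ x t₀) := by
      rw [EventuallyEq.fderiv_eq hev]
      exact ((hRd (x t₀)).comp t₀ (hdx t₀ ht₀).hasFDerivAt).fderiv
    have e2 := DFunLike.congr_fun e1 (fun l => w l * t₀ l)
    rw [ContinuousLinearMap.comp_apply, fderiv_apply_eq_jac (hdx t₀ ht₀),
      fderiv_apply_eq_jac (hdx' t₀ ht₀), hx.jac_mulVec (hVU ht₀), hx'.jac_mulVec ht₀,
      hev.self_of_nhds] at e2
    simp only [map_smul, LinearMap.coe_toContinuousLinearMap', Matrix.mulVecLin_apply,
      smul_add, add_eq_left] at e2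
    refine (smul_eq_zero.mp e2).resolve_left ?_
    exact div_ne_zero (sub_ne_zero.mpr hd.symm) two_ne_zero
  simpa [hb0] using hev

/-! ### Existence of flat coordinates on a dense set. -/

section Branch

variable {U : Set (Fin 4 → ℂ)} {ζ : (Fin 4 → ℂ) → ℂ} {t : Fin 4 → ℂ}

theorem IsBranch.differentiableAt_Y (hζ : IsBranch U ζ) (ht : t ∈ U) :
    DifferentiableAt ℂ (fun s i => Y i s (ζ s)) t :=
  differentiableAt_pi.mpr fun i =>
    ((hζ.differentiableAt_eval ht (yE i)).const_mul (yScale i)).congr_of_eventuallyEq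
      (eventually_of_mem (hζ.isOpen.mem_nhds ht) fun _ hs => hζ.Y_eq hs i)

theorem IsBranch.jac_Y (hζ : IsBranch U ζ) (ht : t ∈ U) :
    jac (fun s i => Y i s (ζ s)) t * g ζ t * (jac (fun s i => Y i s (ζ s)) t)ᵀ =
      gram (fun i => Y i t (ζ t)) := by
  ext i j
  rw [← sum_sum_mul_pd_mul_pd, ← hζ.sum_g_pd_Y ht]

theorem yMap_three (x : Fin 4 → ℂ) : yMap x 3 = ∑ i, x i ^ 2 := by
  simp [yMap, y, y4Aux, h2, eps1, Fin.sum_univ_four]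
  ring

/-- Flat coordinates near a point at which the right-hand sides of the relations are a regular
value of the invariants. -/
theorem IsBranch.exists_isFlatCoordinates (hζ : IsBranch U ζ) (ht : t ∈ U)
    (hreg : (fun i => Y i t (ζ t)) ∈ regular) :
    ∃ V : Set (Fin 4 → ℂ), IsOpen V ∧ t ∈ V ∧ V ⊆ U ∧ ∃ x : (Fin 4 → ℂ) → (Fin 4 → ℂ),
      IsFlatCoordinates euler charge (g ζ) V x ∧ Set.InjOn x V ∧
        ∀ t ∈ V, ∀ i : Fin 4, y i (x t) = Y i t (ζ t) := by
  set Φ : (Fin 4 → ℂ) → Fin 4 → ℂ := fun s i => Y i s (ζ s) with hΦ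
  obtain ⟨x₀, hx₀⟩ := regular_subset_range_yMap hreg
  obtain ⟨V₁, W, ψ, -, hx₀V, -, hW, hym, hψm, -, hr, hψ⟩ := exists_local_inverse_of_differentiableOn
    isOpen_univ differentiable_yMap.differentiableOn (Set.mem_univ x₀)
    (injective_fderiv_of_det_jac_ne_zero (differentiable_yMap x₀)
      (det_jac_yMap_ne_zero (by rw [hx₀]; exact hreg)))
  have hΦc : ContinuousOn Φ U := fun s hs => (hζ.differentiableAt_Y hs).continuousAt.continuousWithinAt
  set V₂ := U ∩ Φ ⁻¹' (W ∩ regular) with hV₂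
  have hV₂o : IsOpen V₂ := hΦc.isOpen_inter_preimage hζ.isOpen (hW.inter isOpen_regular)
  have htV₂ : t ∈ V₂ := ⟨ht, by
    show Φ t ∈ W
    rw [show Φ t = yMap x₀ from hx₀.symm]
    exact hym hx₀V, hreg⟩
  set x : (Fin 4 → ℂ) → Fin 4 → ℂ := fun s => ψ (Φ s) with hx
  have hxd : ∀ s ∈ V₂, DifferentiableAt ℂ x s := fun s hs =>
    ((hψ _ hs.2.1).differentiableAt (hW.mem_nhds hs.2.1)).comp s (hζ.differentiableAt_Y hs.1)
  have hyx : ∀ s ∈ V₂, yMap (x s) = Φ s := fun s hs => hr hs.2.1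
  have horth : ∀ s ∈ V₂, jac x s * g ζ s * (jac x s)ᵀ = 1 := fun s hs => by
    refine mul_mul_transpose_eq_one_of_mul (A := jac yMap (x s))
      (det_jac_yMap_ne_zero (by rw [hyx s hs]; exact hs.2.2)) ?_
    rw [← jac_comp (differentiable_yMap _) (hxd s hs), jac_yMap_mul_transpose, hyx s hs,
      jac_congr (h := Φ) (eventually_of_mem (hV₂o.mem_nhds hs) hyx)]
    exact hζ.jac_Y hs.1
  have hflat : IsFlatCoordinates euler charge (g ζ) V₂ x := by
    refine ⟨fun s hs => (hxd s hs).differentiableWithinAt, fun s hs i j => ?_, fun s hs i => ?_⟩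
    · rw [sum_sum_mul_pd_mul_pd, horth s hs, Matrix.one_apply]
    · have h4 : ∀ r ∈ V₂, 20 * r 3 = ∑ j, x r j ^ 2 := fun r hr => by
        rw [← yMap_three, hyx r hr]
        simp [hΦ, Y, Y4]
      have hpd : ∀ m, 20 * (if m = 3 then 1 else 0) = ∑ j, 2 * x s j * pd m (fun r => x r j) s :=
        fun m => by
        have hj : ∀ j, HasFDerivAt (fun r => x r j) (fderiv ℂ (fun r => x r j) s) s := fun j =>
          (differentiableAt_pi.mp (hxd s hs) j).hasFDerivAt
        have h1 := HasFDerivAt.fun_sum (u := Finset.univ) fun j _ => (hj j).pow 2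
        have h2 := pd_congr hV₂o h4 hs m
        rw [pd_const_mul (hasFDerivAt_apply 3 s).differentiableAt, pd_coord, pd, h1.fderiv] at h2
        rw [h2]
        simp [pd]
      -- Both sides of d(∑ xⱼ²) = 20 dt₄ are paired with dxᵢ. Orthonormality turns the left side
      -- into 2xᵢ, and g^{l4} = Eˡ turns the right side into 20 E(xᵢ); hence E(xᵢ) = xᵢ/10 = (1 −
      -- d)/2 · xᵢ.
      have h5 : ∑ j, 2 * x s j * ∑ l, ∑ m, g ζ s l m * pd l (fun r => x r i) s *
          pd m (fun r => x r j) s =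
          ∑ l, ∑ m, g ζ s l m * pd l (fun r => x r i) s * (20 * if m = 3 then 1 else 0) := by
        simp only [hpd, Finset.mul_sum]
        rw [Finset.sum_comm]
        refine Finset.sum_congr rfl fun l _ => ?_
        rw [Finset.sum_comm]
        exact Finset.sum_congr rfl fun m _ => Finset.sum_congr rfl fun j _ => by ring
      simp only [sum_sum_mul_pd_mul_pd, horth s hs, Matrix.one_apply] at h5
      simp [hζ.g_three hs.1] at h5
      have h6 : ∀ l, euler l * s l * pd l (fun r => x r i) s * 20 =
          20 * (euler l * s l * pd l (fun r => x r i) s) := fun l => mul_comm _ _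
      simp only [h6, ← Finset.mul_sum] at h5
      rw [charge]
      linear_combination -h5 / 20
  -- Orthonormality makes the Jacobian of x invertible, so x is injective on a smaller
  -- neighbourhood.
  obtain ⟨V, W', ψ', hV, htV, hVV₂, -, -, -, hl, -, -⟩ := exists_local_inverse_of_differentiableOn
    hV₂o hflat.holo htV₂ (injective_fderiv_of_det_jac_ne_zero (hxd t htV₂)
      (hflat.det_jac_ne_zero htV₂))
  refine ⟨V, hV, htV, fun s hs => (hVV₂ hs).1, x, ⟨hflat.holo.mono hVV₂,
    fun s hs => hflat.orthonormal s (hVV₂ hs), fun s hs => hflat.euler s (hVV₂ hs)⟩, hl.injOn,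
    fun s hs i => congrFun (hyx s (hVV₂ hs)) i⟩

theorem IsBranch.differentiableAt_chart (hζ : IsBranch U ζ) (ht : t ∈ U) :
    DifferentiableAt ℂ (chart ζ) t :=
  differentiableAt_pi.mpr fun k => (hζ.hasFDerivAt_chart ht k).differentiableAt

/-- The differential of t₂ is a combination of dZ, dt₃ and dt₄, so nothing is lost when Z replaces
t₂. -/
theorem IsBranch.injective_fderiv_chart (hζ : IsBranch U ζ) (ht : t ∈ U) :
    Function.Injective (fderiv ℂ (chart ζ) t) := by
  rw [injective_iff_map_eq_zero]
  intro v hv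
  have hk : HasFDerivAt (chart ζ) _ t :=
    (hasFDerivAt_pi (φ := fun k s => chart ζ s k)).mpr (hζ.hasFDerivAt_chart ht)
  rw [hk.fderiv] at hv
  have h0 : v 0 = 0 := congrFun hv 0
  have h1 : fderiv ℂ ζ t v = 0 := congrFun hv 1
  have h2 : v 2 = 0 := congrFun hv 2
  have h3 : v 3 = 0 := congrFun hv 3
  have h4 := hζ.fderiv_mul ht v
  rw [h1, h2, h3] at h4
  ext k
  fin_cases k
  · exact h0
  · show v 1 = 0
    linear_combination -h4
  · exact h2
  · exact h3

/-- At t₁ = 1 and Z = t₃ = t₄ = 0 all right-hand sides vanish except that for y₂, and `gram` then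
has a single nonzero entry in each row. -/
theorem exists_yE_mem_regular : (fun i => yScale i * (yE i).eval ![1, 0, 0, 0]) ∈ regular := by
  have h1 : ∀ i, (yE i).eval (![1, 0, 0, 0] : Fin 4 → ℤ) = (![0, 1, 0, 0] : Fin 4 → ℤ) i := by
    decide +kernel
  have h2 : (fun i => yScale i * (yE i).eval ![1, 0, 0, 0]) = ![0, yScale 1, 0, 0] := by
    ext i
    have h3 := map_eval (![1, 0, 0, 0] : Fin 4 → ℤ) (Int.castRingHom ℂ) (yE i)
    have h4 : (fun i => Int.castRingHom ℂ ((![1, 0, 0, 0] : Fin 4 → ℤ) i)) = ![1, 0, 0, 0] := by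
      ext k
      fin_cases k <;> simp
    rw [← h4, ← h3, h1]
    fin_cases i <;> simp
  rw [h2, regular, Set.mem_ofPred_eq, det_gram_of_single]
  norm_num [yScale]

/-- In the coordinates (t₁, Z, t₃, t₄) the function det `gram`(Y) extends to a polynomial on ℂ⁴. If
it vanished near a point of U it would vanish on an open subset of ℂ⁴ and hence everywhere, which
the point (1, 0, 0, 0) excludes. -/
theorem IsBranch.subset_closure_regular (hζ : IsBranch U ζ) :
    U ⊆ closure {t ∈ U | (fun i => Y i t (ζ t)) ∈ regular} := by
  intro t₁ ht₁
  rw [mem_closure_iff_nhds]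
  intro N hN
  by_contra hne
  obtain ⟨V, W, ψ, -, ht₁V, hVN, hW, hcm, hψm, -, hr, -⟩ :=
    exists_local_inverse_of_differentiableOn (f := chart ζ) (isOpen_interior (s := N ∩ U))
      (fun s hs => (hζ.differentiableAt_chart (interior_subset hs).2).differentiableWithinAt)
      (mem_interior_iff_mem_nhds.mpr (inter_mem hN (hζ.isOpen.mem_nhds ht₁)))
      (hζ.injective_fderiv_chart ht₁)
  have hd : ∀ p : PolyExpr, Differentiable ℂ fun u => p.eval u := fun p u =>
    (H44.hasFDerivAt_eval (fun k => hasFDerivAt_apply k u) p).differentiableAt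
  refine exists_yE_mem_regular (eq_zero_of_differentiableOn_of_eventually_eq_zero
    (f := fun u => (gram fun i => yScale i * (yE i).eval u).det) isOpen_univ isPreconnected_univ
    (Differentiable.differentiableOn (differentiable_det_gram.comp
      (differentiable_pi.mpr fun i => (hd _).const_mul _))) (Set.mem_univ (chart ζ t₁))
    (eventually_of_mem (hW.mem_nhds (hcm ht₁V)) fun u hu => ?_) (Set.mem_univ _))
  have hs := interior_subset (hVN (hψm hu))
  by_contra hu0
  refine hne ⟨ψ u, hs.1, hs.2, ?_⟩
  rw [funext fun i => hζ.Y_eq hs.2 i, hr hu]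
  exact hu0

end Branch

end H44

theorem mainTheorem8 :
    -- Every system of flat coordinates of the intersection form satisfies the relations, after
    -- an orthogonal change of the flat coordinates.
    (∀ (U : Set (Fin 4 → ℂ)) (ζ : (Fin 4 → ℂ) → ℂ), H44.IsBranch U ζ → IsConnected U →
      ∀ x : (Fin 4 → ℂ) → (Fin 4 → ℂ),
        H44.IsFlatCoordinates H44.euler H44.charge (H44.g ζ) U x →
        ∃ R : Matrix (Fin 4) (Fin 4) ℂ, Rᵀ * R = 1 ∧
          ∀ t ∈ U, ∀ i : Fin 4, H44.y i (R *ᵥ x t) = H44.Y i t (ζ t)) ∧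
    -- Flat coordinates satisfying the relations exist near the points of a dense open set.
    (∀ (U : Set (Fin 4 → ℂ)) (ζ : (Fin 4 → ℂ) → ℂ), H44.IsBranch U ζ →
      U ⊆ closure {t₀ | ∃ V : Set (Fin 4 → ℂ), IsOpen V ∧ t₀ ∈ V ∧ V ⊆ U ∧
        ∃ x : (Fin 4 → ℂ) → (Fin 4 → ℂ),
          H44.IsFlatCoordinates H44.euler H44.charge (H44.g ζ) V x ∧ Set.InjOn x V ∧
          ∀ t ∈ V, ∀ i : Fin 4, H44.y i (x t) = H44.Y i t (ζ t)}) ∧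
    -- Compatibility: the intersection form transformed from the `t` coordinates to the `y`
    -- coordinates agrees with the matrix of scalar products of the gradients of the `yᵢ(x)`.
    (∀ (U : Set (Fin 4 → ℂ)) (ζ : (Fin 4 → ℂ) → ℂ), H44.IsBranch U ζ →
      ∀ t ∈ U, ∀ x₀ : Fin 4 → ℂ, (∀ i : Fin 4, H44.y i x₀ = H44.Y i t (ζ t)) →
        ∀ i j : Fin 4,
          ∑ l, ∑ m, H44.g ζ t l m * H44.pd l (fun s => H44.Y i s (ζ s)) t *
              H44.pd m (fun s => H44.Y j s (ζ s)) t =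
            ∑ a, H44.pd a (H44.y i) x₀ * H44.pd a (H44.y j) x₀) := by
  have dense : ∀ (U : Set (Fin 4 → ℂ)) (ζ : (Fin 4 → ℂ) → ℂ), H44.IsBranch U ζ →
      U ⊆ closure {t₀ | ∃ V : Set (Fin 4 → ℂ), IsOpen V ∧ t₀ ∈ V ∧ V ⊆ U ∧
        ∃ x : (Fin 4 → ℂ) → (Fin 4 → ℂ),
          H44.IsFlatCoordinates H44.euler H44.charge (H44.g ζ) V x ∧ Set.InjOn x V ∧
          ∀ t ∈ V, ∀ i : Fin 4, H44.y i (x t) = H44.Y i t (ζ t)} := fun U ζ hζ =>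
    hζ.subset_closure_regular.trans
      (closure_mono fun _ ht => hζ.exists_isFlatCoordinates ht.1 ht.2)
  refine ⟨fun U ζ hζ hU x hx => ?_, dense, fun U ζ hζ t ht x₀ hx₀ i j => ?_⟩
  · obtain ⟨t₁, ht₁⟩ := hU.nonempty
    -- By density some point of U has nearby flat coordinates x′ satisfying the relations; x is
    -- compared with these.
    obtain ⟨t₀, -, V, hV, ht₀, hVU, x', hx', -, hy⟩ :=
      mem_closure_iff.mp (dense U ζ hζ ht₁) U hζ.isOpen ht₁
    obtain ⟨R, hR, hev⟩ := H44.IsFlatCoordinates.exists_orthogonal (by norm_num [H44.charge])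
      hζ.isOpen hV hVU hx hx' ht₀
    refine ⟨R, hR, fun t ht i => sub_eq_zero.mp ?_⟩
    -- Near t₀ the relations hold since Rx = x′ there; connectedness of U spreads them.
    refine eq_zero_of_differentiableOn_of_eventually_eq_zero
      (f := fun t => H44.y i (R *ᵥ x t) - H44.Y i t (ζ t)) hζ.isOpen hU.isPreconnected
      (fun s hs => ?_) (hVU ht₀) ?_ ht
    · have h1 : DifferentiableAt ℂ (fun s => R *ᵥ x s) s :=
        (LinearMap.toContinuousLinearMap (Matrix.mulVecLin R)).differentiableAt.comp s
          ((hx.holo s hs).differentiableAt (hζ.isOpen.mem_nhds hs))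
      have h2 : DifferentiableAt ℂ (fun s => H44.y i (R *ᵥ x s)) s :=
        (H44.hasFDerivAt_y _ i).differentiableAt.comp s h1
      exact (h2.sub (differentiableAt_pi.mp (hζ.differentiableAt_Y hs) i)).differentiableWithinAt
    · filter_upwards [hev, hV.mem_nhds ht₀] with s hs hsV
      rw [← hs, hy s hsV, sub_self]
  -- Both sides are the matrix `gram`, evaluated at Y(t) and at y(x₀), which agree.
  rw [hζ.sum_g_pd_Y ht, H44.sum_pd_y]
  simp only [hx₀]
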